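/- **Setting.** Let $d>4$ be an integer, fix $\delta\in(0,1\wedge\frac{d-4}{4})$, and let $L>0$, $\beta=L^{-d}$. Let $f_n(k;z),e_n(k;z),g_n(k;z)$ be real functions of $k\in[-\pi,\pi]^d$, $z>0$, with $f_0=1$ and $$f_{n+1}(k;z)=\sum_{m=1}^{n+1}g_m(k;z)f_{n+1-m}(k;z)+e_{n+1}(k;z)\qquad(n\ge 0),$$ and let $D=D_L$ be a non-negative function on $\mathbb Z^d$. Write $\hat D(k)=\sum_{x\in\mathbb Z^d}D(x)e^{ik\cdot x}$, $a(k)=1-\hat D(k)$, $\sigma^2=-\nabla^2\hat D(0)$ and $\|h\|_1=(2\pi)^{-d}\int_{[-\pi,\pi]^d}|h(k)|\,dk$; $\nabla^2$ is the Laplacian in $k$. Fix constants $C$, $c_1,c_2,\eta>0$, $\epsilon>\delta$, and functions $C_e(K),C_g(K),L_e(K,\alpha),L_g(K,\alpha)$, none of them depending on $L$. Assume: * **S.** For all $n\ge1$ and $z>0$, the functions $f_n(\cdot;z),e_n(\cdot;z),g_n(\cdot;z)$ are invariant under sign changes and permutations of the components of $k$, and $f_n(\cdot;z)$ is twice differentiable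 at $k=0$. For each $n$, $|f_n(k;z)|$ is bounded uniformly in $k\in[-\pi,\pi]^d$ and in $z$ in a neighbourhood of $1$ (which may depend on $n$). * **D.** $f_1(k;z)=z\hat D(k)$, $e_1(k;z)=0$, $\hat D(0)=1$, $\sum_x|x|^{2+2\epsilon}D(x)<\infty$, $\|D\|_\infty\le CL^{-d}$, $\sigma^2\le CL^2$; $c_1L^2k^2\le a(k)\le c_2L^2k^2$ for $\|k\|_\infty\le L^{-1}$; and, for $k\in[-\pi,\pi]^d$, $a(k)>\eta$ if $\|k\|_\infty\ge L^{-1}$, and $a(k)<2-\eta$. * **E and G.** Let $K>1$, $\alpha\in(0,1)$, $n\in\mathbb N$, let $I\subset[1-\alpha,1+\alpha]$ be a closed interval of positive length, and suppose that for all $z\in I$ and $1\le m\le n$ $$\|\hat D^2f_m(\cdot;z)\|_1\le K\beta m^{-d/2},\qquad |f_m(0;z)|\le K,\qquad |\nabla^2f_m(0;z)|\le K\sigma^2m .$$ Then for all $z\in I$, $k\in[-\pi,\pi]^d$ and $2\le m\le n+1$: (E) if $L\ge L_e(K,\alpha)$, then $|e_m(k;z)|\le C_e(K)\beta m^{-d/2}$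 and $|e_m(k;z)-e_m(0;z)|\le C_e(K)a(k)\beta m^{-(d-2)/2}$; (G) if $L\ge L_g(K,\alpha)$, then $g_m(\cdot;z)$ is twice differentiable at $0$, $g_m(0;\cdot)$ is differentiable at $z$, and $|g_m(k;z)|\le C_g(K)\beta m^{-d/2}$, $|\nabla^2g_m(0;z)|\le C_g(K)\sigma^2\beta m^{-(d-2)/2}$, $|\partial_zg_m(0;z)|\le C_g(K)\beta m^{-(d-2)/2}$, and $|g_m(k;z)-g_m(0;z)-a(k)\sigma^{-2}\nabla^2g_m(0;z)|\le C_g(K)\beta a(k)^{1+\epsilon'}m^{-(d-2-2\epsilon')/2}$ for every $\epsilon'\in[0,\epsilon]$. **Theorem.** There are $L_0>0$, $\gamma>0$ and $B>0$, depending only on $d$, $\delta$, $C,c_1,c_2,\eta,\epsilon$ and the functions $C_e,C_g,L_e,L_g$, such that for every $L\ge L_0$ and all $D,f,e,g$ that satisfy the above there exist $z_c,A,v>0$ with $$|z_c-1|\le B\beta,\qquad |A-1|\le B\beta,\qquad |v-1|\le B\beta,$$ for which the following hold for all $n\ge1$. (a) There is a constant $B'$, independent of $n$ and $k$ (it may depend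 on $L$ and on $D,f,e,g$), such that for all $k\in\mathbb R^d$ with $k/\sqrt{v\sigma^2n}\in[-\pi,\pi]^d$ and $a(k/\sqrt{v\sigma^2n})\le\gamma n^{-1}\log n$, $$f_n\Big(\frac{k}{\sqrt{v\sigma^2n}};z_c\Big)=Ae^{-k^2/2d}\,[1+R_n(k)],\qquad |R_n(k)|\le B'\big(k^2n^{-\delta}+n^{-(d-4)/2}\big).$$ (b) $f_n(0;z_c)\ne0$ and $$-\frac{\nabla^2f_n(0;z_c)}{f_n(0;z_c)}=v\sigma^2n\,[1+r_n],\qquad |r_n|\le B\beta n^{-\delta}.$$ (c) $\|\hat D^2f_n(\cdot;z_c)\|_1\le B\beta n^{-d/2}$. -/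

import Mathlib

open Set Filter Topology MeasureTheory
open scoped ENNReal

namespace LaceRecursion

/-- The cube `[-π, π]^d`, as a subset of `ℝ^d` with the Euclidean norm. -/
def box (d : ℕ) : Set (EuclideanSpace ℝ (Fin d)) :=
  {k | ∀ i, k i ∈ Icc (-Real.pi) Real.pi}

/-- A lattice point of `ℤ^d`, seen in `ℝ^d`. -/
noncomputable def latticeVec {d : ℕ} (x : Fin d → ℤ) : EuclideanSpace ℝ (Fin d) :=
  WithLp.toLp 2 (fun i => (x i : ℝ))

/-- The Fourier transform `∑_x h(x) e^{i k·x}` of a function on `ℤ^d`. -/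
noncomputable def fourierZd {d : ℕ} (h : (Fin d → ℤ) → ℝ)
    (k : EuclideanSpace ℝ (Fin d)) : ℂ :=
  ∑' x : Fin d → ℤ, (h x : ℂ) * Complex.exp (Complex.I * ((inner ℝ k (latticeVec x) : ℝ) : ℂ))

/-- `D̂(k)` as a real number. Under `AssumptionD` the complex number `fourierZd D k` is real
on the cube, because `z * fourierZd D k` is the real number `f₁(k; z)`. -/
noncomputable def Dhat {d : ℕ} (D : (Fin d → ℤ) → ℝ) (k : EuclideanSpace ℝ (Fin d)) : ℝ :=
  (fourierZd D k).re

/-- `a(k) = 1 - D̂(k)`. -/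
noncomputable def aFun {d : ℕ} (D : (Fin d → ℤ) → ℝ) (k : EuclideanSpace ℝ (Fin d)) : ℝ :=
  1 - Dhat D k

/-- `σ² = -∇² D̂(0)`. -/
noncomputable def sigmaSq {d : ℕ} (D : (Fin d → ℤ) → ℝ) : ℝ :=
  -(Laplacian.laplacian (Dhat D) 0)

/-- The small parameter `β = L^{-d}`. -/
noncomputable def beta (d : ℕ) (L : ℝ) : ℝ := (L ^ d)⁻¹

/-- `‖h‖₁ = (2π)^{-d} ∫_{[-π,π]^d} |h(k)| dk`, with values in `[0, ∞]`. -/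
noncomputable def normOne {d : ℕ} (h : EuclideanSpace ℝ (Fin d) → ℝ) : ℝ≥0∞ :=
  ENNReal.ofReal (((2 * Real.pi) ^ d)⁻¹) * ∫⁻ k in box d, ENNReal.ofReal |h k|

/-- `h` is twice differentiable at `x`, so that `∇² h(x)` exists. -/
def TwiceDifferentiableAt {d : ℕ} (h : EuclideanSpace ℝ (Fin d) → ℝ)
    (x : EuclideanSpace ℝ (Fin d)) : Prop :=
  (∀ᶠ y in 𝓝 x, DifferentiableAt ℝ h y) ∧ DifferentiableAt ℝ (fderiv ℝ h) x

/-- Invariance, on the cube, under sign changes and permutations of the components. -/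
def LatticeSymmetric {d : ℕ} (h : EuclideanSpace ℝ (Fin d) → ℝ) : Prop :=
  (∀ k ∈ box d, ∀ i : Fin d,
    h (WithLp.toLp 2 (fun j => if j = i then -(k j) else k j)) = h k) ∧
  (∀ k ∈ box d, ∀ τ : Equiv.Perm (Fin d), h (WithLp.toLp 2 (fun j => k (τ j))) = h k)

/-- Functions `f_n(k; z)`, `e_n(k; z)`, `g_n(k; z)` with `f_0 = 1` and
`f_{n+1} = ∑_{m=1}^{n+1} g_m f_{n+1-m} + e_{n+1}` for `n ≥ 0`, `k ∈ [-π,π]^d`, `z > 0`.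
Values at other arguments, and `e_0`, `g_0`, play no role. -/
structure Recursion (d : ℕ) where
  f : ℕ → EuclideanSpace ℝ (Fin d) → ℝ → ℝ
  e : ℕ → EuclideanSpace ℝ (Fin d) → ℝ → ℝ
  g : ℕ → EuclideanSpace ℝ (Fin d) → ℝ → ℝ
  f_zero : ∀ k ∈ box d, ∀ z : ℝ, 0 < z → f 0 k z = 1
  f_succ : ∀ n : ℕ, ∀ k ∈ box d, ∀ z : ℝ, 0 < z →
    f (n + 1) k z = (∑ m ∈ Finset.Icc 1 (n + 1), g m k z * f (n + 1 - m) k z) + e (n + 1) k z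

/-- Assumption S: lattice symmetry of `f_n`, `e_n`, `g_n`, and, for each `n`, boundedness of `f_n`
uniformly in `k` and in `z` near `1`. The field `smooth` is the existence of `∇² f_n(0; z)`, which
the bounds on `f_n` presuppose. -/
structure AssumptionS {d : ℕ} (R : Recursion d) : Prop where
  symm_f : ∀ n : ℕ, 1 ≤ n → ∀ z : ℝ, 0 < z → LatticeSymmetric (fun k => R.f n k z)
  symm_e : ∀ n : ℕ, 1 ≤ n → ∀ z : ℝ, 0 < z → LatticeSymmetric (fun k => R.e n k z)
  symm_g : ∀ n : ℕ, 1 ≤ n → ∀ z : ℝ, 0 < z → LatticeSymmetric (fun k => R.g n k z)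
  bounded : ∀ n : ℕ, 1 ≤ n → ∃ M : ℝ, ∀ᶠ z in 𝓝 (1 : ℝ), ∀ k ∈ box d, |R.f n k z| ≤ M
  smooth : ∀ n : ℕ, 1 ≤ n → ∀ z : ℝ, 0 < z → TwiceDifferentiableAt (fun k => R.f n k z) 0

/-- Assumption D for the step distribution `D = D_L`, with constants
`C`, `c₁`, `c₂`, `η`, `ε` that do not depend on `L`. -/
structure AssumptionD {d : ℕ} (C c₁ c₂ η ε L : ℝ) (D : (Fin d → ℤ) → ℝ) (R : Recursion d) :
    Prop where
  nonneg : ∀ x, 0 ≤ D x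
  f_one : ∀ k ∈ box d, ∀ z : ℝ, 0 < z → (R.f 1 k z : ℂ) = (z : ℂ) * fourierZd D k
  e_one : ∀ k ∈ box d, ∀ z : ℝ, 0 < z → R.e 1 k z = 0
  normalised : fourierZd D 0 = 1
  moment : Summable (fun x => ‖latticeVec x‖ ^ (2 + 2 * ε) * D x)
  sup_le : ∀ x, D x ≤ C * (L ^ d)⁻¹
  sigmaSq_le : sigmaSq D ≤ C * L ^ 2
  a_lower : ∀ k : EuclideanSpace ℝ (Fin d), (∀ i, |k i| ≤ L⁻¹) →
    c₁ * L ^ 2 * ‖k‖ ^ 2 ≤ aFun D k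
  a_upper : ∀ k : EuclideanSpace ℝ (Fin d), (∀ i, |k i| ≤ L⁻¹) →
    aFun D k ≤ c₂ * L ^ 2 * ‖k‖ ^ 2
  a_gt : ∀ k ∈ box d, (∃ i, L⁻¹ ≤ |k i|) → η < aFun D k
  a_lt : ∀ k ∈ box d, aFun D k < 2 - η

/-- The bounds `‖D̂² f_m(·;z)‖₁ ≤ Kβm^{-d/2}`, `|f_m(0;z)| ≤ K`, `|∇² f_m(0;z)| ≤ Kσ²m`. -/
structure FBounds {d : ℕ} (L : ℝ) (D : (Fin d → ℤ) → ℝ) (R : Recursion d) (K : ℝ)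
    (m : ℕ) (z : ℝ) : Prop where
  norm_le : normOne (fun k => Dhat D k ^ 2 * R.f m k z) ≤
    ENNReal.ofReal (K * beta d L * (m : ℝ) ^ (-(d : ℝ) / 2))
  zero_le : |R.f m 0 z| ≤ K
  laplacian_le : |Laplacian.laplacian (fun k => R.f m k z) 0| ≤ K * sigmaSq D * m

/-- Assumption E at the value `L` of the parameter. The constant `Ce K` depends on `K` alone and
the threshold `LE K α` on `K` and `α`; neither depends on `n`, on the interval `[s, t]`
or on `L`. -/
def AssumptionE {d : ℕ} (Ce : ℝ → ℝ) (LE : ℝ → ℝ → ℝ) (L : ℝ) (D : (Fin d → ℤ) → ℝ)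
    (R : Recursion d) : Prop :=
  ∀ K : ℝ, 1 < K → ∀ α ∈ Ioo (0 : ℝ) 1, LE K α ≤ L →
  ∀ s t : ℝ, s < t → Icc s t ⊆ Icc (1 - α) (1 + α) → ∀ n : ℕ,
  (∀ z ∈ Icc s t, ∀ m : ℕ, 1 ≤ m → m ≤ n → FBounds L D R K m z) →
  ∀ z ∈ Icc s t, ∀ k ∈ box d, ∀ m : ℕ, 2 ≤ m → m ≤ n + 1 →
    |R.e m k z| ≤ Ce K * beta d L * (m : ℝ) ^ (-(d : ℝ) / 2) ∧
    |R.e m k z - R.e m 0 z| ≤ Ce K * aFun D k * beta d L * (m : ℝ) ^ (-((d : ℝ) - 2) / 2)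

/-- Assumption G at the value `L` of the parameter, with `Cg K` and `LG K α` as in
`AssumptionE`. The derivatives that are bounded are part of the conclusion: they exist. -/
def AssumptionG {d : ℕ} (ε : ℝ) (Cg : ℝ → ℝ) (LG : ℝ → ℝ → ℝ) (L : ℝ) (D : (Fin d → ℤ) → ℝ)
    (R : Recursion d) : Prop :=
  ∀ K : ℝ, 1 < K → ∀ α ∈ Ioo (0 : ℝ) 1, LG K α ≤ L →
  ∀ s t : ℝ, s < t → Icc s t ⊆ Icc (1 - α) (1 + α) → ∀ n : ℕ,
  (∀ z ∈ Icc s t, ∀ m : ℕ, 1 ≤ m → m ≤ n → FBounds L D R K m z) →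
  ∀ z ∈ Icc s t, ∀ m : ℕ, 2 ≤ m → m ≤ n + 1 →
    (∀ k ∈ box d, |R.g m k z| ≤ Cg K * beta d L * (m : ℝ) ^ (-(d : ℝ) / 2)) ∧
    TwiceDifferentiableAt (fun k => R.g m k z) 0 ∧
    |Laplacian.laplacian (fun k => R.g m k z) 0| ≤
      Cg K * sigmaSq D * beta d L * (m : ℝ) ^ (-((d : ℝ) - 2) / 2) ∧
    DifferentiableAt ℝ (fun w => R.g m 0 w) z ∧
    |deriv (fun w => R.g m 0 w) z| ≤ Cg K * beta d L * (m : ℝ) ^ (-((d : ℝ) - 2) / 2) ∧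
    (∀ k ∈ box d, ∀ ε' ∈ Icc (0 : ℝ) ε,
      |R.g m k z - R.g m 0 z -
          aFun D k * (sigmaSq D)⁻¹ * Laplacian.laplacian (fun k => R.g m k z) 0| ≤
        Cg K * beta d L * aFun D k ^ (1 + ε') * (m : ℝ) ^ (-((d : ℝ) - 2 - 2 * ε') / 2))

end LaceRecursion

namespace LaceRecursion

/-- The sum `∑_{m ≥ 1} m^{-p}`. -/
noncomputable def zetaSum (p : ℝ) : ℝ := ∑' m : ℕ, (m : ℝ) ^ (-p)

theorem sum_rpow_le_zetaSum {p : ℝ} (hp : 1 < p) (S : Finset ℕ) :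
    ∑ m ∈ S, (m : ℝ) ^ (-p) ≤ zetaSum p :=
  Summable.sum_le_tsum S (fun _ _ => by positivity)
    (Real.summable_nat_rpow.2 (by linarith))

theorem one_le_zetaSum {p : ℝ} (hp : 1 < p) : 1 ≤ zetaSum p := by
  simpa using sum_rpow_le_zetaSum hp {1}

theorem sum_Ico_succ_rpow_le_zetaSum {p : ℝ} (hp : 1 < p) (i n : ℕ) :
    ∑ j ∈ Finset.Ico i n, ((j : ℝ) + 1) ^ (-p) ≤ zetaSum p := by
  have h := sum_rpow_le_zetaSum hp (Finset.Ico (i + 1) (n + 1))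
  rw [← Finset.sum_Ico_add'] at h
  simpa using h

/-- The decreasing function `(1 + log x) / x`. -/
noncomputable def logRatio (x : ℝ) : ℝ := (1 + Real.log x) / x

theorem logRatio_anti {x y : ℝ} (hx : 1 ≤ x) (hxy : x ≤ y) : logRatio y ≤ logRatio x := by
  have hx0 : 0 < x := by linarith
  have hy0 : 0 < y := by linarith
  have hl : 0 ≤ Real.log x := Real.log_nonneg hx
  have h1 : Real.log y - Real.log x ≤ y / x - 1 := by
    rw [← Real.log_div hy0.ne' hx0.ne']
    exact Real.log_le_sub_one_of_pos (by positivity)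
  have h2 : x * (Real.log y - Real.log x) ≤ y - x := by
    calc x * (Real.log y - Real.log x) ≤ x * (y / x - 1) := by gcongr
      _ = y - x := by field_simp
  unfold logRatio
  rw [div_le_div_iff₀ hy0 hx0]
  nlinarith

theorem logRatio_one : logRatio 1 = 1 := by simp [logRatio]

theorem logRatio_le_one {x : ℝ} (hx : 1 ≤ x) : logRatio x ≤ 1 := by
  simpa [logRatio_one] using logRatio_anti le_rfl hx

theorem inv_le_logRatio {x : ℝ} (hx : 1 ≤ x) : x⁻¹ ≤ logRatio x := by
  unfold logRatio
  rw [inv_eq_one_div]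
  have := Real.log_nonneg hx
  gcongr
  linarith

theorem logRatio_pos {x : ℝ} (hx : 1 ≤ x) : 0 < logRatio x :=
  (by positivity : (0 : ℝ) < x⁻¹).trans_le (inv_le_logRatio hx)

theorem mul_le_of_le_logRatio {a γ x y : ℝ} (hγ : 0 ≤ γ) (hx : 1 ≤ x) (hxy : x ≤ y)
    (ha : a ≤ γ * logRatio y) : a * x ≤ γ * (1 + Real.log x) := by
  have hx0 : 0 < x := by linarith
  calc a * x ≤ γ * logRatio x * x := by
        gcongr
        exact ha.trans (mul_le_mul_of_nonneg_left (logRatio_anti hx hxy) hγ)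
    _ = γ * (1 + Real.log x) := by unfold logRatio; field_simp

theorem one_add_log_le {x κ : ℝ} (hx : 1 ≤ x) (hκ : 0 < κ) :
    1 + Real.log x ≤ (1 + 1 / κ) * x ^ κ := by
  have h1 := Real.log_le_rpow_div (by linarith : 0 ≤ x) hκ
  have h2 : 1 ≤ x ^ κ := Real.one_le_rpow hx hκ.le
  calc 1 + Real.log x ≤ x ^ κ + x ^ κ / κ := by linarith
    _ = _ := by ring

/-- In the region `a ≤ logRatio x`, `a^s` is at most a multiple of `x^{-δ}` for `δ < s`. -/
theorem rpow_le_of_le_logRatio {a x s δ : ℝ} (ha : 0 ≤ a) (hx : 1 ≤ x) (hδ : δ < s)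
    (hs : 0 < s) (hax : a ≤ logRatio x) :
    a ^ s ≤ (1 + s / (s - δ)) ^ s * x ^ (-δ) := by
  have hx0 : 0 < x := by linarith
  have hκ : 0 < (s - δ) / s := div_pos (by linarith) hs
  have h1 : a ≤ (1 + s / (s - δ)) * x ^ (-δ / s) := by
    refine hax.trans ?_
    have h2 := one_add_log_le hx hκ
    unfold logRatio
    rw [div_le_iff₀ hx0]
    refine h2.trans (le_of_eq ?_)
    rw [one_div_div, mul_assoc, ← Real.rpow_add_one hx0.ne']
    congr 2
    field_simp
    ring
  have h3 : 0 ≤ 1 + s / (s - δ) := by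
    have : 0 < s / (s - δ) := div_pos hs (by linarith)
    linarith
  calc a ^ s ≤ ((1 + s / (s - δ)) * x ^ (-δ / s)) ^ s := Real.rpow_le_rpow ha h1 hs.le
    _ = _ := by
      rw [Real.mul_rpow h3 (by positivity), ← Real.rpow_mul hx0.le]
      congr 2
      field_simp

theorem exp_four_mul_le {a γ x y τ : ℝ} (hγ : 0 ≤ γ) (hγ1 : γ ≤ 1 / 8) (hγτ : 4 * γ ≤ τ)
    (hx : 1 ≤ x) (hxy : x ≤ y) (ha : a ≤ γ * logRatio y) :
    Real.exp (4 * (a * x)) ≤ 2 * x ^ τ := by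
  have hx0 : 0 < x := by linarith
  have h1 := mul_le_of_le_logRatio hγ hx hxy ha
  have hl := Real.log_nonneg hx
  calc Real.exp (4 * (a * x)) ≤ Real.exp (1 / 2 + τ * Real.log x) := by
        apply Real.exp_le_exp.2
        nlinarith
    _ = Real.exp (1 / 2) * x ^ τ := by
        rw [Real.exp_add, Real.rpow_def_of_pos hx0, mul_comm τ]
    _ ≤ 2 * x ^ τ := by
        gcongr
        have h2 := Real.exp_one_lt_d9
        have h3 : Real.exp (1 / 2) * Real.exp (1 / 2) = Real.exp 1 := by
          rw [← Real.exp_add]; norm_num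
        nlinarith [Real.exp_pos (1 / 2 : ℝ)]

theorem rpow_neg_le_rpow_neg {x p q : ℝ} (hx : 1 ≤ x) (h : p ≤ q) : x ^ (-q) ≤ x ^ (-p) :=
  Real.rpow_le_rpow_of_exponent_le hx (by linarith)

theorem rpow_neg_le_one {x p : ℝ} (hx : 1 ≤ x) (h : 0 ≤ p) : x ^ (-p) ≤ 1 :=
  Real.rpow_le_one_of_one_le_of_nonpos hx (by linarith)

/-- If `j ≥ N - m ≥ 0` then `(j+1)^{-q} ≤ m^q N^{-q}`. -/
theorem succ_rpow_neg_le {q : ℝ} (hq : 0 ≤ q) {j m N : ℕ} (hm : 1 ≤ m) (hj : N ≤ j + m)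
    (hN : 1 ≤ N) : ((j : ℝ) + 1) ^ (-q) ≤ (m : ℝ) ^ q * (N : ℝ) ^ (-q) := by
  have hj1 : (0 : ℝ) < (j : ℝ) + 1 := by positivity
  have hN0 : (0 : ℝ) < N := by exact_mod_cast hN
  have hm0 : (1 : ℝ) ≤ m := by exact_mod_cast hm
  have h : (N : ℝ) ≤ m * (j + 1) := by
    have : (N : ℝ) ≤ j + m := by exact_mod_cast hj
    nlinarith [(Nat.cast_nonneg j : (0 : ℝ) ≤ j)]
  rw [Real.rpow_neg hj1.le, Real.rpow_neg hN0.le, ← div_eq_mul_inv, inv_eq_one_div,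
    div_le_div_iff₀ (by positivity) (by positivity), one_mul,
    ← Real.mul_rpow (by positivity) hj1.le]
  exact Real.rpow_le_rpow hN0.le h hq

theorem half_rpow_neg_le {q x y : ℝ} (hq : 0 ≤ q) (hy : 0 < y) (h : y ≤ 2 * x) :
    x ^ (-q) ≤ 2 ^ q * y ^ (-q) := by
  have hx : 0 < x := by linarith
  rw [Real.rpow_neg hx.le, Real.rpow_neg hy.le, ← div_eq_mul_inv, inv_eq_one_div,
    div_le_div_iff₀ (by positivity) (by positivity), one_mul,
    ← Real.mul_rpow (by positivity) hx.le]
  exact Real.rpow_le_rpow hy.le h hq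

/-- Bound for one term of the convolution of `m^{-θ}` with the increments `j^{-(θ-1)}`. -/
theorem rpow_mul_sum_Ico_le {θ : ℝ} (hθ : 2 < θ) {m n : ℕ} (hm : 2 ≤ m) (hmn : m ≤ n + 1) :
    (m : ℝ) ^ (-θ) * ∑ j ∈ Finset.Ico (n + 1 - m) n, ((j : ℝ) + 1) ^ (-(θ - 1)) ≤
      2 ^ θ * ((n : ℝ) + 1) ^ (-(θ - 1)) *
        ((m : ℝ) ^ (-(θ - 1)) + zetaSum (θ - 1) * ((n : ℝ) + 1)⁻¹) := by
  have hm0 : (0 : ℝ) < m := by exact_mod_cast (by omega : 0 < m)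
  have hn0 : (0 : ℝ) < (n : ℝ) + 1 := by positivity
  have hZ : 1 ≤ zetaSum (θ - 1) := one_le_zetaSum (by linarith)
  have h2 : (2 : ℝ) ^ (θ - 1) ≤ 2 ^ θ :=
    Real.rpow_le_rpow_of_exponent_le (by norm_num) (by linarith)
  have hmm : (m : ℝ) ^ (-θ) * m = (m : ℝ) ^ (-(θ - 1)) := by
    rw [← Real.rpow_add_one hm0.ne']; congr 1; ring
  rcases le_or_gt (2 * m) (n + 1) with h | h
  · have h1 : ∑ j ∈ Finset.Ico (n + 1 - m) n, ((j : ℝ) + 1) ^ (-(θ - 1)) ≤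
        m * (2 ^ θ * ((n : ℝ) + 1) ^ (-(θ - 1))) := by
      calc _ ≤ ∑ j ∈ Finset.Ico (n + 1 - m) n, 2 ^ θ * ((n : ℝ) + 1) ^ (-(θ - 1)) := by
            apply Finset.sum_le_sum
            intro j hj
            rw [Finset.mem_Ico] at hj
            refine (half_rpow_neg_le (by linarith) hn0 ?_).trans ?_
            · have : n + 1 ≤ 2 * (j + 1) := by omega
              exact_mod_cast this
            · gcongr
        _ ≤ _ := by
            rw [Finset.sum_const, nsmul_eq_mul, Nat.card_Ico]
            gcongr
            omega
    calc _ ≤ (m : ℝ) ^ (-θ) * (m * (2 ^ θ * ((n : ℝ) + 1) ^ (-(θ - 1)))) := by gcongr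
      _ = 2 ^ θ * ((n : ℝ) + 1) ^ (-(θ - 1)) * ((m : ℝ) ^ (-θ) * m) := by ring
      _ ≤ _ := by
        rw [hmm]
        gcongr
        have : 0 ≤ zetaSum (θ - 1) * ((n : ℝ) + 1)⁻¹ := by positivity
        linarith
  · have h1 : (m : ℝ) ^ (-θ) ≤ 2 ^ θ * ((n : ℝ) + 1) ^ (-θ) :=
      half_rpow_neg_le (by linarith) hn0 (by exact_mod_cast h.le)
    have h3 : ((n : ℝ) + 1) ^ (-θ) = ((n : ℝ) + 1) ^ (-(θ - 1)) * ((n : ℝ) + 1)⁻¹ := by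
      rw [← Real.rpow_neg_one, ← Real.rpow_add hn0]; congr 1; ring
    calc _ ≤ (2 ^ θ * ((n : ℝ) + 1) ^ (-θ)) * zetaSum (θ - 1) := by
          gcongr
          exact sum_Ico_succ_rpow_le_zetaSum (by linarith) _ _
      _ = 2 ^ θ * ((n : ℝ) + 1) ^ (-(θ - 1)) * (zetaSum (θ - 1) * ((n : ℝ) + 1)⁻¹) := by
          rw [h3]; ring
      _ ≤ _ := by
        gcongr
        have : 0 ≤ (m : ℝ) ^ (-(θ - 1)) := by positivity
        linarith

theorem sum_rpow_mul_sum_Ico_le {θ : ℝ} (hθ : 2 < θ) (n : ℕ) :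
    ∑ m ∈ Finset.Icc 2 (n + 1),
        (m : ℝ) ^ (-θ) * ∑ j ∈ Finset.Ico (n + 1 - m) n, ((j : ℝ) + 1) ^ (-(θ - 1)) ≤
      2 ^ θ * (2 * zetaSum (θ - 1)) * ((n : ℝ) + 1) ^ (-(θ - 1)) := by
  have hn0 : (0 : ℝ) < (n : ℝ) + 1 := by positivity
  have hZ : 1 ≤ zetaSum (θ - 1) := one_le_zetaSum (by linarith)
  calc _ ≤ ∑ m ∈ Finset.Icc 2 (n + 1), 2 ^ θ * ((n : ℝ) + 1) ^ (-(θ - 1)) *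
        ((m : ℝ) ^ (-(θ - 1)) + zetaSum (θ - 1) * ((n : ℝ) + 1)⁻¹) := by
        apply Finset.sum_le_sum
        intro m hm
        rw [Finset.mem_Icc] at hm
        exact rpow_mul_sum_Ico_le hθ hm.1 hm.2
    _ = 2 ^ θ * ((n : ℝ) + 1) ^ (-(θ - 1)) * (∑ m ∈ Finset.Icc 2 (n + 1), (m : ℝ) ^ (-(θ - 1)) +
        (n : ℝ) * (zetaSum (θ - 1) * ((n : ℝ) + 1)⁻¹)) := by
        rw [← Finset.mul_sum, Finset.sum_add_distrib, Finset.sum_const, nsmul_eq_mul,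
          Nat.card_Icc]
        simp
    _ ≤ 2 ^ θ * ((n : ℝ) + 1) ^ (-(θ - 1)) * (zetaSum (θ - 1) + zetaSum (θ - 1)) := by
        gcongr
        · exact sum_rpow_le_zetaSum (by linarith) _
        · rw [mul_comm, mul_assoc]
          have : ((n : ℝ) + 1)⁻¹ * n ≤ 1 := by
            rw [inv_mul_le_iff₀ hn0]; linarith
          nlinarith
    _ = _ := by ring

theorem abs_sub_le_sum_Ico (u : ℕ → ℝ) {i n : ℕ} (h : i ≤ n) :
    |u i - u n| ≤ ∑ j ∈ Finset.Ico i n, |u (j + 1) - u j| := by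
  have := dist_le_Ico_sum_dist u h
  simpa only [Real.dist_eq, abs_sub_comm] using this

end LaceRecursion

namespace LaceRecursion

/-- The recursion at `k = 0` and a fixed `z`, up to the index `N`, with bounds on its
coefficients and with `z` close to critical up to scale `N`. -/
structure ZeroSeq (θ c β z : ℝ) (N : ℕ) (f g e : ℕ → ℝ) : Prop where
  f_zero : f 0 = 1
  f_succ : ∀ n < N, f (n + 1) =
    z * f n + ∑ m ∈ Finset.Icc 2 (n + 1), g m * f (n + 1 - m) + e (n + 1)
  g_le : ∀ m, 2 ≤ m → m ≤ N → |g m| ≤ c * β * (m : ℝ) ^ (-θ)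
  e_le : ∀ m, 1 ≤ m → m ≤ N → |e m| ≤ c * β * (m : ℝ) ^ (-θ)
  crit : ∀ n < N, |z + ∑ m ∈ Finset.Icc 2 (n + 1), g m - 1| ≤
    c * β * ((n : ℝ) + 1) ^ (-(θ - 1))

theorem abs_sub_le_of_increments {f : ℕ → ℝ} {K p : ℝ} (hp : 1 < p) (hK : 0 ≤ K) {i n : ℕ}
    (hin : i ≤ n) (h : ∀ j < n, |f (j + 1) - f j| ≤ K * ((j : ℝ) + 1) ^ (-p)) :
    |f i - f n| ≤ K * zetaSum p := by
  calc |f i - f n| ≤ ∑ j ∈ Finset.Ico i n, |f (j + 1) - f j| := abs_sub_le_sum_Ico f hin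
    _ ≤ ∑ j ∈ Finset.Ico i n, K * ((j : ℝ) + 1) ^ (-p) :=
        Finset.sum_le_sum fun j hj => h j (Finset.mem_Ico.1 hj).2
    _ ≤ K * zetaSum p := by
        rw [← Finset.mul_sum]
        gcongr
        exact sum_Ico_succ_rpow_le_zetaSum hp _ _

namespace ZeroSeq

/-- Increments of the recursion at `k = 0`. -/
theorem increment_le {θ c β z : ℝ} {N : ℕ} {f g e : ℕ → ℝ} (H : ZeroSeq θ c β z N f g e)
    (hθ : 2 < θ) (hc : 1 ≤ c) (hβ : 0 < β)
    (hβc : c * β * (2 ^ θ * (2 * zetaSum (θ - 1))) ≤ 1 / 4) :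
    ∀ n < N, |f (n + 1) - f n| ≤ 4 * c * β * ((n : ℝ) + 1) ^ (-(θ - 1)) := by
  have hZ : 1 ≤ zetaSum (θ - 1) := one_le_zetaSum (by linarith)
  intro n
  induction n using Nat.strong_induction_on with
  | _ n ih =>
  intro hn
  have hcβ : 0 < c * β := by positivity
  have hinc : ∀ j < n, |f (j + 1) - f j| ≤ 4 * c * β * ((j : ℝ) + 1) ^ (-(θ - 1)) :=
    fun j hj => ih j hj (hj.trans hn)
  have h2θ : (4 : ℝ) ≤ 2 ^ θ := by
    calc (4 : ℝ) = 2 ^ (2 : ℝ) := by norm_num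
      _ ≤ 2 ^ θ := Real.rpow_le_rpow_of_exponent_le (by norm_num) hθ.le
  have hfn : |f n| ≤ 5 / 4 := by
    have h1 := abs_sub_le_of_increments (by linarith : 1 < θ - 1) (by positivity) (Nat.zero_le n)
      hinc
    rw [H.f_zero] at h1
    have h2 : 4 * c * β * zetaSum (θ - 1) ≤ 1 / 4 := by
      refine le_trans ?_ hβc
      have : 0 < c * β * zetaSum (θ - 1) := by positivity
      nlinarith
    have := abs_le.1 (h1.trans h2)
    exact abs_le.2 ⟨by linarith, by linarith⟩
  have hdec : f (n + 1) - f n = (z + ∑ m ∈ Finset.Icc 2 (n + 1), g m - 1) * f n +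
      ∑ m ∈ Finset.Icc 2 (n + 1), g m * (f (n + 1 - m) - f n) + e (n + 1) := by
    rw [H.f_succ n hn]
    simp only [mul_sub, Finset.sum_sub_distrib, ← Finset.sum_mul]
    ring
  set P := ((n : ℝ) + 1) ^ (-(θ - 1)) with hP
  have hP0 : 0 < P := by positivity
  have t1 : |(z + ∑ m ∈ Finset.Icc 2 (n + 1), g m - 1) * f n| ≤ c * β * P * (5 / 4) := by
    rw [abs_mul]
    exact mul_le_mul (H.crit n hn) hfn (abs_nonneg _) (by positivity)
  have t3 : |e (n + 1)| ≤ c * β * P := by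
    refine (H.e_le (n + 1) (by omega) hn).trans ?_
    push_cast
    gcongr
    exact rpow_neg_le_rpow_neg (by linarith [(Nat.cast_nonneg n : (0 : ℝ) ≤ n)]) (by linarith)
  have t2 : |∑ m ∈ Finset.Icc 2 (n + 1), g m * (f (n + 1 - m) - f n)| ≤ c * β * P := by
    calc _ ≤ ∑ m ∈ Finset.Icc 2 (n + 1), |g m * (f (n + 1 - m) - f n)| :=
          Finset.abs_sum_le_sum_abs _ _
      _ ≤ ∑ m ∈ Finset.Icc 2 (n + 1), (c * β) * (4 * c * β) * ((m : ℝ) ^ (-θ) *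
            ∑ j ∈ Finset.Ico (n + 1 - m) n, ((j : ℝ) + 1) ^ (-(θ - 1))) := by
          apply Finset.sum_le_sum
          intro m hm
          rw [Finset.mem_Icc] at hm
          rw [abs_mul]
          have h1 := H.g_le m hm.1 (by omega)
          have h2 : |f (n + 1 - m) - f n| ≤
              4 * c * β * ∑ j ∈ Finset.Ico (n + 1 - m) n, ((j : ℝ) + 1) ^ (-(θ - 1)) := by
            refine (abs_sub_le_sum_Ico f (by omega)).trans ?_
            rw [Finset.mul_sum]
            exact Finset.sum_le_sum fun j hj => hinc j (Finset.mem_Ico.1 hj).2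
          calc _ ≤ (c * β * (m : ℝ) ^ (-θ)) * (4 * c * β *
                ∑ j ∈ Finset.Ico (n + 1 - m) n, ((j : ℝ) + 1) ^ (-(θ - 1))) :=
                mul_le_mul h1 h2 (abs_nonneg _) (by positivity)
            _ = _ := by ring
      _ ≤ (c * β) * (4 * c * β) * (2 ^ θ * (2 * zetaSum (θ - 1)) * P) := by
          rw [← Finset.mul_sum]
          gcongr
          exact sum_rpow_mul_sum_Ico_le hθ n
      _ = c * β * P * (4 * (c * β * (2 ^ θ * (2 * zetaSum (θ - 1))))) := by ring
      _ ≤ c * β * P * (4 * (1 / 4)) := by gcongr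
      _ = c * β * P := by ring
  rw [hdec]
  refine (abs_add_le _ _).trans ?_
  refine (add_le_add (abs_add_le _ _) le_rfl).trans ?_
  have : 0 < c * β * P := by positivity
  linarith

theorem abs_sub_one_le {θ c β z : ℝ} {N : ℕ} {f g e : ℕ → ℝ} (H : ZeroSeq θ c β z N f g e)
    (hθ : 2 < θ) (hc : 1 ≤ c) (hβ : 0 < β)
    (hβc : c * β * (2 ^ θ * (2 * zetaSum (θ - 1))) ≤ 1 / 4) {n : ℕ} (hn : n ≤ N) :
    |f n - 1| ≤ 4 * c * β * zetaSum (θ - 1) := by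
  have h1 := abs_sub_le_of_increments (by linarith : 1 < θ - 1) (by positivity) (Nat.zero_le n)
      (fun j hj => H.increment_le hθ hc hβ hβc j (lt_of_lt_of_le hj hn))
  rwa [H.f_zero, abs_sub_comm] at h1

theorem mem_Icc {θ c β z : ℝ} {N : ℕ} {f g e : ℕ → ℝ} (H : ZeroSeq θ c β z N f g e)
    (hθ : 2 < θ) (hc : 1 ≤ c) (hβ : 0 < β)
    (hβc : c * β * (2 ^ θ * (2 * zetaSum (θ - 1))) ≤ 1 / 4) {n : ℕ} (hn : n ≤ N) :
    f n ∈ Icc (3 / 4 : ℝ) (5 / 4) := by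
  have h := H.abs_sub_one_le hθ hc hβ hβc hn
  have hZ : 1 ≤ zetaSum (θ - 1) := one_le_zetaSum (by linarith)
  have h2θ : (4 : ℝ) ≤ 2 ^ θ := by
    calc (4 : ℝ) = 2 ^ (2 : ℝ) := by norm_num
      _ ≤ 2 ^ θ := Real.rpow_le_rpow_of_exponent_le (by norm_num) hθ.le
  have h2 : 4 * c * β * zetaSum (θ - 1) ≤ 1 / 4 := by
    refine le_trans ?_ hβc
    have : 0 < c * β * zetaSum (θ - 1) := by positivity
    nlinarith
  have := abs_le.1 (h.trans h2)
  exact ⟨by linarith, by linarith⟩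

end ZeroSeq

/-- A positive sequence that decreases by factors `1 - w` with `a/2 ≤ w ≤ 2a`. -/
structure RatioSeq (a : ℝ) (n : ℕ) (F w : ℕ → ℝ) : Prop where
  F_zero : F 0 = 1
  F_succ : ∀ j < n, F (j + 1) = (1 - w j) * F j
  le_w : ∀ j < n, a / 2 ≤ w j
  w_le : ∀ j < n, w j ≤ 2 * a

namespace RatioSeq

variable {a : ℝ} {n : ℕ} {F w : ℕ → ℝ}

theorem mono (H : RatioSeq a n F w) {m : ℕ} (h : m ≤ n) : RatioSeq a m F w :=
  ⟨H.F_zero, fun j hj => H.F_succ j (by omega), fun j hj => H.le_w j (by omega),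
    fun j hj => H.w_le j (by omega)⟩

theorem pos (H : RatioSeq a n F w) (ha : a ≤ 1 / 4) : ∀ j ≤ n, 0 < F j := by
  intro j
  induction j with
  | zero => intro _; rw [H.F_zero]; norm_num
  | succ j ih =>
    intro hj
    rw [H.F_succ j hj]
    have := H.w_le j hj
    exact mul_pos (by linarith) (ih (by omega))

theorem le_exp (H : RatioSeq a n F w) (ha : a ≤ 1 / 4) :
    ∀ j ≤ n, F j ≤ Real.exp (-(a * j) / 2) := by
  intro j
  induction j with
  | zero => intro _; simp [H.F_zero]
  | succ j ih =>
    intro hj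
    rw [H.F_succ j hj]
    have h1 : 1 - w j ≤ Real.exp (-a / 2) := by
      have := H.le_w j hj
      have := Real.add_one_le_exp (-a / 2)
      linarith
    have h2 := H.w_le j hj
    calc (1 - w j) * F j ≤ Real.exp (-a / 2) * Real.exp (-(a * j) / 2) :=
          mul_le_mul h1 (ih (by omega)) (H.pos ha j (by omega)).le (Real.exp_pos _).le
      _ = _ := by rw [← Real.exp_add]; congr 1; push_cast; ring

theorem le_exp_mul (H : RatioSeq a n F w) (ha0 : 0 ≤ a) (ha : a ≤ 1 / 4) :
    ∀ l ≤ n, F (n - l) ≤ Real.exp (4 * (a * l)) * F n := by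
  intro l
  induction l with
  | zero => simp
  | succ l ih =>
    intro hl
    obtain ⟨i, hi⟩ : ∃ i, i = n - (l + 1) := ⟨_, rfl⟩
    have hi' : n - l = i + 1 := by omega
    have h1 := ih (by omega)
    rw [hi', H.F_succ i (by omega)] at h1
    rw [← hi]
    have hw := H.w_le i (by omega)
    have hpos := H.pos ha i (by omega)
    have h2 : 1 ≤ Real.exp (4 * a) * (1 - w i) := by
      have := Real.add_one_le_exp (4 * a)
      nlinarith
    calc F i ≤ (Real.exp (4 * a) * (1 - w i)) * F i := by nlinarith
      _ = Real.exp (4 * a) * ((1 - w i) * F i) := by ring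
      _ ≤ Real.exp (4 * a) * (Real.exp (4 * (a * l)) * F n) := by gcongr
      _ = _ := by rw [← mul_assoc, ← Real.exp_add]; congr 2; push_cast; ring

theorem sub_eq_sum (H : RatioSeq a n F w) {i : ℕ} (hi : i ≤ n) :
    F i - F n = ∑ j ∈ Finset.Ico i n, w j * F j := by
  have h1 : ∑ j ∈ Finset.Ico i n, (F (j + 1) - F j) = F n - F i := Finset.sum_Ico_sub F hi
  have h2 : ∑ j ∈ Finset.Ico i n, w j * F j = -∑ j ∈ Finset.Ico i n, (F (j + 1) - F j) := by
    rw [← Finset.sum_neg_distrib]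
    apply Finset.sum_congr rfl
    intro j hj
    rw [H.F_succ j (Finset.mem_Ico.1 hj).2]
    ring
  rw [h2, h1]; ring

theorem div_le (H : RatioSeq a n F w) (ha0 : 0 ≤ a) (ha : a ≤ 1 / 4) {l : ℕ} (hl : l ≤ n) :
    F (n - l) / F n ≤ Real.exp (4 * (a * l)) := by
  rw [div_le_iff₀ (H.pos ha n le_rfl)]
  exact H.le_exp_mul ha0 ha l hl

theorem one_le_div (H : RatioSeq a n F w) (ha0 : 0 ≤ a) (ha : a ≤ 1 / 4) {i : ℕ} (hi : i ≤ n) :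
    1 ≤ F i / F n := by
  rw [le_div_iff₀ (H.pos ha n le_rfl), one_mul]
  have h : 0 ≤ F i - F n := by
    rw [H.sub_eq_sum hi]
    apply Finset.sum_nonneg
    intro j hj
    have hj' := Finset.mem_Ico.1 hj
    have := H.le_w j hj'.2
    exact mul_nonneg (by linarith) (H.pos ha j hj'.2.le).le
  linarith

theorem div_sub_one_eq_sum (H : RatioSeq a n F w) (ha : a ≤ 1 / 4) {i : ℕ} (hi : i ≤ n) :
    F i / F n - 1 = ∑ j ∈ Finset.Ico i n, w j * (F j / F n) := by
  have h := H.pos ha n le_rfl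
  simp only [← mul_div_assoc]
  rw [← Finset.sum_div, ← H.sub_eq_sum hi, sub_div, div_self h.ne']

theorem div_sub_one_le (H : RatioSeq a n F w) (ha0 : 0 ≤ a) (ha : a ≤ 1 / 4) {l : ℕ}
    (hl : l ≤ n) : F (n - l) / F n - 1 ≤ 2 * (a * l) * Real.exp (4 * (a * l)) := by
  rw [H.div_sub_one_eq_sum ha (by omega)]
  calc _ ≤ ∑ j ∈ Finset.Ico (n - l) n, 2 * a * Real.exp (4 * (a * l)) := by
        apply Finset.sum_le_sum
        intro j hj
        have hj' := Finset.mem_Ico.1 hj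
        have h1 := H.div_le ha0 ha (l := n - j) (by omega)
        rw [show n - (n - j) = j by omega] at h1
        have h2 : F j / F n ≤ Real.exp (4 * (a * l)) := by
          refine h1.trans (Real.exp_le_exp.2 ?_)
          gcongr
          omega
        have h3 := H.one_le_div ha0 ha hj'.2.le
        exact mul_le_mul (H.w_le j hj'.2) h2 (by linarith) (by linarith)
    _ = _ := by
        rw [Finset.sum_const, nsmul_eq_mul, Nat.card_Ico, show n - (n - l) = l by omega]
        ring

theorem abs_div_sub_le (H : RatioSeq a n F w) (ha0 : 0 ≤ a) (ha : a ≤ 1 / 4) {l : ℕ}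
    (hl : l ≤ n) : |F (n - l) / F n - 1 - ∑ j ∈ Finset.Ico (n - l) n, w j| ≤
      4 * (a * l) ^ 2 * Real.exp (4 * (a * l)) := by
  rw [H.div_sub_one_eq_sum ha (by omega), ← Finset.sum_sub_distrib]
  refine (Finset.abs_sum_le_sum_abs _ _).trans ?_
  calc _ ≤ ∑ j ∈ Finset.Ico (n - l) n, (2 * a) * (2 * (a * l) * Real.exp (4 * (a * l))) := by
        apply Finset.sum_le_sum
        intro j hj
        have hj' := Finset.mem_Ico.1 hj
        have h1 := H.div_sub_one_le ha0 ha (l := n - j) (by omega)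
        rw [show n - (n - j) = j by omega] at h1
        have h2 : F j / F n - 1 ≤ 2 * (a * l) * Real.exp (4 * (a * l)) := by
          have h5 : ((n - j : ℕ) : ℝ) ≤ l := by exact_mod_cast (by omega : n - j ≤ l)
          refine h1.trans ?_
          gcongr
        have h3 := H.one_le_div ha0 ha hj'.2.le
        have h4 := H.le_w j hj'.2
        rw [← mul_sub_one, abs_mul, abs_of_nonneg (by linarith), abs_of_nonneg (by linarith)]
        exact mul_le_mul (H.w_le j hj'.2) h2 (by linarith) (by linarith)
    _ = _ := by
        rw [Finset.sum_const, nsmul_eq_mul, Nat.card_Ico, show n - (n - l) = l by omega]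
        ring

end RatioSeq

end LaceRecursion

namespace LaceRecursion

/-- The recursion at a general `k` and a fixed `z`, up to the index `N`; `k` enters through
`a = a(k)`. The sequences with index `0` belong to `k = 0`, and `h m` stands for
`σ⁻² ∇² g_m(0)`. -/
structure PointSeq (θ δ s c β z v a : ℝ) (N : ℕ) (g₀ e₀ f g e h : ℕ → ℝ) : Prop where
  a_nonneg : 0 ≤ a
  f_zero : f 0 = 1
  f_succ : ∀ n < N, f (n + 1) =
    z * (1 - a) * f n + ∑ m ∈ Finset.Icc 2 (n + 1), g m * f (n + 1 - m) + e (n + 1)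
  g_le : ∀ m, 2 ≤ m → m ≤ N → |g m| ≤ c * β * (m : ℝ) ^ (-θ)
  e_le : ∀ m, 1 ≤ m → m ≤ N → |e m| ≤ c * β * (m : ℝ) ^ (-θ)
  g_diff : ∀ m, 2 ≤ m → m ≤ N → |g m - g₀ m| ≤ c * β * a * (m : ℝ) ^ (-(θ - 1))
  g_taylor : ∀ m, 2 ≤ m → m ≤ N →
    |g m - g₀ m - a * h m| ≤ c * β * a ^ (1 + s) * (m : ℝ) ^ (-(θ - 1 - s))
  e_diff : ∀ m, 1 ≤ m → m ≤ N → |e m - e₀ m| ≤ c * β * a * (m : ℝ) ^ (-(θ - 1))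
  drift : ∀ n < N, |z - ∑ m ∈ Finset.Icc 2 (n + 1), h m -
    v * (1 + ∑ m ∈ Finset.Icc 2 (n + 1), ((m : ℝ) - 1) * g₀ m)| ≤
      c * β * ((n : ℝ) + 1) ^ (-δ)

/-- Admissible exponents. -/
structure Exponents (θ δ s γ : ℝ) : Prop where
  two_lt : 2 < θ
  δ_pos : 0 < δ
  δ_lt : δ < s
  s_lt_one : s < 1
  s_lt : s < θ - 2
  γ_pos : 0 < γ
  γ_le : γ ≤ 1 / 8
  γ_le' : 16 * γ ≤ θ - 2 - s

/-- The constant in the bound `a^s ≤ const * N^{-δ}` in the Gaussian region. -/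
noncomputable def powConst (δ s : ℝ) : ℝ := (1 + s / (s - δ)) ^ s

/-- The constant in `1 + a m ≤ const * m^{t/4}`, where `t = θ - 2 - s`. -/
noncomputable def linConst (θ s : ℝ) : ℝ := 2 * (1 + 4 / (θ - 2 - s))

/-- The constant in the bound on the deviation of the decay rate from `v a`. -/
noncomputable def rateConst (θ δ s : ℝ) : ℝ :=
  2 * ((5 * powConst δ s + 8 * (powConst δ s * linConst θ s) + 41) *
    zetaSum (1 + (θ - 2 - s) / 2) + 21)

/-- The inverse of the smallness of `c β` needed to control the recursion for small `k`. -/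
noncomputable def smallConst (θ δ s : ℝ) : ℝ :=
  4 * (2 ^ θ * (2 * zetaSum (θ - 1))) + 8 * rateConst θ δ s + zetaSum (θ - 1 - δ) + 8

namespace Exponents

variable {θ δ s γ : ℝ}

theorem powConst_pos (E : Exponents θ δ s γ) : 0 < powConst δ s := by
  have h1 := E.δ_lt
  have h2 := E.δ_pos
  have : 0 < s / (s - δ) := div_pos (by linarith) (by linarith)
  unfold powConst
  positivity

theorem linConst_pos (E : Exponents θ δ s γ) : 0 < linConst θ s := by
  have h1 := E.s_lt
  have : 0 < 4 / (θ - 2 - s) := div_pos (by norm_num) (by linarith)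
  unfold linConst
  positivity

theorem rateConst_pos (E : Exponents θ δ s γ) : 1 ≤ rateConst θ δ s := by
  have h1 := E.powConst_pos
  have h2 := E.linConst_pos
  have h3 : 1 ≤ zetaSum (1 + (θ - 2 - s) / 2) := one_le_zetaSum (by linarith [E.s_lt])
  unfold rateConst
  have : 0 ≤ (5 * powConst δ s + 8 * (powConst δ s * linConst θ s) + 41) *
    zetaSum (1 + (θ - 2 - s) / 2) := by positivity
  linarith

theorem one_le_zetaSum_sub_one (E : Exponents θ δ s γ) : 1 ≤ zetaSum (θ - 1) :=
  one_le_zetaSum (by linarith [E.two_lt])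

theorem one_le_zetaSum_sub_one_sub (E : Exponents θ δ s γ) : 1 ≤ zetaSum (θ - 1 - δ) :=
  one_le_zetaSum (by linarith [E.δ_lt, E.s_lt])

theorem two_rpow_mul_zetaSum_small (E : Exponents θ δ s γ) {x : ℝ} (hx : 0 < x) (h : x * smallConst θ δ s ≤ 1) :
    x * (2 ^ θ * (2 * zetaSum (θ - 1))) ≤ 1 / 4 := by
  have h1 := E.rateConst_pos
  have h2 := E.one_le_zetaSum_sub_one_sub
  unfold smallConst at h
  have : 0 < x * rateConst θ δ s := by positivity
  have : 0 < x * zetaSum (θ - 1 - δ) := by positivity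
  linarith

theorem rateConst_small (E : Exponents θ δ s γ) {x : ℝ} (hx : 0 < x) (h : x * smallConst θ δ s ≤ 1) :
    x * rateConst θ δ s ≤ 1 / 8 := by
  have h1 := E.one_le_zetaSum_sub_one
  have h2 := E.one_le_zetaSum_sub_one_sub
  unfold smallConst at h
  have : 0 < x * (2 ^ θ * (2 * zetaSum (θ - 1))) := by positivity
  have : 0 < x * zetaSum (θ - 1 - δ) := by positivity
  linarith

theorem zetaSum_small (E : Exponents θ δ s γ) {x : ℝ} (hx : 0 < x) (h : x * smallConst θ δ s ≤ 1) :
    x * zetaSum (θ - 1 - δ) ≤ 1 := by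
  have h1 := E.one_le_zetaSum_sub_one
  have h2 := E.rateConst_pos
  unfold smallConst at h
  have : 0 < x * (2 ^ θ * (2 * zetaSum (θ - 1))) := by positivity
  have : 0 < x * rateConst θ δ s := by positivity
  linarith

theorem le_one_eighth (E : Exponents θ δ s γ) {x : ℝ} (hx : 0 < x) (h : x * smallConst θ δ s ≤ 1) :
    x ≤ 1 / 8 := by
  have h1 := E.one_le_zetaSum_sub_one
  have h2 := E.rateConst_pos
  have h3 := E.one_le_zetaSum_sub_one_sub
  unfold smallConst at h
  have : 0 < x * (2 ^ θ * (2 * zetaSum (θ - 1))) := by positivity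
  have : 0 < x * rateConst θ δ s := by positivity
  have : 0 < x * zetaSum (θ - 1 - δ) := by positivity
  linarith

end Exponents

theorem min_one_le_rpow {x y s : ℝ} (hx : 0 ≤ x) (hs0 : 0 < s) (hs : s ≤ 1) (h1 : y ≤ x)
    (h2 : y ≤ 1) : y ≤ x ^ s := by
  rcases le_total x 1 with h | h
  · refine h1.trans ?_
    rcases hx.eq_or_lt with h0 | h0
    · rw [← h0, Real.zero_rpow hs0.ne']
    · calc x = x ^ (1 : ℝ) := (Real.rpow_one x).symm
        _ ≤ x ^ s := Real.rpow_le_rpow_of_exponent_ge h0 h hs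
  · exact h2.trans (Real.one_le_rpow h hs0.le)

theorem rpow_le_one_add {x s : ℝ} (hx : 0 ≤ x) (hs0 : 0 ≤ s) (hs : s ≤ 1) : x ^ s ≤ 1 + x := by
  rcases le_total x 1 with h | h
  · exact (Real.rpow_le_one hx h hs0).trans (by linarith)
  · calc x ^ s ≤ x ^ (1 : ℝ) := Real.rpow_le_rpow_of_exponent_le h hs
      _ ≤ 1 + x := by rw [Real.rpow_one]; linarith

set_option maxHeartbeats 1000000 in
/-- Deviation of one term of the recursion from its linearisation in `a`. Here `x` is the index
of the term, `u₀` and `u₀ U` are ratios of the recursion at `0` and at `k`, and `S` is a sum of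
decay rates. -/
theorem abs_term_le {θ δ s γ c β a x y v u₀ U S g g₀ h Kr : ℝ}
    (E : Exponents θ δ s γ) (hc : 1 ≤ c) (hβ : 0 < β) (ha : 0 ≤ a) (hv : |v| ≤ 2)
    (hx : 1 ≤ x) (hxy : x ≤ y) (hay : a ≤ γ * logRatio y)
    (hsmall : c * β * zetaSum (θ - 1 - δ) ≤ 1) (hKr : 0 ≤ Kr)
    (g_le : |g| ≤ c * β * x ^ (-θ)) (g₀_le : |g₀| ≤ c * β * x ^ (-θ))
    (g_diff : |g - g₀| ≤ c * β * a * x ^ (-(θ - 1)))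
    (g_taylor : |g - g₀ - a * h| ≤ c * β * a ^ (1 + s) * x ^ (-(θ - 1 - s)))
    (hu₀ : |u₀ - 1| ≤ 8 * (c * β) * zetaSum (θ - 1 - δ) * (x ^ δ * y ^ (-δ)))
    (hU : |U - 1| ≤ 2 * (a * x) * Real.exp (4 * (a * x)))
    (hUS : |U - 1 - S| ≤ 4 * (a * x) ^ 2 * Real.exp (4 * (a * x)))
    (hS : |S - (x - 1) * (v * a)| ≤ Kr * β * a * (x ^ (1 + δ) * y ^ (-δ))) :
    |g * (u₀ * U) - g₀ * u₀ - a * h - v * a * ((x - 1) * g₀)| ≤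
      c * (5 * powConst δ s + 8 * (powConst δ s * linConst θ s) + 40 + Kr * β) * β * a *
        y ^ (-δ) * x ^ (-(1 + (θ - 2 - s) / 2)) := by
  have hx0 : 0 < x := by linarith
  have hy : 1 ≤ y := hx.trans hxy
  have hy0 : 0 < y := by linarith
  have hδ := E.δ_pos
  have hδs := E.δ_lt
  have hs1 := E.s_lt_one
  have hsθ := E.s_lt
  have hγ := E.γ_pos
  have hγ8 := E.γ_le
  have hγ' := E.γ_le'
  have hs0 : 0 < s := hδ.trans hδs
  set A₁ := powConst δ s with hA₁
  set A₂ := linConst θ s with hA₂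
  have hA₁0 : 0 < A₁ := E.powConst_pos
  have hA₂0 : 0 < A₂ := E.linConst_pos
  set τ := θ - 2 - s with hτ
  have hτ0 : 0 < τ := by linarith
  set Y := y ^ (-δ) with hY
  have hY0 : 0 < Y := by positivity
  set X := x ^ (-(1 + τ / 2)) with hX
  have hX0 : 0 < X := by positivity
  have hcβ : 0 < c * β := by positivity
  have hal : a ≤ logRatio y := hay.trans (by nlinarith [logRatio_pos hy])
  have F1 : a ^ s ≤ A₁ * Y := rpow_le_of_le_logRatio ha hy hδs hs0 hal
  have F2 : Real.exp (4 * (a * x)) ≤ 2 * x ^ (τ / 4) :=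
    exp_four_mul_le hγ.le hγ8 (by linarith) hx hxy hay
  have hax := mul_le_of_le_logRatio hγ.le hx hxy hay
  have hax0 : 0 ≤ a * x := by positivity
  have F3 : (a * x) ^ (1 - s) ≤ A₂ * x ^ (τ / 4) := by
    refine (rpow_le_one_add hax0 (by linarith) (by linarith)).trans ?_
    have h1 := one_add_log_le hx (by linarith : 0 < τ / 4)
    have hl := Real.log_nonneg hx
    have h2 : 1 + a * x ≤ 2 * (1 + Real.log x) := by nlinarith
    refine h2.trans ?_
    calc 2 * (1 + Real.log x) ≤ 2 * ((1 + 1 / (τ / 4)) * x ^ (τ / 4)) := by gcongr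
      _ = A₂ * x ^ (τ / 4) := by rw [hA₂, linConst, one_div_div]; ring
  have hpow : ∀ p : ℝ, p ≤ -(1 + τ / 2) → x ^ p ≤ X := fun p hp =>
    Real.rpow_le_rpow_of_exponent_le hx hp
  have haa : a ^ (1 + s) = a * a ^ s := by
    rw [Real.rpow_add_of_nonneg ha zero_le_one hs0.le, Real.rpow_one]
  have T1 : |g - g₀ - a * h| ≤ c * A₁ * β * a * Y * X := by
    refine g_taylor.trans ?_
    rw [haa]
    calc c * β * (a * a ^ s) * x ^ (-(θ - 1 - s)) ≤ c * β * (a * (A₁ * Y)) * X := by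
          gcongr
          exact hpow _ (by linarith)
      _ = _ := by ring
  have T2 : |(g - g₀) * (u₀ - 1)| ≤ c * 8 * β * a * Y * X := by
    rw [abs_mul]
    calc _ ≤ (c * β * a * x ^ (-(θ - 1))) *
          (8 * (c * β) * zetaSum (θ - 1 - δ) * (x ^ δ * Y)) :=
          mul_le_mul g_diff hu₀ (abs_nonneg _) (by positivity)
      _ = c * β * a * 8 * Y * (c * β * zetaSum (θ - 1 - δ)) * (x ^ (-(θ - 1)) * x ^ δ) := by ring
      _ ≤ c * β * a * 8 * Y * 1 * X := by
          gcongr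
          rw [← Real.rpow_add hx0]
          exact hpow _ (by linarith)
      _ = _ := by ring
  have T3 : |(g - g₀) * ((x - 1) * (v * a))| ≤ c * (4 * A₁) * β * a * Y * X := by
    have h1 : |g - g₀| ≤ 2 * (c * β) * x ^ (-θ) * (a * x) ^ s := by
      have h2 : |g - g₀| ≤ 2 * (c * β) * x ^ (-θ) := by
        have := abs_sub g g₀
        linarith
      have h3 : |g - g₀| ≤ 2 * (c * β) * x ^ (-θ) * (a * x) := by
        have h4 : x ^ (-(θ - 1)) = x ^ (-θ) * x := by
          rw [← Real.rpow_add_one hx0.ne']; congr 1; ring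
        have h5 : 0 ≤ c * β * x ^ (-θ) * (a * x) := by positivity
        rw [h4] at g_diff
        linarith
      have h6 : 0 < 2 * (c * β) * x ^ (-θ) := by positivity
      have h7 := min_one_le_rpow (y := |g - g₀| / (2 * (c * β) * x ^ (-θ))) hax0 hs0 hs1.le
        (by rw [div_le_iff₀ h6]; linarith) (by rw [div_le_iff₀ h6]; linarith)
      rw [div_le_iff₀ h6] at h7
      linarith
    have h2 : |(x - 1) * (v * a)| ≤ x * (2 * a) := by
      rw [abs_mul, abs_mul, abs_of_nonneg ha, abs_of_nonneg (by linarith : 0 ≤ x - 1)]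
      gcongr
      linarith
    rw [abs_mul]
    calc _ ≤ (2 * (c * β) * x ^ (-θ) * (a * x) ^ s) * (x * (2 * a)) :=
          mul_le_mul h1 h2 (abs_nonneg _) (by positivity)
      _ = c * β * a * 4 * a ^ s * (x ^ (-θ) * x ^ s * x) := by
          rw [Real.mul_rpow ha hx0.le]; ring
      _ ≤ c * β * a * 4 * (A₁ * Y) * X := by
          gcongr
          rw [← Real.rpow_add hx0, ← Real.rpow_add_one hx0.ne']
          exact hpow _ (by linarith)
      _ = _ := by ring
  have T4 : |g * ((u₀ - 1) * (U - 1))| ≤ c * 32 * β * a * Y * X := by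
    rw [abs_mul, abs_mul]
    calc _ ≤ (c * β * x ^ (-θ)) * ((8 * (c * β) * zetaSum (θ - 1 - δ) * (x ^ δ * Y)) *
            (2 * (a * x) * (2 * x ^ (τ / 4)))) := by
          have h1 : |U - 1| ≤ 2 * (a * x) * (2 * x ^ (τ / 4)) := hU.trans (by gcongr)
          have hz := E.one_le_zetaSum_sub_one_sub
          gcongr
      _ = c * β * a * 32 * Y * (c * β * zetaSum (θ - 1 - δ)) *
            (x ^ (-θ) * x ^ δ * x ^ (τ / 4) * x) := by ring
      _ ≤ c * β * a * 32 * Y * 1 * X := by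
          gcongr
          rw [← Real.rpow_add hx0, ← Real.rpow_add hx0, ← Real.rpow_add_one hx0.ne']
          exact hpow _ (by linarith)
      _ = _ := by ring
  have T5 : |g * (U - 1 - S)| ≤ c * (8 * (A₁ * A₂)) * β * a * Y * X := by
    have hsq : (a * x) ^ 2 = (a * x) * ((a * x) ^ s * (a * x) ^ (1 - s)) := by
      rw [← Real.rpow_add_of_nonneg hax0 hs0.le (by linarith)]
      simp; ring
    rw [abs_mul]
    calc _ ≤ (c * β * x ^ (-θ)) * (4 * (a * x) ^ 2 * (2 * x ^ (τ / 4))) := by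
          gcongr
          exact hUS.trans (by gcongr)
      _ = c * β * 8 * (x ^ (-θ) * x * x ^ (τ / 4)) *
            (a * ((a ^ s * x ^ s) * (a * x) ^ (1 - s))) := by
          rw [hsq, Real.mul_rpow ha hx0.le]; ring
      _ ≤ c * β * 8 * (x ^ (-θ) * x * x ^ (τ / 4)) *
            (a * (((A₁ * Y) * x ^ s) * (A₂ * x ^ (τ / 4)))) := by gcongr
      _ = c * β * 8 * (A₁ * A₂) * a * Y *
            (x ^ (-θ) * x ^ (τ / 4) * x ^ s * x ^ (τ / 4) * x) := by ring
      _ ≤ c * β * 8 * (A₁ * A₂) * a * Y * X := by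
          gcongr
          rw [← Real.rpow_add hx0, ← Real.rpow_add hx0, ← Real.rpow_add hx0,
            ← Real.rpow_add_one hx0.ne']
          exact hpow _ (by linarith)
      _ = _ := by ring
  have T6 : |g * (S - (x - 1) * (v * a))| ≤ c * (Kr * β) * β * a * Y * X := by
    rw [abs_mul]
    calc _ ≤ (c * β * x ^ (-θ)) * (Kr * β * a * (x ^ (1 + δ) * Y)) :=
          mul_le_mul g_le hS (abs_nonneg _) (by positivity)
      _ = c * (Kr * β) * β * a * Y * (x ^ (-θ) * x ^ (1 + δ)) := by ring
      _ ≤ _ := by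
          gcongr
          rw [← Real.rpow_add hx0]
          exact hpow _ (by linarith)
  have hdec : g * (u₀ * U) - g₀ * u₀ - a * h - v * a * ((x - 1) * g₀) =
      (g - g₀ - a * h) + (g - g₀) * (u₀ - 1) + (g - g₀) * ((x - 1) * (v * a)) +
      g * ((u₀ - 1) * (U - 1)) + g * (U - 1 - S) + g * (S - (x - 1) * (v * a)) := by ring
  rw [hdec]
  refine (abs_add_le _ _).trans ((add_le_add ((abs_add_le _ _).trans (add_le_add
    ((abs_add_le _ _).trans (add_le_add ((abs_add_le _ _).trans (add_le_add
    ((abs_add_le _ _).trans (add_le_add T1 T2)) T3)) T4)) T5)) T6).trans (le_of_eq ?_))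
  ring

end LaceRecursion

namespace LaceRecursion

/-- The decay rate `1 - F_{n+1} / F_n` of the normalised sequence `F = f / f₀`. -/
noncomputable def rate (f₀ f : ℕ → ℝ) (n : ℕ) : ℝ :=
  1 - (f (n + 1) / f₀ (n + 1)) / (f n / f₀ n)

theorem ratioSeq_of_rate {a : ℝ} {n : ℕ} {f₀ f : ℕ → ℝ} (ha : a ≤ 1 / 4) (h₀ : f₀ 0 = 1)
    (h : f 0 = 1) (h1 : ∀ j < n, a / 2 ≤ rate f₀ f j) (h2 : ∀ j < n, rate f₀ f j ≤ 2 * a) :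
    RatioSeq a n (fun j => f j / f₀ j) (rate f₀ f) := by
  induction n with
  | zero => exact ⟨by simp [h₀, h], by simp, by simp, by simp⟩
  | succ n ih =>
    have H := ih (fun j hj => h1 j (by omega)) (fun j hj => h2 j (by omega))
    refine ⟨H.F_zero, ?_, h1, h2⟩
    intro j hj
    have hp := H.pos ha j (by omega)
    unfold rate
    rw [sub_sub_cancel, div_mul_cancel₀ _ hp.ne']

namespace PointSeq

variable {θ δ s γ c β z v a : ℝ} {N : ℕ} {f₀ g₀ e₀ f g e h : ℕ → ℝ}

theorem abs_v_sub_one_le (H : PointSeq θ δ s c β z v a N g₀ e₀ f g e h)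
    (H₀ : ZeroSeq θ c β z N f₀ g₀ e₀) (hN : 0 < N) : |v - 1| ≤ 2 * (c * β) := by
  have h1 := H.drift 0 hN
  have h2 := H₀.crit 0 hN
  simp at h1 h2
  have h3 := abs_le.1 h1
  have h4 := abs_le.1 h2
  exact abs_le.2 ⟨by linarith, by linarith⟩

/-- The terms of the recursion satisfy the hypotheses of `abs_term_le`. -/
theorem abs_recursion_term_le (E : Exponents θ δ s γ)
    (H : PointSeq θ δ s c β z v a N g₀ e₀ f g e h)
    (H₀ : ZeroSeq θ c β z N f₀ g₀ e₀) (hc : 1 ≤ c) (hβ : 0 < β)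
    (hsmall : c * β * smallConst θ δ s ≤ 1) (hv : |v| ≤ 2) {n : ℕ} (hn : n < N)
    (ha : a ≤ γ * logRatio ((n : ℝ) + 1))
    (HR : RatioSeq a n (fun j => f j / f₀ j) (rate f₀ f))
    (IH : ∀ j < n, |rate f₀ f j - v * a| ≤ rateConst θ δ s * c * β * a * ((j : ℝ) + 1) ^ (-δ))
    {m : ℕ} (hm : 2 ≤ m) (hmn : m ≤ n + 1) :
    |g m * (f (n + 1 - m) / f n) - g₀ m * (f₀ (n + 1 - m) / f₀ n) - a * h m -
        v * a * (((m : ℝ) - 1) * g₀ m)| ≤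
      c * (5 * powConst δ s + 8 * (powConst δ s * linConst θ s) + 41) * β * a *
        ((n : ℝ) + 1) ^ (-δ) * (m : ℝ) ^ (-(1 + (θ - 2 - s) / 2)) := by
  have hcβ : 0 < c * β := by positivity
  have s1 := E.two_rpow_mul_zetaSum_small hcβ hsmall
  have s2 := E.rateConst_small hcβ hsmall
  have s3 := E.zetaSum_small hcβ hsmall
  have ha0 := H.a_nonneg
  have hθ := E.two_lt
  have hδ := E.δ_pos
  have hδs := E.δ_lt
  have hsθ := E.s_lt
  have hn1 : (1 : ℝ) ≤ (n : ℝ) + 1 := by linarith [(Nat.cast_nonneg n : (0 : ℝ) ≤ n)]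
  have ha4 : a ≤ 1 / 4 := by
    have h1 := logRatio_le_one hn1
    have h2 := E.γ_le
    have h3 := E.γ_pos
    nlinarith [logRatio_pos hn1]
  have hf₀ : ∀ j ≤ n, f₀ j ∈ Icc (3 / 4 : ℝ) (5 / 4) := fun j hj =>
    H₀.mem_Icc hθ hc hβ s1 (by omega)
  obtain ⟨i, hi⟩ : ∃ i, i = n + 1 - m := ⟨_, rfl⟩
  have hil : i = n - (m - 1) := by omega
  have hm1 : (1 : ℝ) ≤ m := by exact_mod_cast (by omega : 1 ≤ m)
  have hmn' : (m : ℝ) ≤ (n : ℝ) + 1 := by exact_mod_cast hmn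
  have hml : ((m - 1 : ℕ) : ℝ) = (m : ℝ) - 1 := by
    rw [Nat.cast_sub (by omega)]; simp
  rw [← hi]
  have hfi := hf₀ i (by omega)
  have hfn := hf₀ n le_rfl
  have hi0 : 0 < f₀ i := by linarith [hfi.1]
  have hn0 : 0 < f₀ n := by linarith [hfn.1]
  have hFn := HR.pos ha4 n le_rfl
  have hfnpos : 0 < f n := by
    have := mul_pos hFn hn0
    rwa [div_mul_cancel₀ _ hn0.ne'] at this
  have key : f i / f n = (f₀ i / f₀ n) * ((f i / f₀ i) / (f n / f₀ n)) := by
    field_simp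
  rw [key]
  have hr1 := E.rateConst_pos
  have hax : a * (m - 1 : ℕ) ≤ a * m := by
    rw [hml]; nlinarith
  have hax0 : 0 ≤ a * (m - 1 : ℕ) := by positivity
  have hsumδ : ∑ j ∈ Finset.Ico i n, ((j : ℝ) + 1) ^ (-δ) ≤
      (m : ℝ) ^ (1 + δ) * ((n : ℝ) + 1) ^ (-δ) := by
    calc _ ≤ ∑ j ∈ Finset.Ico i n, (m : ℝ) ^ δ * ((n : ℝ) + 1) ^ (-δ) := by
          apply Finset.sum_le_sum
          intro j hj
          rw [Finset.mem_Ico] at hj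
          have := succ_rpow_neg_le hδ.le (by omega : 1 ≤ m) (by omega : n + 1 ≤ j + m)
            (by omega)
          exact_mod_cast this
      _ ≤ (m : ℝ) * ((m : ℝ) ^ δ * ((n : ℝ) + 1) ^ (-δ)) := by
          rw [Finset.sum_const, nsmul_eq_mul, Nat.card_Ico]
          gcongr
          omega
      _ = _ := by
          rw [Real.rpow_add (by linarith), Real.rpow_one]; ring
  have hu₀ : |f₀ i / f₀ n - 1| ≤
      8 * (c * β) * zetaSum (θ - 1 - δ) * ((m : ℝ) ^ δ * ((n : ℝ) + 1) ^ (-δ)) := by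
    have h1 : |f₀ i - f₀ n| ≤ 4 * c * β * (zetaSum (θ - 1 - δ) *
        ((m : ℝ) ^ δ * ((n : ℝ) + 1) ^ (-δ))) := by
      calc _ ≤ ∑ j ∈ Finset.Ico i n, |f₀ (j + 1) - f₀ j| := abs_sub_le_sum_Ico f₀ (by omega)
        _ ≤ ∑ j ∈ Finset.Ico i n, 4 * c * β * (((j : ℝ) + 1) ^ (-(θ - 1 - δ)) *
              ((m : ℝ) ^ δ * ((n : ℝ) + 1) ^ (-δ))) := by
            apply Finset.sum_le_sum
            intro j hj
            rw [Finset.mem_Ico] at hj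
            refine (H₀.increment_le hθ hc hβ s1 j (by omega)).trans ?_
            have h2 := succ_rpow_neg_le hδ.le (by omega : 1 ≤ m) (by omega : n + 1 ≤ j + m)
              (by omega)
            push_cast at h2
            have h3 : ((j : ℝ) + 1) ^ (-(θ - 1)) =
                ((j : ℝ) + 1) ^ (-(θ - 1 - δ)) * ((j : ℝ) + 1) ^ (-δ) := by
              rw [← Real.rpow_add (by positivity)]; congr 1; ring
            rw [h3]
            gcongr
        _ ≤ _ := by
            rw [← Finset.mul_sum, ← Finset.sum_mul]
            gcongr
            exact sum_Ico_succ_rpow_le_zetaSum (by linarith) _ _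
    rw [div_sub_one hn0.ne', abs_div, abs_of_pos hn0, div_le_iff₀ hn0]
    refine h1.trans ?_
    have h4 : 0 < c * β * (zetaSum (θ - 1 - δ) * ((m : ℝ) ^ δ * ((n : ℝ) + 1) ^ (-δ))) := by
      have := E.one_le_zetaSum_sub_one_sub
      positivity
    nlinarith [hfn.1]
  have hb := abs_term_le (S := ∑ j ∈ Finset.Ico i n, rate f₀ f j) (u₀ := f₀ i / f₀ n)
    (U := (f i / f₀ i) / (f n / f₀ n)) (h := h m) (Kr := rateConst θ δ s * c) E hc hβ ha0 hv
    hm1 hmn' ha s3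
    (by positivity) (H.g_le m hm (by omega)) (H₀.g_le m hm (by omega))
    (H.g_diff m hm (by omega)) (H.g_taylor m hm (by omega)) hu₀ ?_ ?_ ?_
  · refine hb.trans ?_
    have : 5 * powConst δ s + 8 * (powConst δ s * linConst θ s) + 40 + rateConst θ δ s * c * β ≤
      5 * powConst δ s + 8 * (powConst δ s * linConst θ s) + 41 := by linarith
    gcongr
  · have h1 := HR.div_sub_one_le ha0 ha4 (by omega : m - 1 ≤ n)
    have h2 := HR.one_le_div ha0 ha4 (by omega : i ≤ n)
    rw [← hil] at h1
    rw [abs_of_nonneg (by simpa using h2)]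
    refine h1.trans ?_
    gcongr
  · have h1 := HR.abs_div_sub_le ha0 ha4 (by omega : m - 1 ≤ n)
    rw [← hil] at h1
    refine h1.trans ?_
    gcongr
  · have h1 : ∑ j ∈ Finset.Ico i n, rate f₀ f j - ((m : ℝ) - 1) * (v * a) =
        ∑ j ∈ Finset.Ico i n, (rate f₀ f j - v * a) := by
      rw [Finset.sum_sub_distrib, Finset.sum_const, nsmul_eq_mul, Nat.card_Ico,
        show n - i = m - 1 by omega, hml]
    rw [h1]
    refine (Finset.abs_sum_le_sum_abs _ _).trans ?_
    calc _ ≤ ∑ j ∈ Finset.Ico i n, rateConst θ δ s * c * β * a * ((j : ℝ) + 1) ^ (-δ) :=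
          Finset.sum_le_sum fun j hj => IH j (Finset.mem_Ico.1 hj).2
      _ ≤ _ := by
          rw [← Finset.mul_sum]
          gcongr

theorem abs_e_term_le (E : Exponents θ δ s γ)
    (H : PointSeq θ δ s c β z v a N g₀ e₀ f g e h)
    (H₀ : ZeroSeq θ c β z N f₀ g₀ e₀) (hc : 1 ≤ c) (hβ : 0 < β)
    (hsmall : c * β * smallConst θ δ s ≤ 1) {n : ℕ} (hn : n < N)
    (ha : a ≤ γ * logRatio ((n : ℝ) + 1))
    (HR : RatioSeq a n (fun j => f j / f₀ j) (rate f₀ f)) :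
    |e (n + 1) / f n - e₀ (n + 1) / f₀ n| ≤ 9 * c * β * a * ((n : ℝ) + 1) ^ (-δ) := by
  have hcβ : 0 < c * β := by positivity
  have s1 := E.two_rpow_mul_zetaSum_small hcβ hsmall
  have ha0 := H.a_nonneg
  have hθ := E.two_lt
  have hδ := E.δ_pos
  have hδs := E.δ_lt
  have hsθ := E.s_lt
  have hγ := E.γ_pos
  have hγ' := E.γ_le'
  have hn1 : (1 : ℝ) ≤ (n : ℝ) + 1 := by linarith [(Nat.cast_nonneg n : (0 : ℝ) ≤ n)]
  have hnp : (0 : ℝ) < (n : ℝ) + 1 := by linarith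
  have ha4 : a ≤ 1 / 4 := by
    have h1 := logRatio_le_one hn1
    have h2 := E.γ_le
    nlinarith [logRatio_pos hn1]
  have hfn := H₀.mem_Icc hθ hc hβ s1 hn.le
  have hn0 : 0 < f₀ n := by linarith [hfn.1]
  have hFn := HR.pos ha4 n le_rfl
  have hfnpos : 0 < f n := by
    have := mul_pos hFn hn0
    rwa [div_mul_cancel₀ _ hn0.ne'] at this
  set y := (n : ℝ) + 1 with hy
  set τ := θ - 2 - s with hτ
  have hexp : Real.exp (4 * (a * n)) ≤ 2 * y ^ (τ / 4) := by
    refine le_trans (Real.exp_le_exp.2 ?_)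
      (exp_four_mul_le hγ.le E.γ_le (by linarith : 4 * γ ≤ τ / 4) hn1 le_rfl ha)
    gcongr
    linarith
  have h1 := HR.div_le ha0 ha4 (le_refl n)
  have h2 := HR.div_sub_one_le ha0 ha4 (le_refl n)
  have h3 := HR.one_le_div ha0 ha4 (Nat.zero_le n)
  simp only [Nat.sub_self, H₀.f_zero, H.f_zero, div_one] at h1 h2 h3
  set V := 1 / (f n / f₀ n) with hV
  have hdec : e (n + 1) / f n - e₀ (n + 1) / f₀ n =
      ((e (n + 1) - e₀ (n + 1)) * V + e₀ (n + 1) * (V - 1)) / f₀ n := by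
    rw [hV]; field_simp; ring
  have hp1 : y ^ (-(θ - 1)) * y ^ (τ / 4) ≤ y ^ (-δ) := by
    rw [← Real.rpow_add hnp]
    exact Real.rpow_le_rpow_of_exponent_le hn1 (by linarith)
  have hp2 : y ^ (-θ) * y * y ^ (τ / 4) ≤ y ^ (-δ) := by
    rw [← Real.rpow_add_one hnp.ne', ← Real.rpow_add hnp]
    exact Real.rpow_le_rpow_of_exponent_le hn1 (by linarith)
  have t1 : |(e (n + 1) - e₀ (n + 1)) * V| ≤ 2 * (c * β * a * y ^ (-δ)) := by
    have he := H.e_diff (n + 1) (by omega) hn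
    push_cast at he
    rw [abs_mul, abs_of_nonneg (by linarith : 0 ≤ V)]
    calc _ ≤ (c * β * a * y ^ (-(θ - 1))) * (2 * y ^ (τ / 4)) :=
          mul_le_mul he (h1.trans hexp) (by linarith) (by positivity)
      _ = 2 * (c * β * a * (y ^ (-(θ - 1)) * y ^ (τ / 4))) := by ring
      _ ≤ _ := by gcongr
  have t2 : |e₀ (n + 1) * (V - 1)| ≤ 4 * (c * β * a * y ^ (-δ)) := by
    have he := H₀.e_le (n + 1) (by omega) hn
    push_cast at he
    rw [abs_mul, abs_of_nonneg (by linarith : 0 ≤ V - 1)]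
    have h4 : V - 1 ≤ 2 * (a * y) * (2 * y ^ (τ / 4)) := by
      refine h2.trans ?_
      gcongr
      linarith
    calc _ ≤ (c * β * y ^ (-θ)) * (2 * (a * y) * (2 * y ^ (τ / 4))) :=
          mul_le_mul he h4 (by linarith) (by positivity)
      _ = 4 * (c * β * a * (y ^ (-θ) * y * y ^ (τ / 4))) := by ring
      _ ≤ _ := by gcongr
  rw [hdec, abs_div, abs_of_pos hn0, div_le_iff₀ hn0]
  refine (abs_add_le _ _).trans ((add_le_add t1 t2).trans ?_)
  have : 0 ≤ c * β * a * y ^ (-δ) := by positivity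
  nlinarith [hfn.1]

theorem rate_step (E : Exponents θ δ s γ)
    (H : PointSeq θ δ s c β z v a N g₀ e₀ f g e h)
    (H₀ : ZeroSeq θ c β z N f₀ g₀ e₀) (hc : 1 ≤ c) (hβ : 0 < β)
    (hsmall : c * β * smallConst θ δ s ≤ 1) {n : ℕ} (hn : n < N)
    (ha : a ≤ γ * logRatio ((n : ℝ) + 1))
    (HR : RatioSeq a n (fun j => f j / f₀ j) (rate f₀ f))
    (IH : ∀ j < n, |rate f₀ f j - v * a| ≤ rateConst θ δ s * c * β * a * ((j : ℝ) + 1) ^ (-δ)) :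
    |rate f₀ f n - v * a| ≤ rateConst θ δ s * c * β * a * ((n : ℝ) + 1) ^ (-δ) := by
  have hcβ : 0 < c * β := by positivity
  have s1 := E.two_rpow_mul_zetaSum_small hcβ hsmall
  have s4 := E.le_one_eighth hcβ hsmall
  have hv1 := abs_le.1 (H.abs_v_sub_one_le H₀ (by omega))
  have hv0 : 0 ≤ v := by linarith
  have hv2 : v ≤ 2 := by linarith
  have hv : |v| ≤ 2 := by rwa [abs_of_nonneg hv0]
  have ha0 := H.a_nonneg
  have hθ := E.two_lt
  have hδ := E.δ_pos
  have hδs := E.δ_lt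
  have hsθ := E.s_lt
  have hn1 : (1 : ℝ) ≤ (n : ℝ) + 1 := by linarith [(Nat.cast_nonneg n : (0 : ℝ) ≤ n)]
  have ha4 : a ≤ 1 / 4 := by
    have h1 := logRatio_le_one hn1
    have h2 := E.γ_le
    have h3 := E.γ_pos
    nlinarith [logRatio_pos hn1]
  have hfn := H₀.mem_Icc hθ hc hβ s1 hn.le
  have hfn1 := H₀.mem_Icc hθ hc hβ s1 (by omega : n + 1 ≤ N)
  have hn0 : 0 < f₀ n := by linarith [hfn.1]
  have hn10 : 0 < f₀ (n + 1) := by linarith [hfn1.1]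
  have hFn := HR.pos ha4 n le_rfl
  have hfnpos : 0 < f n := by
    have := mul_pos hFn hn0
    rwa [div_mul_cancel₀ _ hn0.ne'] at this
  set y := (n : ℝ) + 1 with hy
  set r := f₀ (n + 1) / f₀ n with hr
  set Er := e (n + 1) / f n - e₀ (n + 1) / f₀ n with hEr
  set T : ℕ → ℝ := fun m => g m * (f (n + 1 - m) / f n) - g₀ m * (f₀ (n + 1 - m) / f₀ n) -
    a * h m - v * a * (((m : ℝ) - 1) * g₀ m) with hT
  set Dr := z - ∑ m ∈ Finset.Icc 2 (n + 1), h m -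
    v * (1 + ∑ m ∈ Finset.Icc 2 (n + 1), ((m : ℝ) - 1) * g₀ m) with hDr
  have hrw : r * rate f₀ f n = r - f (n + 1) / f n := by
    rw [hr]; unfold rate; field_simp
  have hr' : r = z + ∑ m ∈ Finset.Icc 2 (n + 1), g₀ m * (f₀ (n + 1 - m) / f₀ n) +
      e₀ (n + 1) / f₀ n := by
    rw [hr, H₀.f_succ n hn]
    simp only [← mul_div_assoc]
    rw [← Finset.sum_div]
    field_simp
  have hf' : f (n + 1) / f n = z * (1 - a) +
      ∑ m ∈ Finset.Icc 2 (n + 1), g m * (f (n + 1 - m) / f n) + e (n + 1) / f n := by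
    rw [H.f_succ n hn]
    simp only [← mul_div_assoc]
    rw [← Finset.sum_div]
    field_simp
  have hsumT : ∑ m ∈ Finset.Icc 2 (n + 1), T m =
      ∑ m ∈ Finset.Icc 2 (n + 1), g m * (f (n + 1 - m) / f n) -
      ∑ m ∈ Finset.Icc 2 (n + 1), g₀ m * (f₀ (n + 1 - m) / f₀ n) -
      a * ∑ m ∈ Finset.Icc 2 (n + 1), h m -
      v * a * ∑ m ∈ Finset.Icc 2 (n + 1), ((m : ℝ) - 1) * g₀ m := by
    simp only [hT, Finset.sum_sub_distrib, Finset.mul_sum]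
  have hmain : r * rate f₀ f n - v * a = a * Dr - ∑ m ∈ Finset.Icc 2 (n + 1), T m - Er := by
    rw [hrw, hf', hsumT, hDr, hEr]
    conv_lhs => rw [hr']
    ring
  set Y := y ^ (-δ) with hY
  have hY0 : 0 < Y := by positivity
  set Q := 5 * powConst δ s + 8 * (powConst δ s * linConst θ s) + 41 with hQ
  have hQ0 : 0 < Q := by
    have h1 := E.powConst_pos
    have h2 := E.linConst_pos
    positivity
  set Z := zetaSum (1 + (θ - 2 - s) / 2) with hZ
  have b1 : |∑ m ∈ Finset.Icc 2 (n + 1), T m| ≤ c * β * a * Y * (Q * Z) := by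
    calc _ ≤ ∑ m ∈ Finset.Icc 2 (n + 1), |T m| := Finset.abs_sum_le_sum_abs _ _
      _ ≤ ∑ m ∈ Finset.Icc 2 (n + 1),
            c * Q * β * a * Y * (m : ℝ) ^ (-(1 + (θ - 2 - s) / 2)) := by
          apply Finset.sum_le_sum
          intro m hm
          rw [Finset.mem_Icc] at hm
          exact H.abs_recursion_term_le E H₀ hc hβ hsmall hv hn ha HR IH hm.1 hm.2
      _ ≤ c * Q * β * a * Y * Z := by
          rw [← Finset.mul_sum]
          gcongr
          exact sum_rpow_le_zetaSum (by linarith) _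
      _ = _ := by ring
  have b2 : |Er| ≤ 9 * c * β * a * Y := H.abs_e_term_le E H₀ hc hβ hsmall hn ha HR
  have b3 : |a * Dr| ≤ c * β * a * Y := by
    rw [abs_mul, abs_of_nonneg ha0]
    calc a * |Dr| ≤ a * (c * β * Y) := by gcongr; exact H.drift n hn
      _ = _ := by ring
  have hPY : y ^ (-(θ - 1)) ≤ Y := rpow_neg_le_rpow_neg hn1 (by linarith)
  have b4 : |v * a * (1 - r)| ≤ 32 / 3 * (c * β * a * Y) := by
    have h1 : |1 - r| ≤ 16 / 3 * (c * β * Y) := by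
      rw [abs_sub_comm, hr, div_sub_one hn0.ne', abs_div, abs_of_pos hn0, div_le_iff₀ hn0]
      refine (H₀.increment_le hθ hc hβ s1 n hn).trans ?_
      have h2 : 0 < c * β * Y := by positivity
      have h3 : c * β * y ^ (-(θ - 1)) ≤ c * β * Y := by gcongr
      nlinarith [hfn.1]
    rw [abs_mul, abs_mul, abs_of_nonneg ha0]
    calc |v| * a * |1 - r| ≤ 2 * a * (16 / 3 * (c * β * Y)) := by gcongr
      _ = _ := by ring
  have hrlow : 3 / 5 ≤ r := by
    rw [hr, le_div_iff₀ hn0]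
    linarith [hfn.2, hfn1.1]
  have hfin : |r * (rate f₀ f n - v * a)| ≤ c * β * a * Y * (Q * Z + 21) := by
    have h1 : r * (rate f₀ f n - v * a) =
        a * Dr - ∑ m ∈ Finset.Icc 2 (n + 1), T m - Er + v * a * (1 - r) := by
      rw [← hmain]; ring
    rw [h1]
    refine (abs_add_le _ _).trans ?_
    have h2 := abs_sub (a * Dr - ∑ m ∈ Finset.Icc 2 (n + 1), T m) Er
    have h3 := abs_sub (a * Dr) (∑ m ∈ Finset.Icc 2 (n + 1), T m)
    have h4 : 0 ≤ c * β * a * Y := by positivity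
    linarith
  rw [abs_mul, abs_of_pos (by linarith)] at hfin
  have hRC : rateConst θ δ s = 2 * (Q * Z + 21) := rfl
  rw [hRC]
  have h5 : 3 / 5 * |rate f₀ f n - v * a| ≤ r * |rate f₀ f n - v * a| := by gcongr
  have h6 : 0 ≤ c * β * a * Y * (Q * Z + 21) := by
    have : 1 ≤ Z := one_le_zetaSum (by linarith)
    positivity
  linarith

/-- In the region `a ≤ γ logRatio n`, the normalised sequence decays at a rate close to `v a`. -/
theorem abs_rate_sub_le (E : Exponents θ δ s γ)
    (H : PointSeq θ δ s c β z v a N g₀ e₀ f g e h)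
    (H₀ : ZeroSeq θ c β z N f₀ g₀ e₀) (hc : 1 ≤ c) (hβ : 0 < β)
    (hsmall : c * β * smallConst θ δ s ≤ 1) :
    ∀ n < N, a ≤ γ * logRatio ((n : ℝ) + 1) →
      |rate f₀ f n - v * a| ≤ rateConst θ δ s * c * β * a * ((n : ℝ) + 1) ^ (-δ) ∧
      RatioSeq a (n + 1) (fun j => f j / f₀ j) (rate f₀ f) := by
  have hcβ : 0 < c * β := by positivity
  have s2 := E.rateConst_small hcβ hsmall
  have s4 := E.le_one_eighth hcβ hsmall
  have ha0 := H.a_nonneg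
  intro n
  induction n using Nat.strong_induction_on with
  | _ n ih =>
  intro hn ha
  have hn1 : (1 : ℝ) ≤ (n : ℝ) + 1 := by linarith [(Nat.cast_nonneg n : (0 : ℝ) ≤ n)]
  have hv1 := abs_le.1 (H.abs_v_sub_one_le H₀ (by omega))
  have ha4 : a ≤ 1 / 4 := by
    have h1 := logRatio_le_one hn1
    have h2 := E.γ_le
    have h3 := E.γ_pos
    nlinarith [logRatio_pos hn1]
  have IH : ∀ j < n,
      |rate f₀ f j - v * a| ≤ rateConst θ δ s * c * β * a * ((j : ℝ) + 1) ^ (-δ) := by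
    intro j hj
    refine (ih j hj (by omega) (ha.trans ?_)).1
    have hj' : (j : ℝ) + 1 ≤ (n : ℝ) + 1 := by exact_mod_cast (by omega : j + 1 ≤ n + 1)
    have := E.γ_pos
    gcongr
    exact logRatio_anti (by linarith [(Nat.cast_nonneg j : (0 : ℝ) ≤ j)]) hj'
  have hw : ∀ j : ℕ, |rate f₀ f j - v * a| ≤ rateConst θ δ s * c * β * a * ((j : ℝ) + 1) ^ (-δ) →
      a / 2 ≤ rate f₀ f j ∧ rate f₀ f j ≤ 2 * a := by
    intro j hj
    have h1 : ((j : ℝ) + 1) ^ (-δ) ≤ 1 :=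
      rpow_neg_le_one (by linarith [(Nat.cast_nonneg j : (0 : ℝ) ≤ j)]) E.δ_pos.le
    have hr := E.rateConst_pos
    have h2 : rateConst θ δ s * c * β * a * ((j : ℝ) + 1) ^ (-δ) ≤ 1 / 8 * a * 1 := by
      gcongr
      linarith
    have h3 := abs_le.1 (hj.trans h2)
    constructor <;> nlinarith
  have HR : RatioSeq a n (fun j => f j / f₀ j) (rate f₀ f) :=
    ratioSeq_of_rate ha4 H₀.f_zero H.f_zero (fun j hj => (hw j (IH j hj)).1)
      (fun j hj => (hw j (IH j hj)).2)
  have hstep := H.rate_step E H₀ hc hβ hsmall hn ha HR IH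
  have hall : ∀ j < n + 1,
      |rate f₀ f j - v * a| ≤ rateConst θ δ s * c * β * a * ((j : ℝ) + 1) ^ (-δ) := by
    intro j hj
    rcases Nat.lt_succ_iff_lt_or_eq.1 hj with h | h
    · exact IH j h
    · rw [h]; exact hstep
  exact ⟨hstep, ratioSeq_of_rate ha4 H₀.f_zero H.f_zero (fun j hj => (hw j (hall j hj)).1)
      (fun j hj => (hw j (hall j hj)).2)⟩

end PointSeq

end LaceRecursion

namespace LaceRecursion

theorem rpow_mul_exp_neg_le {p t : ℝ} (hp : 0 < p) (ht : 0 ≤ t) :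
    t ^ p * Real.exp (-t) ≤ p ^ p := by
  have h1 : t / p ≤ Real.exp (t / p) := by linarith [Real.add_one_le_exp (t / p)]
  have h2 : (t / p) ^ p ≤ Real.exp t := by
    calc (t / p) ^ p ≤ Real.exp (t / p) ^ p := Real.rpow_le_rpow (by positivity) h1 hp.le
      _ = Real.exp t := by rw [← Real.exp_mul]; congr 1; field_simp
  rw [Real.div_rpow ht hp.le, div_le_iff₀ (by positivity)] at h2
  rw [Real.exp_neg, ← div_eq_mul_inv, div_le_iff₀ (Real.exp_pos _)]
  linarith

/-- At the boundary of the Gaussian region, exponential decay gives the polynomial bound of the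
complementary region. -/
theorem exp_neg_le_of_logRatio_lt {a γ θ κ x y : ℝ} (hγ : 0 < γ) (hκ : κ = γ / 8) (hκθ : κ < θ)
    (hx : 1 ≤ x) (hxy : x ≤ y) (hyx : y ≤ 2 * x) (ha : γ * logRatio y < a) :
    Real.exp (-(a * x) / 2) ≤ (4 * (θ - κ)) ^ (θ - κ) * (a ^ (-(θ - κ)) * x ^ (-θ)) := by
  have hx0 : 0 < x := by linarith
  have hy0 : 0 < y := by linarith
  have ha0 : 0 < a := lt_of_le_of_lt (mul_nonneg hγ.le (logRatio_pos (hx.trans hxy)).le) ha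
  have hp : 0 < θ - κ := by linarith
  have h1 : γ * (1 + Real.log y) ≤ a * y := by
    have : γ * logRatio y * y ≤ a * y := by gcongr
    refine le_trans (le_of_eq ?_) this
    unfold logRatio; field_simp
  have hlog : Real.log x ≤ Real.log y := Real.log_le_log hx0 hxy
  have h2 : κ * Real.log x ≤ a * x / 4 := by
    rw [hκ]
    nlinarith
  have h3 : x ^ κ * Real.exp (-(a * x / 4)) ≤ 1 := by
    rw [Real.rpow_def_of_pos hx0, ← Real.exp_add]
    apply Real.exp_le_one_iff.2
    linarith
  have h4 := rpow_mul_exp_neg_le hp (by positivity : 0 ≤ a * x / 4)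
  have h5 : (a * x / 4) ^ (θ - κ) = a ^ (θ - κ) * x ^ (θ - κ) / 4 ^ (θ - κ) := by
    rw [Real.div_rpow (by positivity) (by norm_num), Real.mul_rpow ha0.le hx0.le]
  rw [h5] at h4
  have h6 : a ^ (θ - κ) * x ^ (θ - κ) * Real.exp (-(a * x / 4)) ≤ (4 * (θ - κ)) ^ (θ - κ) := by
    rw [Real.mul_rpow (by norm_num) hp.le]
    have : (0 : ℝ) < 4 ^ (θ - κ) := by positivity
    rw [div_mul_eq_mul_div, div_le_iff₀ this] at h4
    linarith
  have h7 : a ^ (θ - κ) * x ^ θ * Real.exp (-(a * x) / 2) ≤ (4 * (θ - κ)) ^ (θ - κ) := by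
    calc _ = (a ^ (θ - κ) * x ^ (θ - κ) * Real.exp (-(a * x / 4))) *
          (x ^ κ * Real.exp (-(a * x / 4))) := by
          have e1 : x ^ θ = x ^ (θ - κ) * x ^ κ := by rw [← Real.rpow_add hx0]; congr 1; ring
          have e2 : Real.exp (-(a * x) / 2) =
              Real.exp (-(a * x / 4)) * Real.exp (-(a * x / 4)) := by
            rw [← Real.exp_add]; congr 1; ring
          rw [e1, e2]; ring
      _ ≤ (4 * (θ - κ)) ^ (θ - κ) * 1 := by gcongr
      _ = _ := mul_one _
  rw [Real.rpow_neg ha0.le, Real.rpow_neg hx0.le, ← mul_inv, ← div_eq_mul_inv,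
    le_div_iff₀ (by positivity)]
  linarith

theorem sum_exp_neg_le {a : ℝ} (ha : 0 < a) (ha2 : a ≤ 2) (n : ℕ) :
    ∑ j ∈ Finset.range n, Real.exp (-(a * j) / 2) ≤ 4 / a := by
  set r := Real.exp (-a / 2) with hr
  have hr0 : 0 < r := Real.exp_pos _
  have h1 : r * (1 + a / 2) ≤ 1 := by
    have h2 := Real.add_one_le_exp (a / 2)
    have h3 : r * Real.exp (a / 2) = 1 := by
      rw [hr, ← Real.exp_add]; simp [neg_div]
    nlinarith
  have hr1 : r < 1 := by nlinarith
  have h4 : ∑ j ∈ Finset.range n, Real.exp (-(a * j) / 2) = ∑ j ∈ Finset.range n, r ^ j := by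
    apply Finset.sum_congr rfl
    intro j _
    rw [hr, ← Real.exp_nat_mul]; congr 1; ring
  rw [h4]
  have h5 : (∑ j ∈ Finset.range n, r ^ j) * (1 - r) ≤ 1 := by
    rw [geom_sum_mul_neg]
    have : 0 ≤ r ^ n := by positivity
    linarith
  have h6 : a / 4 ≤ 1 - r := by nlinarith
  rw [le_div_iff₀ ha]
  have h7 : 0 ≤ ∑ j ∈ Finset.range n, r ^ j := Finset.sum_nonneg fun _ _ => by positivity
  nlinarith

theorem abs_one_sub_le {a η : ℝ} (hη : 0 < η) (hη1 : η ≤ 1) (ha : 0 ≤ a) (ha2 : a ≤ 2 - η) :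
    |1 - a| ≤ 1 - η / 2 * a := by
  rw [abs_le]
  constructor <;> nlinarith

theorem one_sub_mul_exp_le {x : ℝ} (hx : 0 ≤ x) (hx1 : x ≤ 1) :
    (1 - 2 * x) * Real.exp x ≤ 1 - x / 2 := by
  have h1 : 1 - 2 * x ≤ Real.exp (-(2 * x)) := by linarith [Real.add_one_le_exp (-(2 * x))]
  have h2 : (1 - 2 * x) * Real.exp x ≤ Real.exp (-x) := by
    calc _ ≤ Real.exp (-(2 * x)) * Real.exp x := by gcongr
      _ = _ := by rw [← Real.exp_add]; congr 1; ring
  refine h2.trans ?_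
  have h3 := Real.add_one_le_exp x
  have h4 : Real.exp (-x) * Real.exp x = 1 := by rw [← Real.exp_add]; simp
  have h5 := Real.exp_pos (-x)
  have h6 : Real.exp (-x) * (1 + x) ≤ 1 := by nlinarith
  nlinarith

namespace PointSeq

variable {θ δ s γ c β z v a : ℝ} {N : ℕ} {f₀ g₀ e₀ f g e h : ℕ → ℝ}

theorem abs_le_two (H : PointSeq θ δ s c β z v a N g₀ e₀ f g e h)
    (H₀ : ZeroSeq θ c β z N f₀ g₀ e₀) (hθ : 2 < θ) (hc : 1 ≤ c) (hβ : 0 < β) (ha2 : a ≤ 2)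
    {n₀ : ℕ} (hsmall : c * β * (zetaSum θ + 2) * n₀ ≤ 1 / 2) {n : ℕ} (hn : n ≤ n₀) (hnN : n ≤ N) :
    |f n| ≤ 2 := by
  have hZ : 1 ≤ zetaSum θ := one_le_zetaSum (by linarith)
  set x := c * β * (zetaSum θ + 2) with hx
  have hx0 : 0 < x := by positivity
  have key : ∀ n ≤ N, ∀ j ≤ n, |f j| ≤ (1 + x) ^ n := by
    intro n
    induction n with
    | zero =>
      intro _ j hj
      have : j = 0 := by omega
      rw [this, H.f_zero]; simp
    | succ n ih =>
      intro hn j hj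
      set M := (1 + x) ^ n with hM
      have hM1 : 1 ≤ M := one_le_pow₀ (by linarith)
      have ih' := ih (by omega)
      have hMM : M ≤ (1 + x) ^ (n + 1) := by rw [pow_succ]; nlinarith
      rcases Nat.le_succ_iff.1 hj with h1 | h1
      · exact (ih' j h1).trans hMM
      · rw [h1, Nat.succ_eq_add_one, H.f_succ n hn]
        have hz : |z| ≤ 1 + c * β := by
          have h2 := H₀.crit 0 (by omega)
          simp at h2
          have := abs_le.1 h2
          exact abs_le.2 ⟨by linarith, by linarith⟩
        have ha1 : |1 - a| ≤ 1 := abs_le.2 ⟨by linarith [H.a_nonneg], by linarith [H.a_nonneg]⟩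
        have b1 : |z * (1 - a) * f n| ≤ (1 + c * β) * 1 * M := by
          rw [abs_mul, abs_mul]
          have := ih' n le_rfl
          gcongr
        have b2 : |∑ m ∈ Finset.Icc 2 (n + 1), g m * f (n + 1 - m)| ≤ c * β * zetaSum θ * M := by
          calc _ ≤ ∑ m ∈ Finset.Icc 2 (n + 1), |g m * f (n + 1 - m)| :=
                Finset.abs_sum_le_sum_abs _ _
            _ ≤ ∑ m ∈ Finset.Icc 2 (n + 1), c * β * M * (m : ℝ) ^ (-θ) := by
                apply Finset.sum_le_sum
                intro m hm
                rw [Finset.mem_Icc] at hm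
                rw [abs_mul]
                calc _ ≤ (c * β * (m : ℝ) ^ (-θ)) * M :=
                      mul_le_mul (H.g_le m hm.1 (by omega)) (ih' _ (by omega)) (abs_nonneg _)
                        (by positivity)
                  _ = _ := by ring
            _ ≤ c * β * M * zetaSum θ := by
                rw [← Finset.mul_sum]
                gcongr
                exact sum_rpow_le_zetaSum (by linarith) _
            _ = _ := by ring
        have b3 : |e (n + 1)| ≤ c * β * M := by
          refine (H.e_le (n + 1) (by omega) hn).trans ?_
          gcongr
          refine le_trans (rpow_neg_le_one ?_ (by linarith)) hM1
          exact_mod_cast (by omega : 1 ≤ n + 1)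
        refine (abs_add_le _ _).trans ((add_le_add ((abs_add_le _ _).trans
          (add_le_add b1 b2)) b3).trans (le_of_eq ?_))
        rw [pow_succ, hx]; ring
  refine (key n hnN n le_rfl).trans ?_
  have h1 : (1 + x) ^ n ≤ Real.exp (n * x) := by
    rw [Real.exp_nat_mul]
    gcongr
    linarith [Real.add_one_le_exp x]
  refine h1.trans ?_
  have h2 : (n : ℝ) * x ≤ 1 / 2 := by
    have : (n : ℝ) ≤ n₀ := by exact_mod_cast hn
    nlinarith
  have h3 := Real.exp_one_lt_d9
  have h4 : Real.exp (1 / 2) * Real.exp (1 / 2) = Real.exp 1 := by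
    rw [← Real.exp_add]; norm_num
  have h5 : Real.exp (n * x) ≤ Real.exp (1 / 2) := Real.exp_le_exp.2 h2
  nlinarith [Real.exp_pos (1 / 2 : ℝ)]

/-- The sum of the coefficients is close to `1 - a`. -/
theorem abs_sum_coeff_le (H : PointSeq θ δ s c β z v a N g₀ e₀ f g e h)
    (H₀ : ZeroSeq θ c β z N f₀ g₀ e₀) (hθ : 2 < θ) (hc : 1 ≤ c) (hβ : 0 < β) (hγ : 0 < γ)
    {n : ℕ} (hn : n < N) (ha : γ * logRatio ((n : ℝ) + 1) < a) :
    |z * (1 - a) + ∑ m ∈ Finset.Icc 2 (n + 1), g m - (1 - a)| ≤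
      c * β * (1 / γ + 1 + zetaSum (θ - 1)) * a := by
  have hn1 : (1 : ℝ) ≤ (n : ℝ) + 1 := by linarith [(Nat.cast_nonneg n : (0 : ℝ) ≤ n)]
  have ha0 := H.a_nonneg
  have hinv : ((n : ℝ) + 1) ^ (-(θ - 1)) ≤ 1 / γ * a := by
    have h1 : ((n : ℝ) + 1) ^ (-(θ - 1)) ≤ ((n : ℝ) + 1)⁻¹ := by
      rw [← Real.rpow_neg_one]
      exact Real.rpow_le_rpow_of_exponent_le hn1 (by linarith)
    have h2 := inv_le_logRatio hn1
    rw [one_div, inv_mul_eq_div, le_div_iff₀ hγ]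
    nlinarith
  have hdec : z * (1 - a) + ∑ m ∈ Finset.Icc 2 (n + 1), g m - (1 - a) =
      (z + ∑ m ∈ Finset.Icc 2 (n + 1), g₀ m - 1) + (1 - z) * a +
      ∑ m ∈ Finset.Icc 2 (n + 1), (g m - g₀ m) := by
    rw [Finset.sum_sub_distrib]; ring
  have b1 : |z + ∑ m ∈ Finset.Icc 2 (n + 1), g₀ m - 1| ≤ c * β * (1 / γ * a) := by
    refine (H₀.crit n hn).trans ?_
    gcongr
  have b2 : |(1 - z) * a| ≤ c * β * a := by
    have h2 := H₀.crit 0 (by omega)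
    simp at h2
    rw [abs_mul, abs_sub_comm, abs_of_nonneg ha0]
    gcongr
  have b3 : |∑ m ∈ Finset.Icc 2 (n + 1), (g m - g₀ m)| ≤ c * β * a * zetaSum (θ - 1) := by
    calc _ ≤ ∑ m ∈ Finset.Icc 2 (n + 1), |g m - g₀ m| := Finset.abs_sum_le_sum_abs _ _
      _ ≤ ∑ m ∈ Finset.Icc 2 (n + 1), c * β * a * (m : ℝ) ^ (-(θ - 1)) := by
          apply Finset.sum_le_sum
          intro m hm
          rw [Finset.mem_Icc] at hm
          exact H.g_diff m hm.1 (by omega)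
      _ ≤ _ := by
          rw [← Finset.mul_sum]
          gcongr
          exact sum_rpow_le_zetaSum (by linarith) _
  rw [hdec]
  refine (abs_add_le _ _).trans ((add_le_add ((abs_add_le _ _).trans
    (add_le_add b1 b2)) b3).trans (le_of_eq ?_))
  ring

/-- Bounds in the Gaussian region. -/
theorem abs_le_exp (E : Exponents θ δ s γ)
    (H : PointSeq θ δ s c β z v a N g₀ e₀ f g e h)
    (H₀ : ZeroSeq θ c β z N f₀ g₀ e₀) (hc : 1 ≤ c) (hβ : 0 < β)
    (hsmall : c * β * smallConst θ δ s ≤ 1) {n : ℕ} (hn : n < N)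
    (ha : a ≤ γ * logRatio ((n : ℝ) + 1)) :
    |f (n + 1)| ≤ 5 / 4 * Real.exp (-(a * ((n : ℝ) + 1)) / 2) ∧
    |f (n + 1) - f n| ≤ (4 * c * β * ((n : ℝ) + 1) ^ (-(θ - 1)) + 5 * a) *
      Real.exp (-(a * ((n : ℝ) + 1)) / 2) := by
  have hcβ : 0 < c * β := by positivity
  have s1 := E.two_rpow_mul_zetaSum_small hcβ hsmall
  have HR := (H.abs_rate_sub_le E H₀ hc hβ hsmall n hn ha).2
  have hn1 : (1 : ℝ) ≤ (n : ℝ) + 1 := by linarith [(Nat.cast_nonneg n : (0 : ℝ) ≤ n)]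
  have ha0 := H.a_nonneg
  have ha4 : a ≤ 1 / 4 := by
    have h1 := logRatio_le_one hn1
    have h2 := E.γ_le
    have h3 := E.γ_pos
    nlinarith [logRatio_pos hn1]
  have hf := H₀.mem_Icc E.two_lt hc hβ s1 (by omega : n + 1 ≤ N)
  have hf' := H₀.mem_Icc E.two_lt hc hβ s1 (by omega : n ≤ N)
  have p1 : 0 < f₀ (n + 1) := by linarith [hf.1]
  have p2 : 0 < f₀ n := by linarith [hf'.1]
  have hF := HR.pos ha4 (n + 1) le_rfl
  have hF' := HR.pos ha4 n (by omega)
  have hL := HR.le_exp ha4 (n + 1) le_rfl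
  have hL' := HR.le_exp ha4 n (by omega)
  have hS := HR.F_succ n (by omega)
  have hw := HR.w_le n (by omega)
  have hw' := HR.le_w n (by omega)
  push_cast at hL
  set X := Real.exp (-(a * ((n : ℝ) + 1)) / 2) with hX
  have hX0 : 0 < X := Real.exp_pos _
  have hX' : Real.exp (-(a * n) / 2) ≤ 2 * X := by
    have h1 : Real.exp (-(a * n) / 2) = Real.exp (a / 2) * X := by
      rw [hX, ← Real.exp_add]; congr 1; ring
    rw [h1]
    gcongr
    have h3 := Real.exp_one_lt_d9
    have h4 : Real.exp (1 / 2) * Real.exp (1 / 2) = Real.exp 1 := by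
      rw [← Real.exp_add]; norm_num
    have h5 : Real.exp (a / 2) ≤ Real.exp (1 / 2) := Real.exp_le_exp.2 (by linarith)
    nlinarith [Real.exp_pos (1 / 2 : ℝ)]
  have e1 : f (n + 1) = f₀ (n + 1) * (f (n + 1) / f₀ (n + 1)) := by field_simp
  have e2 : f n = f₀ n * (f n / f₀ n) := by field_simp
  constructor
  · rw [e1, abs_mul, abs_of_pos p1, abs_of_pos hF]
    exact mul_le_mul hf.2 hL hF.le (by norm_num)
  · have hdec : f (n + 1) - f n = (f₀ (n + 1) - f₀ n) * (f (n + 1) / f₀ (n + 1)) -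
        f₀ n * (rate f₀ f n * (f n / f₀ n)) := by
      have : f n / f₀ n - f (n + 1) / f₀ (n + 1) = rate f₀ f n * (f n / f₀ n) := by
        rw [hS]; ring
      rw [← this]
      field_simp
      ring
    rw [hdec]
    have b1 : |(f₀ (n + 1) - f₀ n) * (f (n + 1) / f₀ (n + 1))| ≤
        4 * c * β * ((n : ℝ) + 1) ^ (-(θ - 1)) * X := by
      rw [abs_mul, abs_of_pos hF]
      exact mul_le_mul (H₀.increment_le E.two_lt hc hβ s1 n hn) hL hF.le (by positivity)
    have b2 : |f₀ n * (rate f₀ f n * (f n / f₀ n))| ≤ 5 / 4 * (2 * a * (2 * X)) := by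
      rw [abs_mul, abs_mul, abs_of_pos p2, abs_of_pos hF', abs_of_nonneg (by linarith)]
      have h6 : f n / f₀ n ≤ 2 * X := hL'.trans hX'
      have : rate f₀ f n * (f n / f₀ n) ≤ 2 * a * (2 * X) :=
        mul_le_mul hw h6 hF'.le (by linarith)
      exact mul_le_mul hf'.2 this (mul_nonneg (by linarith) hF'.le) (by norm_num)
    refine (abs_sub _ _).trans ((add_le_add b1 b2).trans (le_of_eq ?_))
    ring

end PointSeq

end LaceRecursion

namespace LaceRecursion

theorem tail_le_inv_mul {a γ θ κ x : ℝ} (hγ : 0 < γ) (hκ : κ ≤ θ - 1) (hx : 1 ≤ x)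
    (ha : γ * logRatio x < a) :
    a ^ (-(θ - κ)) * x ^ (-θ) ≤ γ ^ (-(θ - 1 - κ)) * (a⁻¹ * x ^ (-(1 + κ))) := by
  have hx0 : 0 < x := by linarith
  have ha0 : 0 < a := lt_of_le_of_lt (mul_nonneg hγ.le (logRatio_pos hx).le) ha
  have h1 : γ ≤ a * x := by
    have h2 : γ * x⁻¹ ≤ a := (mul_le_mul_of_nonneg_left (inv_le_logRatio hx) hγ.le).trans ha.le
    rwa [← div_eq_mul_inv, div_le_iff₀ hx0] at h2
  have h3 : (a * x) ^ (-(θ - 1 - κ)) ≤ γ ^ (-(θ - 1 - κ)) :=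
    Real.rpow_le_rpow_of_nonpos hγ h1 (by linarith)
  calc a ^ (-(θ - κ)) * x ^ (-θ) = (a * x) ^ (-(θ - 1 - κ)) * (a⁻¹ * x ^ (-(1 + κ))) := by
        rw [Real.mul_rpow ha0.le hx0.le, ← Real.rpow_neg_one a]
        have e1 : a ^ (-(θ - κ)) = a ^ (-(θ - 1 - κ)) * a ^ (-1 : ℝ) := by
          rw [← Real.rpow_add ha0]; congr 1; ring
        have e2 : x ^ (-θ) = x ^ (-(θ - 1 - κ)) * x ^ (-(1 + κ)) := by
          rw [← Real.rpow_add hx0]; congr 1; ring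
        rw [e1, e2]; ring
    _ ≤ _ := by gcongr

theorem mul_exp_neg_half_le {a x : ℝ} (ha : 0 < a) : x * Real.exp (-(a * x) / 2) ≤ 2 / a := by
  have h1 := Real.add_one_le_exp (a * x / 2)
  have h2 : Real.exp (-(a * x) / 2) * Real.exp (a * x / 2) = 1 := by
    rw [← Real.exp_add]; simp [neg_div]
  have h3 := Real.exp_pos (-(a * x) / 2)
  rw [le_div_iff₀ ha]
  nlinarith

/-- The boundary constant in `exp_neg_le_of_logRatio_lt`. -/
noncomputable def boundaryConst (θ κ : ℝ) : ℝ := (4 * (θ - κ)) ^ (θ - κ)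

/-- The constant in the bound on the convolution outside the Gaussian region. -/
noncomputable def convConst (θ γ κ K₄ K₅ : ℝ) : ℝ :=
  2 ^ θ * (2 ^ θ * ((K₅ + 6 * boundaryConst θ κ) * zetaSum (θ - 1)) +
    2 ^ θ * (12 + 2 * K₄ * γ ^ (-(θ - 1 - κ)) * zetaSum (1 + κ)))

namespace PointSeq

variable {θ δ s γ κ c β z v a K₄ K₅ : ℝ} {N : ℕ} {f₀ g₀ e₀ f g e h : ℕ → ℝ}

set_option maxHeartbeats 1000000 in
theorem abs_convolution_le (E : Exponents θ δ s γ)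
    (H : PointSeq θ δ s c β z v a N g₀ e₀ f g e h)
    (H₀ : ZeroSeq θ c β z N f₀ g₀ e₀) (hc : 1 ≤ c) (hβ : 0 < β)
    (hsmall : c * β * smallConst θ δ s ≤ 1) (hγβ : 8 * (c * β) ≤ γ) (hκ : κ = γ / 8)
    (hK₄ : 1 ≤ K₄) (hK₅ : 1 ≤ K₅)
    (ha2 : a ≤ 2) {n : ℕ} (hn : n < N) (ha : γ * logRatio ((n : ℝ) + 1) < a)
    (IH : ∀ j < n, γ * logRatio ((j : ℝ) + 1) < a →
      |f (j + 1)| ≤ K₄ * (a ^ (-(θ - κ)) * ((j : ℝ) + 1) ^ (-θ)) ∧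
      |f (j + 1) - f j| ≤ K₅ * (a ^ (-(θ - 1 - κ)) * ((j : ℝ) + 1) ^ (-θ))) :
    |∑ m ∈ Finset.Icc 2 (n + 1), g m * (f (n + 1 - m) - f n)| ≤
      c * β * convConst θ γ κ K₄ K₅ * (a ^ (-(θ - 1 - κ)) * ((n : ℝ) + 1) ^ (-θ)) := by
  have hcβ : 0 < c * β := by positivity
  have hn1 : (1 : ℝ) ≤ (n : ℝ) + 1 := by linarith [(Nat.cast_nonneg n : (0 : ℝ) ≤ n)]
  have hγ := E.γ_pos
  have hγ8 := E.γ_le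
  have hθ := E.two_lt
  have hκ0 : 0 < κ := by rw [hκ]; linarith
  have hκθ : κ < θ - 2 := by rw [hκ]; linarith [E.γ_le', E.s_lt, E.δ_lt, E.δ_pos]
  have ha0 : 0 < a := lt_of_le_of_lt (mul_nonneg hγ.le (logRatio_pos hn1).le) ha
  set y := (n : ℝ) + 1 with hy
  set C₆ := boundaryConst θ κ with hC₆
  have hC₆0 : 0 < C₆ := Real.rpow_pos_of_pos (by linarith) _
  set G := γ ^ (-(θ - 1 - κ)) with hG
  have hG0 : 0 < G := by positivity
  set q := θ - 1 - κ with hq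
  set Q := a ^ (-q) with hQ
  have hQ0 : 0 < Q := by positivity
  have hZ := E.one_le_zetaSum_sub_one
  have hZκ : 1 ≤ zetaSum (1 + κ) := one_le_zetaSum (by linarith)
  have h2θ : (1 : ℝ) ≤ 2 ^ θ := Real.one_le_rpow (by norm_num) (by linarith)
  have hinvQ : a⁻¹ ≤ 2 ^ θ * Q := by
    have h1 : a⁻¹ = a ^ (q - 1) * Q := by
      rw [hQ, ← Real.rpow_add ha0, ← Real.rpow_neg_one]; congr 1; ring
    rw [h1]
    gcongr
    calc a ^ (q - 1) ≤ 2 ^ (q - 1) := Real.rpow_le_rpow ha0.le ha2 (by linarith)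
      _ ≤ 2 ^ θ := Real.rpow_le_rpow_of_exponent_le (by norm_num) (by linarith)
  have hfj : ∀ j ≤ n, |f j| ≤
      2 * Real.exp (-(a * j) / 2) + K₄ * G * a⁻¹ * (j : ℝ) ^ (-(1 + κ)) := by
    intro j hj
    rcases Nat.eq_zero_or_pos j with h0 | h0
    · rw [h0, H.f_zero]
      have : 0 ≤ K₄ * G * a⁻¹ * ((0 : ℕ) : ℝ) ^ (-(1 + κ)) := by positivity
      simp only [Nat.cast_zero, mul_zero, neg_zero, zero_div, Real.exp_zero, abs_one]
      simp only [Nat.cast_zero] at this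
      linarith
    · obtain ⟨i, rfl⟩ : ∃ i, j = i + 1 := ⟨j - 1, by omega⟩
      have hi1 : (1 : ℝ) ≤ (i : ℝ) + 1 := by linarith [(Nat.cast_nonneg i : (0 : ℝ) ≤ i)]
      push_cast
      rcases le_or_gt a (γ * logRatio ((i : ℝ) + 1)) with h1 | h1
      · have h2 := (H.abs_le_exp E H₀ hc hβ hsmall (by omega : i < N) h1).1
        have h3 : 0 ≤ K₄ * G * a⁻¹ * ((i : ℝ) + 1) ^ (-(1 + κ)) := by positivity
        have h4 := Real.exp_pos (-(a * ((i : ℝ) + 1)) / 2)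
        linarith
      · have h2 := (IH i (by omega) h1).1
        have h3 := tail_le_inv_mul hγ (by linarith : κ ≤ θ - 1) hi1 h1
        have h4 := Real.exp_pos (-(a * ((i : ℝ) + 1)) / 2)
        have h5 : K₄ * (a ^ (-(θ - κ)) * ((i : ℝ) + 1) ^ (-θ)) ≤
          K₄ * (G * (a⁻¹ * ((i : ℝ) + 1) ^ (-(1 + κ)))) := by gcongr
        linarith
  have hsumf : ∑ j ∈ Finset.range n, |f j| ≤ (8 + K₄ * G * zetaSum (1 + κ)) * a⁻¹ := by
    calc _ ≤ ∑ j ∈ Finset.range n,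
          (2 * Real.exp (-(a * j) / 2) + K₄ * G * a⁻¹ * (j : ℝ) ^ (-(1 + κ))) :=
          Finset.sum_le_sum fun j hj => hfj j (Finset.mem_range.1 hj).le
      _ = 2 * ∑ j ∈ Finset.range n, Real.exp (-(a * j) / 2) +
          K₄ * G * a⁻¹ * ∑ j ∈ Finset.range n, (j : ℝ) ^ (-(1 + κ)) := by
          rw [Finset.sum_add_distrib, Finset.mul_sum, Finset.mul_sum]
      _ ≤ 2 * (4 / a) + K₄ * G * a⁻¹ * zetaSum (1 + κ) := by
          gcongr
          · exact sum_exp_neg_le ha0 ha2 n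
          · exact sum_rpow_le_zetaSum (by linarith) _
      _ = _ := by rw [div_eq_mul_inv]; ring
  have hnf : (n : ℝ) * |f n| ≤ (4 + K₄ * G * zetaSum (1 + κ)) * a⁻¹ := by
    have h1 : (n : ℝ) * (n : ℝ) ^ (-(1 + κ)) ≤ 1 := by
      rcases Nat.eq_zero_or_pos n with h0 | h0
      · rw [h0]; simp
      · have hn0 : (0 : ℝ) < n := by exact_mod_cast h0
        rw [mul_comm, ← Real.rpow_add_one hn0.ne']
        exact Real.rpow_le_one_of_one_le_of_nonpos (by exact_mod_cast h0) (by linarith)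
    have h2 := mul_exp_neg_half_le (x := n) ha0
    calc (n : ℝ) * |f n| ≤ n * (2 * Real.exp (-(a * n) / 2) +
          K₄ * G * a⁻¹ * (n : ℝ) ^ (-(1 + κ))) := by gcongr; exact hfj n le_rfl
      _ = 2 * (n * Real.exp (-(a * n) / 2)) + K₄ * G * a⁻¹ * (n * (n : ℝ) ^ (-(1 + κ))) := by ring
      _ ≤ 2 * (2 / a) + K₄ * G * a⁻¹ * zetaSum (1 + κ) := by
          gcongr
          exact h1.trans hZκ
      _ = _ := by rw [div_eq_mul_inv]; ring
  set M := K₅ + 6 * C₆ with hM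
  have hM0 : 0 < M := by positivity
  have hinc : ∀ j < n, n + 1 ≤ 2 * (j + 1) → |f (j + 1) - f j| ≤ M * Q * (2 ^ θ * y ^ (-θ)) := by
    intro j hj hj2
    have hj1 : (1 : ℝ) ≤ (j : ℝ) + 1 := by linarith [(Nat.cast_nonneg j : (0 : ℝ) ≤ j)]
    have hjy : y ≤ 2 * ((j : ℝ) + 1) := by rw [hy]; exact_mod_cast hj2
    have hjy' : (j : ℝ) + 1 ≤ y := by rw [hy]; exact_mod_cast (by omega : j + 1 ≤ n + 1)
    have hhalf : ((j : ℝ) + 1) ^ (-θ) ≤ 2 ^ θ * y ^ (-θ) :=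
      half_rpow_neg_le (by linarith) (by linarith) hjy
    have h5 : |f (j + 1) - f j| ≤ M * (Q * ((j : ℝ) + 1) ^ (-θ)) := by
      rcases le_or_gt a (γ * logRatio ((j : ℝ) + 1)) with h1 | h1
      · have h2 := (H.abs_le_exp E H₀ hc hβ hsmall (by omega : j < N) h1).2
        have h3 := exp_neg_le_of_logRatio_lt (θ := θ) hγ hκ (by linarith) hj1 hjy' hjy ha
        have h4 : 4 * c * β * ((j : ℝ) + 1) ^ (-(θ - 1)) ≤ a := by
          have h6 : ((j : ℝ) + 1) ^ (-(θ - 1)) ≤ ((j : ℝ) + 1)⁻¹ := by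
            rw [← Real.rpow_neg_one]
            exact Real.rpow_le_rpow_of_exponent_le hj1 (by linarith)
          have h7 : γ * y⁻¹ ≤ a :=
            (mul_le_mul_of_nonneg_left (inv_le_logRatio hn1) hγ.le).trans ha.le
          have h8 : ((j : ℝ) + 1)⁻¹ ≤ 2 * y⁻¹ := by
            rw [← div_eq_mul_inv, inv_le_comm₀ (by linarith) (by positivity), inv_div]
            linarith
          have h9 : 0 < y⁻¹ := by positivity
          calc 4 * c * β * ((j : ℝ) + 1) ^ (-(θ - 1)) ≤ 4 * c * β * (2 * y⁻¹) := by
                gcongr; exact h6.trans h8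
            _ = 8 * (c * β) * y⁻¹ := by ring
            _ ≤ γ * y⁻¹ := by gcongr
            _ ≤ a := h7
        have h10 : a * a ^ (-(θ - κ)) = Q := by
          rw [hQ, mul_comm, ← Real.rpow_add_one ha0.ne']; congr 1; ring
        calc _ ≤ (a + 5 * a) * (C₆ * (a ^ (-(θ - κ)) * ((j : ℝ) + 1) ^ (-θ))) := by
              refine h2.trans ?_
              gcongr
              exact h3
          _ = 6 * C₆ * ((a * a ^ (-(θ - κ))) * ((j : ℝ) + 1) ^ (-θ)) := by ring
          _ ≤ _ := by
              rw [h10]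
              gcongr
              linarith
      · refine (IH j (by omega) h1).2.trans ?_
        gcongr
        linarith
    calc _ ≤ M * (Q * ((j : ℝ) + 1) ^ (-θ)) := h5
      _ ≤ M * (Q * (2 ^ θ * y ^ (-θ))) := by gcongr
      _ = _ := by ring
  have hterm : ∀ m ∈ Finset.Icc 2 (n + 1), |g m * (f (n + 1 - m) - f n)| ≤
      c * β * (2 ^ θ * y ^ (-θ)) *
        (M * Q * (m : ℝ) ^ (-(θ - 1)) + |f (n + 1 - m)| + |f n|) := by
    intro m hm
    rw [Finset.mem_Icc] at hm
    have hm0 : (0 : ℝ) < m := by exact_mod_cast (by omega : 0 < m)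
    have hg := H.g_le m hm.1 (by omega)
    rw [abs_mul]
    rcases le_or_gt (2 * m) (n + 1) with h1 | h1
    · have h2 : |f (n + 1 - m) - f n| ≤ m * (M * Q * (2 ^ θ * y ^ (-θ))) := by
        refine (abs_sub_le_sum_Ico f (by omega)).trans ?_
        calc _ ≤ ∑ j ∈ Finset.Ico (n + 1 - m) n, M * Q * (2 ^ θ * y ^ (-θ)) := by
              apply Finset.sum_le_sum
              intro j hj
              rw [Finset.mem_Ico] at hj
              exact hinc j hj.2 (by omega)
          _ ≤ _ := by
              rw [Finset.sum_const, nsmul_eq_mul, Nat.card_Ico]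
              gcongr
              omega
      have h3 : (m : ℝ) ^ (-θ) * m = (m : ℝ) ^ (-(θ - 1)) := by
        rw [← Real.rpow_add_one hm0.ne']; congr 1; ring
      calc _ ≤ (c * β * (m : ℝ) ^ (-θ)) * (m * (M * Q * (2 ^ θ * y ^ (-θ)))) :=
            mul_le_mul hg h2 (abs_nonneg _) (by positivity)
        _ = c * β * (2 ^ θ * y ^ (-θ)) * (M * Q * ((m : ℝ) ^ (-θ) * m)) := by ring
        _ ≤ _ := by
            rw [h3]
            gcongr
            linarith [abs_nonneg (f (n + 1 - m)), abs_nonneg (f n)]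
    · have h2 : (m : ℝ) ^ (-θ) ≤ 2 ^ θ * y ^ (-θ) :=
        half_rpow_neg_le (by linarith) (by linarith) (by rw [hy]; exact_mod_cast h1.le)
      have h3 := abs_sub (f (n + 1 - m)) (f n)
      calc _ ≤ (c * β * (2 ^ θ * y ^ (-θ))) * (|f (n + 1 - m)| + |f n|) := by
            refine mul_le_mul (hg.trans ?_) h3 (abs_nonneg _) (by positivity)
            gcongr
        _ ≤ _ := by
            gcongr
            have : 0 ≤ M * Q * (m : ℝ) ^ (-(θ - 1)) := by positivity
            linarith
  have hreidx : ∑ m ∈ Finset.Icc 2 (n + 1), |f (n + 1 - m)| = ∑ j ∈ Finset.range n, |f j| := by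
    apply Finset.sum_nbij' (fun m => n + 1 - m) (fun j => n + 1 - j)
    · intro m hm; rw [Finset.mem_Icc] at hm; rw [Finset.mem_range]; omega
    · intro j hj; rw [Finset.mem_range] at hj; rw [Finset.mem_Icc]; omega
    · intro m hm; rw [Finset.mem_Icc] at hm; omega
    · intro j hj; rw [Finset.mem_range] at hj; omega
    · intro m _; rfl
  calc _ ≤ ∑ m ∈ Finset.Icc 2 (n + 1), |g m * (f (n + 1 - m) - f n)| :=
        Finset.abs_sum_le_sum_abs _ _
    _ ≤ ∑ m ∈ Finset.Icc 2 (n + 1), c * β * (2 ^ θ * y ^ (-θ)) *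
        (M * Q * (m : ℝ) ^ (-(θ - 1)) + |f (n + 1 - m)| + |f n|) := Finset.sum_le_sum hterm
    _ = c * β * (2 ^ θ * y ^ (-θ)) * (M * Q * ∑ m ∈ Finset.Icc 2 (n + 1), (m : ℝ) ^ (-(θ - 1)) +
        ∑ j ∈ Finset.range n, |f j| + n * |f n|) := by
        rw [← Finset.mul_sum, Finset.sum_add_distrib, Finset.sum_add_distrib, hreidx,
          Finset.sum_const, nsmul_eq_mul, Nat.card_Icc, ← Finset.mul_sum]
        simp
    _ ≤ c * β * (2 ^ θ * y ^ (-θ)) * (M * Q * zetaSum (θ - 1) +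
        (8 + K₄ * G * zetaSum (1 + κ)) * a⁻¹ + (4 + K₄ * G * zetaSum (1 + κ)) * a⁻¹) := by
        gcongr
        exact sum_rpow_le_zetaSum (by linarith) _
    _ = c * β * (2 ^ θ * y ^ (-θ)) * (M * Q * zetaSum (θ - 1) +
        (12 + 2 * K₄ * G * zetaSum (1 + κ)) * a⁻¹) := by ring
    _ ≤ c * β * (2 ^ θ * y ^ (-θ)) * (2 ^ θ * (M * Q * zetaSum (θ - 1)) +
        (12 + 2 * K₄ * G * zetaSum (1 + κ)) * (2 ^ θ * Q)) := by
        have : 0 < M * Q * zetaSum (θ - 1) := by positivity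
        have : M * Q * zetaSum (θ - 1) ≤ 2 ^ θ * (M * Q * zetaSum (θ - 1)) := by nlinarith
        gcongr
    _ = _ := by rw [convConst]; ring

set_option maxHeartbeats 1000000 in
/-- One step of the bounds outside the Gaussian region. -/
theorem tail_step (E : Exponents θ δ s γ)
    (H : PointSeq θ δ s c β z v a N g₀ e₀ f g e h)
    (H₀ : ZeroSeq θ c β z N f₀ g₀ e₀) (hc : 1 ≤ c) (hβ : 0 < β)
    (hsmall : c * β * smallConst θ δ s ≤ 1) (hγβ : 8 * (c * β) ≤ γ) (hκ : κ = γ / 8)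
    {η : ℝ} (hη : 0 < η) (hη1 : η ≤ 1)
    (hsum : c * β * (1 / γ + 1 + zetaSum (θ - 1)) ≤ η / 4)
    (hconv : c * β * (convConst θ γ κ K₄ K₅ + 2 ^ θ) ≤ η / 16)
    {n₀ : ℕ} (hn₀ : 1 ≤ n₀) (hn₀' : 16 * θ / (γ * η) ≤ 1 + Real.log n₀)
    (hsmall₀ : c * β * (zetaSum θ + 2) * n₀ ≤ 1 / 2)
    (hK₄ : 2 * (2 ^ θ * (n₀ : ℝ) ^ θ) + 2 * 2 ^ θ * boundaryConst θ κ + 2 ≤ K₄)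
    (hK₅ : K₅ = 2 * 2 ^ θ * K₄ + 1)
    (ha2 : a ≤ 2 - η) {n : ℕ} (hn : n < N) (ha : γ * logRatio ((n : ℝ) + 1) < a)
    (IH : ∀ j < n, γ * logRatio ((j : ℝ) + 1) < a →
      |f (j + 1)| ≤ K₄ * (a ^ (-(θ - κ)) * ((j : ℝ) + 1) ^ (-θ)) ∧
      |f (j + 1) - f j| ≤ K₅ * (a ^ (-(θ - 1 - κ)) * ((j : ℝ) + 1) ^ (-θ))) :
    |f (n + 1)| ≤ K₄ * (a ^ (-(θ - κ)) * ((n : ℝ) + 1) ^ (-θ)) ∧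
    |f (n + 1) - f n| ≤ K₅ * (a ^ (-(θ - 1 - κ)) * ((n : ℝ) + 1) ^ (-θ)) := by
  have hcβ : 0 < c * β := by positivity
  have hn1 : (1 : ℝ) ≤ (n : ℝ) + 1 := by linarith [(Nat.cast_nonneg n : (0 : ℝ) ≤ n)]
  have hγ := E.γ_pos
  have hγ8 := E.γ_le
  have hθ := E.two_lt
  have hκ0 : 0 < κ := by rw [hκ]; linarith
  have hκθ : κ < θ - 2 := by rw [hκ]; linarith [E.γ_le', E.s_lt, E.δ_lt, E.δ_pos]
  have ha0 : 0 < a := lt_of_le_of_lt (mul_nonneg hγ.le (logRatio_pos hn1).le) ha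
  have h2θ : (1 : ℝ) ≤ 2 ^ θ := Real.one_le_rpow (by norm_num) (by linarith)
  have hn₀1 : (1 : ℝ) ≤ (n₀ : ℝ) := by exact_mod_cast hn₀
  have hn₀θ : (1 : ℝ) ≤ (n₀ : ℝ) ^ θ := Real.one_le_rpow hn₀1 (by linarith)
  have hC₆0 : 0 < boundaryConst θ κ := Real.rpow_pos_of_pos (by linarith) _
  have hK₄1 : 1 ≤ K₄ := by
    have : 0 < 2 * (2 ^ θ * (n₀ : ℝ) ^ θ) := by positivity
    have : 0 < 2 * 2 ^ θ * boundaryConst θ κ := by positivity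
    linarith
  have hK₄K₅ : 2 * K₄ ≤ K₅ := by
    have : 1 * K₄ ≤ 2 ^ θ * K₄ := by gcongr
    linarith
  have hK₅1 : 1 ≤ K₅ := by linarith
  set y := (n : ℝ) + 1 with hy
  have hy0 : 0 < y := by linarith
  set Q := a ^ (-(θ - 1 - κ)) with hQ
  set P := a ^ (-(θ - κ)) with hP
  have hQ0 : 0 < Q := by positivity
  have hP0 : 0 < P := by positivity
  have hQP : Q = a * P := by
    rw [hQ, hP, mul_comm, ← Real.rpow_add_one ha0.ne']; congr 1; ring
  set Y := y ^ (-θ) with hY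
  have hY0 : 0 < Y := by positivity
  rcases le_or_gt (n + 1) n₀ with hsm | hsm
  · have f1 : |f (n + 1)| ≤ 2 :=
      H.abs_le_two H₀ hθ hc hβ (by linarith) hsmall₀ hsm (by omega)
    have f2 : |f n| ≤ 2 :=
      H.abs_le_two H₀ hθ hc hβ (by linarith) hsmall₀ (by omega) (by omega)
    have hyn : y ≤ n₀ := by rw [hy]; exact_mod_cast hsm
    have hYn : 1 ≤ (n₀ : ℝ) ^ θ * Y := by
      rw [hY, Real.rpow_neg hy0.le, ← div_eq_mul_inv, le_div_iff₀ (by positivity), one_mul]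
      exact Real.rpow_le_rpow hy0.le hyn (by linarith)
    have hpow : ∀ p : ℝ, 0 ≤ p → p ≤ θ → 1 ≤ 2 ^ θ * a ^ (-p) := by
      intro p hp hpθ
      rw [Real.rpow_neg ha0.le, ← div_eq_mul_inv, le_div_iff₀ (by positivity), one_mul]
      calc a ^ p ≤ 2 ^ p := Real.rpow_le_rpow ha0.le (by linarith) hp
        _ ≤ 2 ^ θ := Real.rpow_le_rpow_of_exponent_le (by norm_num) hpθ
    have hP1 : 1 ≤ 2 ^ θ * P := hpow _ (by linarith) (by linarith)
    have hQ1 : 1 ≤ 2 ^ θ * Q := hpow _ (by linarith) (by linarith)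
    have hKK : 2 * (2 ^ θ * (n₀ : ℝ) ^ θ) ≤ K₄ := by
      have : 0 < 2 * 2 ^ θ * boundaryConst θ κ := by positivity
      linarith
    constructor
    · refine f1.trans ?_
      calc (2 : ℝ) = 2 * (1 * 1) := by norm_num
        _ ≤ 2 * ((2 ^ θ * P) * ((n₀ : ℝ) ^ θ * Y)) := by gcongr
        _ = (2 * (2 ^ θ * (n₀ : ℝ) ^ θ)) * (P * Y) := by ring
        _ ≤ K₄ * (P * Y) := by gcongr
    · refine (abs_sub _ _).trans ((add_le_add f1 f2).trans ?_)
      calc (2 : ℝ) + 2 = 4 * (1 * 1) := by norm_num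
        _ ≤ 4 * ((2 ^ θ * Q) * ((n₀ : ℝ) ^ θ * Y)) := by gcongr
        _ = (2 * (2 * (2 ^ θ * (n₀ : ℝ) ^ θ))) * (Q * Y) := by ring
        _ ≤ K₅ * (Q * Y) := by gcongr; linarith
  · have hnpos : 1 ≤ n := by omega
    have hn1' : (1 : ℝ) ≤ n := by exact_mod_cast hnpos
    have hn0 : (0 : ℝ) < n := by linarith
    obtain ⟨i, hi⟩ : ∃ i, n = i + 1 := ⟨n - 1, by omega⟩
    have hicast : (i : ℝ) + 1 = n := by rw [hi]; push_cast; ring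
    set S := z * (1 - a) + ∑ m ∈ Finset.Icc 2 (n + 1), g m with hS
    have hS1 : |S - (1 - a)| ≤ η / 4 * a := by
      refine (H.abs_sum_coeff_le H₀ hθ hc hβ hγ hn ha).trans ?_
      gcongr
    have hSabs : |S| ≤ 1 - η / 4 * a := by
      have h1 := abs_one_sub_le hη hη1 ha0.le ha2
      have h2 := abs_add_le (S - (1 - a)) (1 - a)
      rw [sub_add_cancel] at h2
      linarith
    have hSsub : |S - 1| ≤ 2 * a := by
      have h2 := abs_add_le (S - (1 - a)) (-a)
      rw [abs_neg, abs_of_pos ha0] at h2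
      have h3 : S - (1 - a) + -a = S - 1 := by ring
      rw [h3] at h2
      have h4 : η / 4 * a ≤ 1 * a := by gcongr; linarith
      linarith
    set W := ∑ m ∈ Finset.Icc 2 (n + 1), g m * (f (n + 1 - m) - f n) + e (n + 1) with hW
    have hfS : f (n + 1) = S * f n + W := by
      rw [H.f_succ n hn, hS, hW]
      simp only [mul_sub, Finset.sum_sub_distrib, ← Finset.sum_mul]
      ring
    have hWle : |W| ≤ η / 16 * (Q * Y) := by
      have h1 := H.abs_convolution_le E H₀ hc hβ hsmall hγβ hκ hK₄1 hK₅1 (by linarith) hn ha IH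
      have h2 : |e (n + 1)| ≤ c * β * 2 ^ θ * (Q * Y) := by
        have h3 := H.e_le (n + 1) (by omega) hn
        push_cast at h3
        have h4 : 1 ≤ 2 ^ θ * Q := by
          rw [hQ, Real.rpow_neg ha0.le, ← div_eq_mul_inv, le_div_iff₀ (by positivity), one_mul]
          calc a ^ (θ - 1 - κ) ≤ 2 ^ (θ - 1 - κ) :=
                Real.rpow_le_rpow ha0.le (by linarith) (by linarith)
            _ ≤ 2 ^ θ := Real.rpow_le_rpow_of_exponent_le (by norm_num) (by linarith)
        calc _ ≤ c * β * (1 * Y) := by rw [one_mul]; exact h3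
          _ ≤ c * β * ((2 ^ θ * Q) * Y) := by gcongr
          _ = _ := by ring
      refine (abs_add_le _ _).trans ((add_le_add h1 h2).trans ?_)
      calc _ = c * β * (convConst θ γ κ K₄ K₅ + 2 ^ θ) * (Q * Y) := by ring
        _ ≤ _ := by gcongr
    have hWP : |W| ≤ 2 * (P * Y) := by
      refine hWle.trans ?_
      rw [hQP]
      have : 0 < P * Y := by positivity
      have h3 : η / 16 * a ≤ 1 * 2 := by gcongr <;> linarith
      rw [one_mul] at h3
      calc η / 16 * (a * P * Y) = (η / 16 * a) * (P * Y) := by ring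
        _ ≤ _ := by gcongr
    have hWQ : |W| ≤ Q * Y := by
      refine hWle.trans ?_
      have : 0 < Q * Y := by positivity
      calc η / 16 * (Q * Y) ≤ 1 * (Q * Y) := by gcongr; linarith
        _ = Q * Y := one_mul _
    have hnY : (n : ℝ) ^ (-θ) ≤ 2 ^ θ * Y :=
      half_rpow_neg_le (by linarith) hy0 (by rw [hy]; linarith)
    have hlogn : (n : ℝ) ≤ y := by rw [hy]; linarith
    have hcase : (|f n| ≤ 5 / 4 * (boundaryConst θ κ * (P * (n : ℝ) ^ (-θ)))) ∨
        (|f n| ≤ K₄ * (P * (n : ℝ) ^ (-θ))) := by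
      rcases le_or_gt a (γ * logRatio n) with h1 | h1
      · left
        have h2 := (H.abs_le_exp E H₀ hc hβ hsmall (by omega : i < N) (by rwa [hicast])).1
        rw [hicast, ← hi] at h2
        refine h2.trans ?_
        gcongr
        exact exp_neg_le_of_logRatio_lt hγ hκ (by linarith) hn1' hlogn
          (by rw [hy]; linarith) ha
      · right
        have h2 := (IH i (by omega) (by rwa [hicast])).1
        rwa [hicast, ← hi] at h2
    have hKC : 2 * 2 ^ θ * boundaryConst θ κ + 2 ≤ K₄ := by
      have : 0 < 2 * (2 ^ θ * (n₀ : ℝ) ^ θ) := by positivity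
      linarith
    have hfn : |f n| ≤ K₄ * (P * (n : ℝ) ^ (-θ)) := by
      rcases hcase with h1 | h1
      · refine h1.trans ?_
        have h3 : 5 / 4 * boundaryConst θ κ ≤ K₄ := by
          have : 1 * boundaryConst θ κ ≤ 2 ^ θ * boundaryConst θ κ := by gcongr
          linarith
        calc _ = (5 / 4 * boundaryConst θ κ) * (P * (n : ℝ) ^ (-θ)) := by ring
          _ ≤ _ := by gcongr
      · exact h1
    constructor
    · rw [hfS]
      refine (abs_add_le _ _).trans ?_
      rw [abs_mul]
      rcases hcase with h1 | h1
      · have h2 : |S| * |f n| ≤ 1 * (5 / 4 * (boundaryConst θ κ * (P * (2 ^ θ * Y)))) := by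
          have hS2 : |S| ≤ 1 := hSabs.trans (by linarith [mul_pos hη ha0])
          refine mul_le_mul hS2 (h1.trans ?_) (abs_nonneg _) zero_le_one
          gcongr
        have h3 : 0 < P * Y := by positivity
        have h4 : 0 < 2 ^ θ * boundaryConst θ κ * (P * Y) := by positivity
        calc _ ≤ 1 * (5 / 4 * (boundaryConst θ κ * (P * (2 ^ θ * Y)))) + 2 * (P * Y) :=
              add_le_add h2 hWP
          _ ≤ (2 * 2 ^ θ * boundaryConst θ κ + 2) * (P * Y) := by linarith
          _ ≤ _ := by gcongr
      · have hratio : (n : ℝ) ^ (-θ) ≤ Real.exp (η * a / 8) * Y := by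
          have h2 : y / n ≤ Real.exp (1 / n) := by
            have h3 := Real.add_one_le_exp (1 / (n : ℝ))
            have : y / n = 1 / n + 1 := by rw [hy]; field_simp; ring
            linarith
          have h4 : (y / n) ^ θ ≤ Real.exp (θ / n) := by
            calc _ ≤ Real.exp (1 / n) ^ θ := Real.rpow_le_rpow (by positivity) h2 (by linarith)
              _ = _ := by rw [← Real.exp_mul]; congr 1; field_simp
          have h5 : θ / n ≤ η * a / 8 := by
            have h6 : 16 * θ / (γ * η) ≤ 1 + Real.log y := by
              refine hn₀'.trans ?_
              have : Real.log n₀ ≤ Real.log y := by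
                apply Real.log_le_log (by linarith)
                rw [hy]
                exact_mod_cast hsm.le
              linarith
            have h7 : γ * (1 + Real.log y) ≤ a * y := by
              have : γ * logRatio y * y ≤ a * y := by gcongr
              refine le_trans (le_of_eq ?_) this
              unfold logRatio; field_simp
            rw [div_le_iff₀ (by positivity)] at h6
            rw [div_le_iff₀ hn0]
            have h8 : y ≤ 2 * n := by rw [hy]; linarith
            have h9 : 16 * θ ≤ η * (a * y) := by
              calc 16 * θ ≤ (1 + Real.log y) * (γ * η) := h6
                _ = η * (γ * (1 + Real.log y)) := by ring
                _ ≤ _ := by gcongr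
            have h10 : η * (a * y) ≤ η * (a * (2 * n)) := by gcongr
            linarith
          have h11 : (n : ℝ) ^ (-θ) = (y / n) ^ θ * Y := by
            rw [Real.div_rpow hy0.le hn0.le, hY, Real.rpow_neg hy0.le, Real.rpow_neg hn0.le]
            field_simp
          rw [h11]
          gcongr
          exact h4.trans (Real.exp_le_exp.2 h5)
        set x := η * a / 8 with hx
        have hx0 : 0 ≤ x := by positivity
        have hx1 : x ≤ 1 := by
          have : η * a ≤ 1 * 2 := by gcongr; linarith
          linarith
        have h12 := one_sub_mul_exp_le hx0 hx1
        have hSx : |S| ≤ 1 - 2 * x := by rw [hx]; linarith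
        have hx2 : 0 ≤ 1 - 2 * x := (abs_nonneg _).trans hSx
        have h13 : |S| * |f n| ≤ (1 - x / 2) * (K₄ * (P * Y)) := by
          calc |S| * |f n| ≤ (1 - 2 * x) * (K₄ * (P * (Real.exp x * Y))) := by
                refine mul_le_mul hSx (h1.trans ?_) (abs_nonneg _) hx2
                gcongr
            _ = ((1 - 2 * x) * Real.exp x) * (K₄ * (P * Y)) := by ring
            _ ≤ _ := by gcongr
        have h14 : |W| ≤ x / 2 * (K₄ * (P * Y)) := by
          refine hWle.trans ?_
          rw [hQP]
          have : 0 < x / 2 * (P * Y) := by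
            have : 0 < x := by positivity
            positivity
          calc η / 16 * (a * P * Y) = x / 2 * (P * Y) := by rw [hx]; ring
            _ ≤ K₄ * (x / 2 * (P * Y)) := le_mul_of_one_le_left this.le hK₄1
            _ = _ := by ring
        linarith
    · have h1 : f (n + 1) - f n = (S - 1) * f n + W := by rw [hfS]; ring
      rw [h1]
      refine (abs_add_le _ _).trans ?_
      rw [abs_mul]
      have h2 : |S - 1| * |f n| ≤ 2 * a * (K₄ * (P * (2 ^ θ * Y))) := by
        refine mul_le_mul hSsub (hfn.trans ?_) (abs_nonneg _) (by positivity)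
        gcongr
      calc _ ≤ 2 * a * (K₄ * (P * (2 ^ θ * Y))) + Q * Y := add_le_add h2 hWQ
        _ = (2 * 2 ^ θ * K₄ + 1) * (Q * Y) := by rw [hQP]; ring
        _ = _ := by rw [hK₅]

end PointSeq

/-- Outside the Gaussian region the recursion decays polynomially, with a constant that does not
depend on the constant `c` in the bounds on the coefficients. -/
theorem exists_tail_bound {θ δ s γ η : ℝ} (E : Exponents θ δ s γ) (hη : 0 < η) (hη1 : η ≤ 1) :
    ∃ K₄ ≥ 1, ∀ c ≥ 1, ∃ β₀ > 0, ∀ β : ℝ, 0 < β → β ≤ β₀ →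
      c * β * smallConst θ δ s ≤ 1 ∧
      ∀ (z v a : ℝ) (N : ℕ) (f₀ g₀ e₀ f g e h : ℕ → ℝ),
        ZeroSeq θ c β z N f₀ g₀ e₀ → PointSeq θ δ s c β z v a N g₀ e₀ f g e h → a ≤ 2 - η →
        ∀ n < N, γ * logRatio ((n : ℝ) + 1) < a →
          |f (n + 1)| ≤ K₄ * (a ^ (-(θ - γ / 8)) * ((n : ℝ) + 1) ^ (-θ)) := by
  obtain ⟨n₀, hn₀⟩ := exists_nat_ge (Real.exp (16 * θ / (γ * η)))
  have hθ := E.two_lt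
  have hγ := E.γ_pos
  have hγ8 := E.γ_le
  have hn₀pos : (0 : ℝ) < n₀ := (Real.exp_pos _).trans_le hn₀
  have hn₀1 : 1 ≤ n₀ := by exact_mod_cast hn₀pos
  have hlog : 16 * θ / (γ * η) ≤ 1 + Real.log n₀ := by
    have := (Real.le_log_iff_exp_le hn₀pos).2 hn₀
    linarith
  set κ := γ / 8 with hκ
  have hC₆0 : 0 < boundaryConst θ κ := Real.rpow_pos_of_pos (by linarith) _
  set K₄ := 2 * (2 ^ θ * (n₀ : ℝ) ^ θ) + 2 * 2 ^ θ * boundaryConst θ κ + 2 with hK₄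
  have hK₄1 : 1 ≤ K₄ := by
    have : 0 < 2 * (2 ^ θ * (n₀ : ℝ) ^ θ) := by positivity
    have : 0 < 2 * 2 ^ θ * boundaryConst θ κ := by positivity
    linarith
  set K₅ := 2 * 2 ^ θ * K₄ + 1 with hK₅
  refine ⟨K₄, hK₄1, fun c hc => ?_⟩
  have hc0 : 0 < c := by linarith
  have hZ1 := E.one_le_zetaSum_sub_one
  have hZ2 := E.one_le_zetaSum_sub_one_sub
  have hZθ : 1 ≤ zetaSum θ := one_le_zetaSum (by linarith)
  have hZκ : 1 ≤ zetaSum (1 + κ) := one_le_zetaSum (by linarith)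
  have hr := E.rateConst_pos
  have hsm0 : 0 < smallConst θ δ s := by unfold smallConst; positivity
  have hcv0 : 0 < convConst θ γ κ K₄ K₅ := by unfold convConst; positivity
  have ex : ∀ A B : ℝ, 0 < A → 0 < B → ∀ β : ℝ, β ≤ B / (c * A) → c * β * A ≤ B := by
    intro A B hA hB β h
    rw [le_div_iff₀ (by positivity)] at h
    linarith
  set b1 := 1 / (c * smallConst θ δ s)
  set b2 := γ / (c * 8)
  set b3 := (η / 4) / (c * (1 / γ + 1 + zetaSum (θ - 1)))
  set b4 := (η / 16) / (c * (convConst θ γ κ K₄ K₅ + 2 ^ θ))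
  set b5 := (1 / 2) / (c * ((zetaSum θ + 2) * n₀))
  refine ⟨min b1 (min b2 (min b3 (min b4 b5))), ?_, ?_⟩
  · simp only [gt_iff_lt, lt_min_iff]
    refine ⟨?_, ?_, ?_, ?_, ?_⟩ <;> positivity
  · intro β hβ hβ₀
    simp only [le_min_iff] at hβ₀
    obtain ⟨h1, h2, h3, h4, h5⟩ := hβ₀
    have q1 : c * β * smallConst θ δ s ≤ 1 := ex _ _ hsm0 one_pos β h1
    have q2 : 8 * (c * β) ≤ γ := by
      have := ex _ _ (by norm_num) hγ β h2
      linarith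
    have q3 := ex _ _ (by positivity) (by positivity) β h3
    have q4 := ex _ _ (by positivity) (by positivity) β h4
    have q5 : c * β * (zetaSum θ + 2) * n₀ ≤ 1 / 2 := by
      have := ex _ _ (by positivity) (by positivity) β h5
      linarith
    refine ⟨q1, ?_⟩
    intro z v a N f₀ g₀ e₀ f g e h H₀ H ha2
    have key : ∀ n < N, γ * logRatio ((n : ℝ) + 1) < a →
        |f (n + 1)| ≤ K₄ * (a ^ (-(θ - κ)) * ((n : ℝ) + 1) ^ (-θ)) ∧
        |f (n + 1) - f n| ≤ K₅ * (a ^ (-(θ - 1 - κ)) * ((n : ℝ) + 1) ^ (-θ)) := by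
      intro n
      induction n using Nat.strong_induction_on with
      | _ n ih =>
      intro hn ha
      exact H.tail_step E H₀ hc hβ q1 q2 hκ hη hη1 q3 q4 hn₀1 hlog q5 le_rfl hK₅ ha2 hn ha
        (fun j hj => ih j hj (hj.trans hn))
    exact fun n hn ha => (key n hn ha).1

end LaceRecursion

namespace LaceRecursion

section Symmetric

variable {d : ℕ}

theorem smul_single_mem_box {t : ℝ} (ht : |t| ≤ 1) (i : Fin d) :
    t • EuclideanSpace.single i (1 : ℝ) ∈ box d := by
  intro j
  have hpi := Real.pi_gt_three
  have ht' := abs_le.1 ht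
  by_cases h : j = i
  · subst h; simp; constructor <;> linarith
  · simp [h]; positivity

theorem box_mem_nhds : box d ∈ 𝓝 (0 : EuclideanSpace ℝ (Fin d)) := by
  have hpi := Real.pi_pos
  have : ∀ i : Fin d, ∀ᶠ k in 𝓝 (0 : EuclideanSpace ℝ (Fin d)), k i ∈ Icc (-Real.pi) Real.pi := by
    intro i
    have hc : Continuous fun k : EuclideanSpace ℝ (Fin d) => k i := by fun_prop
    apply hc.continuousAt
    exact Icc_mem_nhds (by simpa using hpi) (by simpa using hpi)
  exact Filter.eventually_all.2 this

theorem zero_mem_box : (0 : EuclideanSpace ℝ (Fin d)) ∈ box d := mem_of_mem_nhds box_mem_nhds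

theorem LatticeSymmetric.neg_single {h : EuclideanSpace ℝ (Fin d) → ℝ} (hs : LatticeSymmetric h)
    {t : ℝ} (ht : |t| ≤ 1) (i : Fin d) :
    h (-t • EuclideanSpace.single i (1 : ℝ)) = h (t • EuclideanSpace.single i (1 : ℝ)) := by
  rw [← hs.1 _ (smul_single_mem_box ht i) i]
  congr 1
  ext j
  by_cases hj : j = i <;> simp [hj]

theorem LatticeSymmetric.swap_single {h : EuclideanSpace ℝ (Fin d) → ℝ}
    (hs : LatticeSymmetric h) {t : ℝ} (ht : |t| ≤ 1) (i j : Fin d) :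
    h (t • EuclideanSpace.single i (1 : ℝ)) = h (t • EuclideanSpace.single j (1 : ℝ)) := by
  rw [← hs.2 _ (smul_single_mem_box ht i) (Equiv.swap i j)]
  congr 1
  ext l
  by_cases hl : l = j
  · subst hl; simp
  · by_cases hi : l = i
    · subst hi; simp [Equiv.swap_apply_left, Ne.symm hl, hl]
    · simp [Equiv.swap_apply_of_ne_of_ne hi hl, hi, hl]

theorem eventually_abs_le_one : ∀ᶠ t in 𝓝[≠] (0 : ℝ), |t| ≤ 1 := by
  apply eventually_nhdsWithin_of_eventually_nhds
  have : Icc (-1 : ℝ) 1 ∈ 𝓝 (0 : ℝ) := Icc_mem_nhds (by norm_num) (by norm_num)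
  filter_upwards [this] with t ht
  exact abs_le.2 ht

/-- Second-order expansion along a coordinate axis, in terms of the second derivative. -/
theorem tendsto_second_difference {h : EuclideanSpace ℝ (Fin d) → ℝ}
    (hd : TwiceDifferentiableAt h 0) (hs : LatticeSymmetric h) (i : Fin d) :
    Tendsto (fun t : ℝ => (h (t • EuclideanSpace.single i (1 : ℝ)) - h 0) / t ^ 2) (𝓝[≠] 0)
      (𝓝 (fderiv ℝ (fderiv ℝ h) 0 (EuclideanSpace.single i 1) (EuclideanSpace.single i 1) / 2)) := by
  set u : EuclideanSpace ℝ (Fin d) := EuclideanSpace.single i 1 with hu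
  have hline : ∀ t : ℝ, HasDerivAt (fun t : ℝ => t • u) u t := fun t => by
    simpa using (hasDerivAt_id t).smul_const u
  have hcont : Tendsto (fun t : ℝ => t • u) (𝓝 0) (𝓝 0) := by
    have := (hline 0).continuousAt.tendsto
    simpa using this
  have hφ : ∀ᶠ t in 𝓝 (0 : ℝ), HasDerivAt (fun t : ℝ => h (t • u)) (fderiv ℝ h (t • u) u) t := by
    filter_upwards [hcont.eventually hd.1] with t ht
    exact ht.hasFDerivAt.comp_hasDerivAt t (hline t)
  have hφ' : HasDerivAt (fun t : ℝ => fderiv ℝ h (t • u) u) (fderiv ℝ (fderiv ℝ h) 0 u u) 0 := by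
    have h0 : HasFDerivAt (fderiv ℝ h) (fderiv ℝ (fderiv ℝ h) 0) ((0 : ℝ) • u) := by
      rw [zero_smul]; exact hd.2.hasFDerivAt
    have h1 := h0.comp_hasDerivAt (0 : ℝ) (hline 0)
    have h2 := h1.clm_apply (hasDerivAt_const (0 : ℝ) u)
    simpa using h2
  have hzero : fderiv ℝ h 0 u = 0 := by
    have h1 := hφ.self_of_nhds
    simp only [zero_smul] at h1
    have h2 : HasDerivAt (fun t : ℝ => h (-t • u)) (-(fderiv ℝ h 0 u)) 0 := by
      have h3 : HasDerivAt (fun t : ℝ => h (t • u)) (fderiv ℝ h 0 u) (-0) := by simpa using h1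
      have := h3.scomp (0 : ℝ) (hasDerivAt_neg (0 : ℝ))
      simpa [Function.comp_def] using this
    have h4 : HasDerivAt (fun t : ℝ => h (t • u)) (-(fderiv ℝ h 0 u)) 0 := by
      refine h2.congr_of_eventuallyEq ?_
      have : Icc (-1 : ℝ) 1 ∈ 𝓝 (0 : ℝ) := Icc_mem_nhds (by norm_num) (by norm_num)
      filter_upwards [this] with t ht
      exact (hs.neg_single (abs_le.2 ht) i).symm
    have := h1.unique h4
    linarith
  apply HasDerivAt.lhopital_zero_nhdsNE (f' := fun t => fderiv ℝ h (t • u) u)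
    (g' := fun t => 2 * t)
  · filter_upwards [eventually_nhdsWithin_of_eventually_nhds hφ] with t ht
    exact ht.sub_const _
  · filter_upwards with t
    simpa using hasDerivAt_pow 2 t
  · filter_upwards [self_mem_nhdsWithin] with t ht
    exact mul_ne_zero two_ne_zero ht
  · have h1 := hφ.self_of_nhds.continuousAt.tendsto
    simp only [zero_smul] at h1
    have h2 := (h1.sub_const (h 0)).mono_left (nhdsWithin_le_nhds (s := {0}ᶜ))
    simpa using h2
  · have : Tendsto (fun t : ℝ => t ^ 2) (𝓝 0) (𝓝 0) := by
      have := (continuous_pow 2 (M := ℝ)).tendsto 0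
      simpa using this
    exact this.mono_left nhdsWithin_le_nhds
  · have h1 := hasDerivAt_iff_tendsto_slope_zero.1 hφ'
    simp only [zero_add, zero_smul, hzero, sub_zero] at h1
    have h2 := h1.div_const 2
    refine h2.congr' ?_
    filter_upwards with t
    simp only [smul_eq_mul]
    rw [inv_mul_eq_div, div_div, mul_comm]

/-- Second-order expansion of a lattice-symmetric function along a coordinate axis. -/
theorem tendsto_laplacian {h : EuclideanSpace ℝ (Fin d) → ℝ}
    (hd : TwiceDifferentiableAt h 0) (hs : LatticeSymmetric h) (i : Fin d) :
    Tendsto (fun t : ℝ => (h (t • EuclideanSpace.single i (1 : ℝ)) - h 0) / t ^ 2) (𝓝[≠] 0)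
      (𝓝 (Laplacian.laplacian h 0 / (2 * d))) := by
  have h1 := tendsto_second_difference hd hs i
  have heq : ∀ j : Fin d,
      fderiv ℝ (fderiv ℝ h) 0 (EuclideanSpace.single j 1) (EuclideanSpace.single j 1) =
      fderiv ℝ (fderiv ℝ h) 0 (EuclideanSpace.single i 1) (EuclideanSpace.single i 1) := by
    intro j
    have h2 := tendsto_second_difference hd hs j
    have h3 : Tendsto (fun t : ℝ => (h (t • EuclideanSpace.single i (1 : ℝ)) - h 0) / t ^ 2)
        (𝓝[≠] 0) (𝓝 (fderiv ℝ (fderiv ℝ h) 0 (EuclideanSpace.single j 1)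
          (EuclideanSpace.single j 1) / 2)) := by
      refine h2.congr' ?_
      filter_upwards [eventually_abs_le_one] with t ht
      rw [hs.swap_single ht i j]
    have := tendsto_nhds_unique h3 h1
    linarith
  have hlap : Laplacian.laplacian h 0 = d *
      fderiv ℝ (fderiv ℝ h) 0 (EuclideanSpace.single i 1) (EuclideanSpace.single i 1) := by
    have h4 := congrFun (InnerProductSpace.laplacian_eq_iteratedFDeriv_orthonormalBasis h
      (EuclideanSpace.basisFun (Fin d) ℝ)) 0
    rw [h4]
    simp only [iteratedFDeriv_two_apply, EuclideanSpace.basisFun_apply]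
    simp [heq]
  have hd0 : (d : ℝ) ≠ 0 := by
    have : 0 < d := Fin.pos i
    positivity
  rw [hlap]
  convert h1 using 2
  field_simp

end Symmetric

section StepDistribution

variable {d : ℕ} {D : (Fin d → ℤ) → ℝ}

theorem summable_of_normalised (h : fourierZd D 0 = 1) : Summable D := by
  by_contra hn
  simp only [fourierZd, inner_zero_left, Complex.ofReal_zero, mul_zero, Complex.exp_zero,
    mul_one] at h
  rw [tsum_eq_zero_of_not_summable (by rwa [Complex.summable_ofReal])] at h
  exact zero_ne_one h

theorem tsum_eq_one (h : fourierZd D 0 = 1) : ∑' x, D x = 1 := by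
  simp only [fourierZd, inner_zero_left, Complex.ofReal_zero, mul_zero, Complex.exp_zero,
    mul_one] at h
  rw [← Complex.ofReal_tsum] at h
  exact_mod_cast h

theorem summable_mul_cos (hD : ∀ x, 0 ≤ D x) (hsum : Summable D) (k : EuclideanSpace ℝ (Fin d)) :
    Summable fun x => D x * Real.cos (inner ℝ k (latticeVec x)) := by
  refine Summable.of_norm_bounded hsum fun x => ?_
  rw [norm_mul, Real.norm_of_nonneg (hD x)]
  exact mul_le_of_le_one_right (hD x) (Real.abs_cos_le_one _)

theorem Dhat_eq_tsum (hD : ∀ x, 0 ≤ D x) (hsum : Summable D) (k : EuclideanSpace ℝ (Fin d)) :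
    Dhat D k = ∑' x, D x * Real.cos (inner ℝ k (latticeVec x)) := by
  have hs : Summable fun x => (D x : ℂ) *
      Complex.exp (Complex.I * ((inner ℝ k (latticeVec x) : ℝ) : ℂ)) := by
    refine Summable.of_norm_bounded hsum fun x => ?_
    rw [norm_mul, Complex.norm_real, Real.norm_of_nonneg (hD x), mul_comm Complex.I,
      Complex.norm_exp_ofReal_mul_I, mul_one]
  rw [Dhat, fourierZd, Complex.re_tsum hs]
  congr 1
  ext x
  rw [Complex.re_ofReal_mul, mul_comm Complex.I, Complex.exp_ofReal_mul_I_re]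

theorem aFun_eq_tsum (hD : ∀ x, 0 ≤ D x) (h1 : fourierZd D 0 = 1)
    (k : EuclideanSpace ℝ (Fin d)) :
    aFun D k = ∑' x, D x * (1 - Real.cos (inner ℝ k (latticeVec x))) := by
  have hsum := summable_of_normalised h1
  have e1 : ∑' x, D x * (1 - Real.cos (inner ℝ k (latticeVec x))) =
      ∑' x, D x - ∑' x, D x * Real.cos (inner ℝ k (latticeVec x)) := by
    rw [← hsum.tsum_sub (summable_mul_cos hD hsum k)]
    congr 1
    ext x
    ring
  rw [aFun, Dhat_eq_tsum hD hsum, e1, tsum_eq_one h1]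

theorem aFun_nonneg (hD : ∀ x, 0 ≤ D x) (h1 : fourierZd D 0 = 1)
    (k : EuclideanSpace ℝ (Fin d)) : 0 ≤ aFun D k := by
  rw [aFun_eq_tsum hD h1]
  exact tsum_nonneg fun x => mul_nonneg (hD x)
    (by linarith [Real.cos_le_one (inner ℝ k (latticeVec x))])

theorem Dhat_zero (h1 : fourierZd D 0 = 1) : Dhat D 0 = 1 := by simp [Dhat, h1]

theorem aFun_zero (h1 : fourierZd D 0 = 1) : aFun D 0 = 0 := by simp [aFun, Dhat_zero h1]

theorem abs_one_sub_cos_sub_le {s : ℝ} (hs0 : 0 ≤ s) (hs1 : s ≤ 1) (u : ℝ) :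
    |1 - Real.cos u - u ^ 2 / 2| ≤ 3 * |u| ^ (2 + 2 * s) := by
  rcases le_or_gt |u| 1 with h | h
  · have h1 := Real.cos_bound h
    have h2 : 1 - Real.cos u - u ^ 2 / 2 = -(Real.cos u - (1 - u ^ 2 / 2)) := by ring
    rw [h2, abs_neg]
    have h3 : |u| ^ 4 ≤ |u| ^ (2 + 2 * s) := by
      rcases (abs_nonneg u).eq_or_lt with h0 | h0
      · rw [← h0, Real.zero_rpow (by linarith)]; norm_num
      · rw [← Real.rpow_natCast]
        exact Real.rpow_le_rpow_of_exponent_ge h0 h (by push_cast; linarith)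
    have h4 : 0 ≤ |u| ^ (2 + 2 * s) := by positivity
    linarith
  · have h3 : u ^ 2 ≤ |u| ^ (2 + 2 * s) := by
      rw [← sq_abs, ← Real.rpow_natCast]
      exact Real.rpow_le_rpow_of_exponent_le h.le (by push_cast; linarith)
    have h4 : 1 ≤ |u| ^ (2 + 2 * s) := Real.one_le_rpow h.le (by linarith)
    have h5 := Real.cos_le_one u
    have h6 := Real.neg_one_le_cos u
    rw [abs_le]
    constructor <;> nlinarith [sq_nonneg u]

theorem summable_moment (hD : ∀ x, 0 ≤ D x) (hsum : Summable D) {p q : ℝ} (hp : 0 ≤ p)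
    (hpq : p ≤ q) (hq : Summable fun x => ‖latticeVec x‖ ^ q * D x) :
    Summable fun x => ‖latticeVec x‖ ^ p * D x := by
  refine Summable.of_nonneg_of_le (fun x => mul_nonneg (by positivity) (hD x)) (fun x => ?_)
    (hsum.add hq)
  have h1 : ‖latticeVec x‖ ^ p ≤ 1 + ‖latticeVec x‖ ^ q := by
    rcases le_total ‖latticeVec x‖ 1 with h | h
    · have := Real.rpow_le_one (norm_nonneg (latticeVec x)) h hp
      have : 0 ≤ ‖latticeVec x‖ ^ q := by positivity
      linarith
    · have := Real.rpow_le_rpow_of_exponent_le h hpq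
      linarith
  calc _ ≤ (1 + ‖latticeVec x‖ ^ q) * D x := mul_le_mul_of_nonneg_right h1 (hD x)
    _ = _ := by ring

/-- The covariance form `½ ∑_x D(x) (k·x)(l·x)`. -/
noncomputable def covForm (D : (Fin d → ℤ) → ℝ) (k l : EuclideanSpace ℝ (Fin d)) : ℝ :=
  ∑' x, D x * (inner ℝ k (latticeVec x) * inner ℝ l (latticeVec x)) / 2

theorem summable_covForm (hD : ∀ x, 0 ≤ D x)
    (h2 : Summable fun x => ‖latticeVec x‖ ^ (2 : ℝ) * D x) (k l : EuclideanSpace ℝ (Fin d)) :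
    Summable fun x => D x * (inner ℝ k (latticeVec x) * inner ℝ l (latticeVec x)) / 2 := by
  refine Summable.of_norm_bounded (h2.mul_left (‖k‖ * ‖l‖)) fun x => ?_
  rw [norm_div, norm_mul, norm_mul, Real.norm_of_nonneg (hD x)]
  have e1 := norm_inner_le_norm (𝕜 := ℝ) k (latticeVec x)
  have e2 := norm_inner_le_norm (𝕜 := ℝ) l (latticeVec x)
  have e3 : ‖inner ℝ k (latticeVec x)‖ * ‖inner ℝ l (latticeVec x)‖ ≤
      (‖k‖ * ‖latticeVec x‖) * (‖l‖ * ‖latticeVec x‖) :=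
    mul_le_mul e1 e2 (norm_nonneg _) (by positivity)
  have e4 : 0 ≤ D x * (‖inner ℝ k (latticeVec x)‖ * ‖inner ℝ l (latticeVec x)‖) :=
    mul_nonneg (hD x) (by positivity)
  rw [Real.rpow_two, Real.norm_of_nonneg (by norm_num : (0 : ℝ) ≤ 2)]
  calc _ ≤ D x * (‖inner ℝ k (latticeVec x)‖ * ‖inner ℝ l (latticeVec x)‖) := by linarith
    _ ≤ D x * ((‖k‖ * ‖latticeVec x‖) * (‖l‖ * ‖latticeVec x‖)) :=
        mul_le_mul_of_nonneg_left e3 (hD x)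
    _ = _ := by ring

theorem covForm_smul (D : (Fin d → ℤ) → ℝ) (t : ℝ) (k : EuclideanSpace ℝ (Fin d)) :
    covForm D (t • k) (t • k) = t ^ 2 * covForm D k k := by
  rw [covForm, covForm, ← tsum_mul_left]
  congr 1
  ext x
  simp only [inner_smul_left, RCLike.conj_to_real]
  ring

theorem covForm_add (hD : ∀ x, 0 ≤ D x)
    (h2 : Summable fun x => ‖latticeVec x‖ ^ (2 : ℝ) * D x) (k l : EuclideanSpace ℝ (Fin d)) :
    covForm D (k + l) (k + l) = covForm D k k + 2 * covForm D k l + covForm D l l := by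
  simp only [covForm]
  rw [← tsum_mul_left, ← (summable_covForm hD h2 k k).tsum_add
    ((summable_covForm hD h2 k l).mul_left 2), ← Summable.tsum_add
    ((summable_covForm hD h2 k k).add ((summable_covForm hD h2 k l).mul_left 2))
    (summable_covForm hD h2 l l)]
  congr 1
  ext x
  rw [inner_add_left]
  ring

theorem covForm_neg_right (D : (Fin d → ℤ) → ℝ) (k l : EuclideanSpace ℝ (Fin d)) :
    covForm D k (-l) = -covForm D k l := by
  rw [covForm, covForm, ← tsum_neg]
  congr 1
  ext x
  rw [inner_neg_left]
  ring

theorem covForm_sum (hD : ∀ x, 0 ≤ D x)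
    (h2 : Summable fun x => ‖latticeVec x‖ ^ (2 : ℝ) * D x) (k : EuclideanSpace ℝ (Fin d)) :
    covForm D k k = ∑ i, ∑ j, k i * k j *
      covForm D (EuclideanSpace.single i 1) (EuclideanSpace.single j 1) := by
  simp only [covForm, ← tsum_mul_left]
  have hs : ∀ i j : Fin d, Summable fun x => k i * k j *
      (D x * (inner ℝ (EuclideanSpace.single i (1 : ℝ)) (latticeVec x) *
        inner ℝ (EuclideanSpace.single j (1 : ℝ)) (latticeVec x)) / 2) := fun i j =>
    (summable_covForm hD h2 _ _).mul_left _
  have e1 : ∀ i : Fin d, ∑ j, ∑' x, k i * k j *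
      (D x * (inner ℝ (EuclideanSpace.single i (1 : ℝ)) (latticeVec x) *
        inner ℝ (EuclideanSpace.single j (1 : ℝ)) (latticeVec x)) / 2) =
      ∑' x, ∑ j, k i * k j *
      (D x * (inner ℝ (EuclideanSpace.single i (1 : ℝ)) (latticeVec x) *
        inner ℝ (EuclideanSpace.single j (1 : ℝ)) (latticeVec x)) / 2) := fun i =>
    (Summable.tsum_finsetSum fun j _ => hs i j).symm
  simp only [e1]
  rw [← Summable.tsum_finsetSum fun i _ => summable_sum fun j _ => hs i j]
  congr 1
  ext x
  have e2 : inner ℝ k (latticeVec x) = ∑ i, k i * (x i : ℝ) := by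
    simp [PiLp.inner_apply, latticeVec, mul_comm]
  simp only [e2]
  simp only [EuclideanSpace.inner_single_left, latticeVec]
  rw [Finset.sum_mul_sum]
  simp only [Finset.mul_sum, Finset.sum_div]
  refine Finset.sum_congr rfl fun i _ => Finset.sum_congr rfl fun j _ => ?_
  simp
  ring

/-- Taylor expansion of `a` with a fractional error. -/
theorem abs_aFun_sub_covForm_le (hD : ∀ x, 0 ≤ D x) (h1 : fourierZd D 0 = 1) {s ε : ℝ}
    (hs0 : 0 ≤ s) (hs1 : s ≤ 1) (hsε : s ≤ ε)
    (hm : Summable fun x => ‖latticeVec x‖ ^ (2 + 2 * ε) * D x)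
    (k : EuclideanSpace ℝ (Fin d)) :
    |aFun D k - covForm D k k| ≤
      3 * (∑' x, ‖latticeVec x‖ ^ (2 + 2 * s) * D x) * ‖k‖ ^ (2 + 2 * s) := by
  have hsum := summable_of_normalised h1
  have hms := summable_moment hD hsum (by linarith : 0 ≤ 2 + 2 * s) (by linarith) hm
  have hm2 := summable_moment hD hsum (by norm_num : (0 : ℝ) ≤ 2) (by linarith) hm
  have hs3 : Summable fun x => D x * (1 - Real.cos (inner ℝ k (latticeVec x))) := by
    simpa [mul_sub] using hsum.sub (summable_mul_cos hD hsum k)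
  rw [aFun_eq_tsum hD h1, covForm, ← hs3.tsum_sub (summable_covForm hD hm2 k k)]
  have hb : ∀ x, ‖D x * (1 - Real.cos (inner ℝ k (latticeVec x))) -
      D x * (inner ℝ k (latticeVec x) * inner ℝ k (latticeVec x)) / 2‖ ≤
      3 * ‖k‖ ^ (2 + 2 * s) * (‖latticeVec x‖ ^ (2 + 2 * s) * D x) := by
    intro x
    have e1 := abs_one_sub_cos_sub_le hs0 hs1 (inner ℝ k (latticeVec x))
    have e2 : |inner ℝ k (latticeVec x)| ^ (2 + 2 * s) ≤
        (‖k‖ * ‖latticeVec x‖) ^ (2 + 2 * s) :=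
      Real.rpow_le_rpow (abs_nonneg _) (abs_real_inner_le_norm _ _) (by linarith)
    rw [Real.mul_rpow (norm_nonneg _) (norm_nonneg _)] at e2
    rw [show D x * (1 - Real.cos (inner ℝ k (latticeVec x))) -
      D x * (inner ℝ k (latticeVec x) * inner ℝ k (latticeVec x)) / 2 =
      D x * (1 - Real.cos (inner ℝ k (latticeVec x)) - inner ℝ k (latticeVec x) ^ 2 / 2) by ring,
      norm_mul, Real.norm_of_nonneg (hD x), Real.norm_eq_abs]
    calc _ ≤ D x * (3 * (‖k‖ ^ (2 + 2 * s) * ‖latticeVec x‖ ^ (2 + 2 * s))) :=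
          mul_le_mul_of_nonneg_left (by linarith) (hD x)
      _ = _ := by ring
  refine (tsum_of_norm_bounded (hms.mul_left (3 * ‖k‖ ^ (2 + 2 * s))).hasSum hb).trans
    (le_of_eq ?_)
  rw [tsum_mul_left]
  ring

theorem tendsto_aFun_div_sq (hD : ∀ x, 0 ≤ D x) (h1 : fourierZd D 0 = 1) {ε : ℝ} (hε : 0 < ε)
    (hm : Summable fun x => ‖latticeVec x‖ ^ (2 + 2 * ε) * D x)
    (k : EuclideanSpace ℝ (Fin d)) :
    Tendsto (fun t : ℝ => aFun D (t • k) / t ^ 2) (𝓝[≠] 0) (𝓝 (covForm D k k)) := by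
  set s := min ε 1 with hs
  have hs0 : 0 < s := lt_min hε one_pos
  set M := 3 * (∑' x, ‖latticeVec x‖ ^ (2 + 2 * s) * D x) * ‖k‖ ^ (2 + 2 * s) with hM
  rw [tendsto_iff_norm_sub_tendsto_zero]
  have hlim : Tendsto (fun t : ℝ => M * |t| ^ (2 * s)) (𝓝[≠] 0) (𝓝 0) := by
    have : Continuous fun t : ℝ => M * |t| ^ (2 * s) :=
      continuous_const.mul (continuous_abs.rpow_const fun _ => Or.inr (by linarith))
    have h := this.tendsto 0
    rw [abs_zero, Real.zero_rpow (by linarith), mul_zero] at h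
    exact h.mono_left nhdsWithin_le_nhds
  refine squeeze_zero' (Eventually.of_forall fun _ => norm_nonneg _) ?_ hlim
  filter_upwards [self_mem_nhdsWithin] with t ht
  have ht0 : t ≠ 0 := ht
  have hta : 0 < |t| := abs_pos.2 ht0
  have e1 := abs_aFun_sub_covForm_le hD h1 hs0.le (min_le_right _ _) (min_le_left _ _) hm (t • k)
  rw [covForm_smul, norm_smul, Real.mul_rpow (norm_nonneg _) (norm_nonneg _), Real.norm_eq_abs]
    at e1
  have e2 : aFun D (t • k) / t ^ 2 - covForm D k k =
      (aFun D (t • k) - t ^ 2 * covForm D k k) / t ^ 2 := by field_simp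
  rw [e2, norm_div, Real.norm_eq_abs, Real.norm_eq_abs, abs_of_pos (by positivity : 0 < t ^ 2),
    div_le_iff₀ (by positivity)]
  refine e1.trans (le_of_eq ?_)
  rw [Real.rpow_add hta, Real.rpow_two, sq_abs, hM]
  ring

end StepDistribution

end LaceRecursion

namespace LaceRecursion

variable {d : ℕ} {D : (Fin d → ℤ) → ℝ} {R : Recursion d} {C c₁ c₂ η ε L : ℝ}

namespace AssumptionD

theorem f_one_eq (hD : AssumptionD C c₁ c₂ η ε L D R) {k : EuclideanSpace ℝ (Fin d)}
    (hk : k ∈ box d) {z : ℝ} (hz : 0 < z) : R.f 1 k z = z * Dhat D k := by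
  have h := congrArg Complex.re (hD.f_one k hk z hz)
  rwa [Complex.ofReal_re, Complex.re_ofReal_mul] at h

theorem g_one_eq (hD : AssumptionD C c₁ c₂ η ε L D R) {k : EuclideanSpace ℝ (Fin d)}
    (hk : k ∈ box d) {z : ℝ} (hz : 0 < z) : R.g 1 k z = z * (1 - aFun D k) := by
  have h1 := R.f_succ 0 k hk z hz
  simp only [zero_add, Finset.Icc_self, Finset.sum_singleton, Nat.sub_self,
    R.f_zero k hk z hz, hD.e_one k hk z hz, hD.f_one_eq hk hz] at h1
  rw [aFun]
  linarith

theorem symm_Dhat (hD : AssumptionD C c₁ c₂ η ε L D R) (hS : AssumptionS R) :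
    LatticeSymmetric (Dhat D) := by
  have hs := hS.symm_f 1 le_rfl 1 one_pos
  have key : ∀ k ∈ box d, R.f 1 k 1 = Dhat D k := fun k hk => by
    rw [hD.f_one_eq hk one_pos, one_mul]
  constructor
  · intro k hk i
    have hk' : WithLp.toLp 2 (fun j => if j = i then -(k j) else k j) ∈ box d := by
      intro j
      have := hk j
      by_cases hj : j = i
      · simp only [hj, if_true]
        rw [hj] at this
        exact ⟨by linarith [this.2], by linarith [this.1]⟩
      · simpa only [hj, if_false] using this
    rw [← key _ hk, ← key _ hk']
    exact hs.1 k hk i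
  · intro k hk τ
    have hk' : WithLp.toLp 2 (fun j => k (τ j)) ∈ box d := fun j => hk (τ j)
    rw [← key _ hk, ← key _ hk']
    exact hs.2 k hk τ

theorem twiceDifferentiableAt_Dhat (hD : AssumptionD C c₁ c₂ η ε L D R) (hS : AssumptionS R) :
    TwiceDifferentiableAt (Dhat D) 0 := by
  have hs := hS.smooth 1 le_rfl 1 one_pos
  have key : (fun k => R.f 1 k 1) =ᶠ[𝓝 0] Dhat D := by
    filter_upwards [box_mem_nhds] with k hk
    rw [hD.f_one_eq hk one_pos, one_mul]
  constructor
  · filter_upwards [hs.1, key.eventuallyEq_nhds] with y hy hy'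
    exact hy'.symm.differentiableAt_iff.2 hy
  · exact key.fderiv.symm.differentiableAt_iff.2 hs.2

theorem tendsto_aFun_single (hD : AssumptionD C c₁ c₂ η ε L D R) (hS : AssumptionS R)
    (i : Fin d) :
    Tendsto (fun t : ℝ => aFun D (t • EuclideanSpace.single i (1 : ℝ)) / t ^ 2) (𝓝[≠] 0)
      (𝓝 (sigmaSq D / (2 * d))) := by
  have h := (tendsto_laplacian (hD.twiceDifferentiableAt_Dhat hS) (hD.symm_Dhat hS) i).neg
  have e1 : -(Laplacian.laplacian (Dhat D) 0 / (2 * d)) = sigmaSq D / (2 * d) := by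
    rw [sigmaSq]; ring
  rw [e1] at h
  refine h.congr fun t => ?_
  rw [Dhat_zero hD.normalised, aFun]
  ring

theorem covForm_single (hD : AssumptionD C c₁ c₂ η ε L D R) (hS : AssumptionS R) (hε : 0 < ε)
    (i : Fin d) : covForm D (EuclideanSpace.single i 1) (EuclideanSpace.single i 1) =
      sigmaSq D / (2 * d) :=
  tendsto_nhds_unique (tendsto_aFun_div_sq hD.nonneg hD.normalised hε hD.moment _)
    (hD.tendsto_aFun_single hS i)

theorem covForm_single_ne (hD : AssumptionD C c₁ c₂ η ε L D R) (hS : AssumptionS R)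
    (hε : 0 < ε) {i j : Fin d} (hij : i ≠ j) :
    covForm D (EuclideanSpace.single i 1) (EuclideanSpace.single j 1) = 0 := by
  have hm2 := summable_moment hD.nonneg (summable_of_normalised hD.normalised)
    (by norm_num : (0 : ℝ) ≤ 2) (by linarith) hD.moment
  set u : EuclideanSpace ℝ (Fin d) := EuclideanSpace.single i 1 with hu
  set w : EuclideanSpace ℝ (Fin d) := EuclideanSpace.single j 1 with hw
  have hsym : covForm D (u + w) (u + w) = covForm D (u + -w) (u + -w) := by
    refine tendsto_nhds_unique (tendsto_aFun_div_sq hD.nonneg hD.normalised hε hD.moment _) ?_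
    refine (tendsto_aFun_div_sq hD.nonneg hD.normalised hε hD.moment (u + -w)).congr' ?_
    filter_upwards [eventually_abs_le_one] with t ht
    have hmem : t • (u + w) ∈ box d := by
      intro l
      have hpi := Real.pi_gt_three
      have ht' := abs_le.1 ht
      have : (t • (u + w)) l = (if l = i then t else 0) + (if l = j then t else 0) := by
        simp [hu, hw]
      rw [this]
      split_ifs <;> constructor <;> linarith
    have h1 := (hD.symm_Dhat hS).1 _ hmem j
    have h2 : (WithLp.toLp 2 fun l => if l = j then -((t • (u + w)) l) else (t • (u + w)) l) =
        t • (u + -w) := by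
      ext l
      by_cases hl : l = j
      · subst hl
        simp [hu, hw, Ne.symm hij]
      · simp [hu, hw, hl]
    rw [h2] at h1
    rw [aFun, aFun, h1]
  rw [covForm_add hD.nonneg hm2, covForm_add hD.nonneg hm2, covForm_neg_right] at hsym
  have h3 : covForm D (-w) (-w) = covForm D w w := by
    have := covForm_smul D (-1) w
    simpa using this
  rw [h3] at hsym
  linarith

theorem covForm_eq (hD : AssumptionD C c₁ c₂ η ε L D R) (hS : AssumptionS R) (hε : 0 < ε)
    (k : EuclideanSpace ℝ (Fin d)) : covForm D k k = sigmaSq D / (2 * d) * ‖k‖ ^ 2 := by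
  have hm2 := summable_moment hD.nonneg (summable_of_normalised hD.normalised)
    (by norm_num : (0 : ℝ) ≤ 2) (by linarith) hD.moment
  rw [covForm_sum hD.nonneg hm2, EuclideanSpace.norm_sq_eq, Finset.mul_sum]
  refine Finset.sum_congr rfl fun i _ => ?_
  rw [Finset.sum_eq_single i]
  · rw [hD.covForm_single hS hε, Real.norm_eq_abs, sq_abs]; ring
  · intro j _ hj
    rw [hD.covForm_single_ne hS hε (Ne.symm hj), mul_zero]
  · simp

theorem abs_aFun_sub_le (hD : AssumptionD C c₁ c₂ η ε L D R) (hS : AssumptionS R) (hε : 0 < ε)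
    {s : ℝ} (hs0 : 0 ≤ s) (hs1 : s ≤ 1) (hsε : s ≤ ε) (k : EuclideanSpace ℝ (Fin d)) :
    |aFun D k - sigmaSq D / (2 * d) * ‖k‖ ^ 2| ≤
      3 * (∑' x, ‖latticeVec x‖ ^ (2 + 2 * s) * D x) * ‖k‖ ^ (2 + 2 * s) := by
  rw [← hD.covForm_eq hS hε]
  exact abs_aFun_sub_covForm_le hD.nonneg hD.normalised hs0 hs1 hsε hD.moment k

theorem le_sigmaSq (hD : AssumptionD C c₁ c₂ η ε L D R) (hS : AssumptionS R) (hd : 0 < d)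
    (hL : 1 ≤ L) : c₁ * L ^ 2 ≤ sigmaSq D / (2 * d) := by
  refine ge_of_tendsto (hD.tendsto_aFun_single hS ⟨0, hd⟩) ?_
  have : ∀ᶠ t in 𝓝 (0 : ℝ), t ∈ Icc (-L⁻¹) L⁻¹ :=
    Icc_mem_nhds (by simp; linarith) (by simp; linarith)
  filter_upwards [self_mem_nhdsWithin, eventually_nhdsWithin_of_eventually_nhds this] with t ht ht'
  have ht0 : t ≠ 0 := ht
  rw [le_div_iff₀ (by positivity)]
  have h1 := hD.a_lower (t • EuclideanSpace.single ⟨0, hd⟩ (1 : ℝ)) ?_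
  · rw [norm_smul] at h1
    simpa using h1
  · intro j
    by_cases hj : j = ⟨0, hd⟩
    · subst hj; simpa [abs_le] using ht'
    · simp [hj]; linarith

theorem sigmaSq_pos (hD : AssumptionD C c₁ c₂ η ε L D R) (hS : AssumptionS R) (hd : 0 < d)
    (hL : 1 ≤ L) (hc₁ : 0 < c₁) : 0 < sigmaSq D := by
  have h := hD.le_sigmaSq hS hd hL
  have h1 : 0 < c₁ * L ^ 2 := by positivity
  have hd' : (0 : ℝ) < 2 * d := by positivity
  have := h1.trans_le h
  rw [lt_div_iff₀ hd'] at this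
  linarith

/-- Points of the cube with `a ≤ η` lie in the small cube of side `2 / L`. -/
theorem abs_lt_of_aFun_le (hD : AssumptionD C c₁ c₂ η ε L D R) {k : EuclideanSpace ℝ (Fin d)}
    (hk : k ∈ box d) (ha : aFun D k ≤ η) (i : Fin d) : |k i| < L⁻¹ := by
  by_contra h
  exact absurd (hD.a_gt k hk ⟨i, not_lt.1 h⟩) (not_lt.2 ha)

theorem tendsto_aFun_zero (hD : AssumptionD C c₁ c₂ η ε L D R) (hS : AssumptionS R)
    (i : Fin d) :
    Tendsto (fun t : ℝ => aFun D (t • EuclideanSpace.single i (1 : ℝ))) (𝓝[≠] 0) (𝓝 0) := by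
  have h1 := hD.tendsto_aFun_single hS i
  have h2 : Tendsto (fun t : ℝ => t ^ 2) (𝓝[≠] 0) (𝓝 0) := by
    have := (continuous_pow 2 (M := ℝ)).tendsto 0
    simp only [ne_eq, OfNat.ofNat_ne_zero, not_false_eq_true, zero_pow] at this
    exact this.mono_left nhdsWithin_le_nhds
  have h3 := h1.mul h2
  rw [mul_zero] at h3
  refine h3.congr' ?_
  filter_upwards [self_mem_nhdsWithin] with t ht
  have ht0 : t ≠ 0 := ht
  field_simp

end AssumptionD

end LaceRecursion

namespace LaceRecursion

section Box

variable {d : ℕ}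

theorem box_eq_preimage : box d = (MeasurableEquiv.toLp 2 (Fin d → ℝ)).symm ⁻¹'
    (Set.univ.pi fun _ => Icc (-Real.pi) Real.pi) := by
  ext k
  exact ⟨fun h i _ => h i, fun h i => h i (mem_univ i)⟩

theorem isCompact_box : IsCompact (box d) := by
  have h1 : IsCompact (Set.univ.pi fun _ : Fin d => Icc (-Real.pi) Real.pi) :=
    isCompact_univ_pi fun _ => isCompact_Icc
  have h2 := h1.image (PiLp.continuous_toLp 2 (fun _ : Fin d => ℝ))
  convert h2 using 1
  ext k
  constructor
  · intro hk
    exact ⟨k.ofLp, fun i _ => hk i, rfl⟩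
  · rintro ⟨y, hy, rfl⟩
    exact fun i => hy i (mem_univ i)

theorem measurableSet_box : MeasurableSet (box d) := isCompact_box.isClosed.measurableSet

theorem integral_exp_int (m : ℤ) :
    ∫ x in Icc (-Real.pi) Real.pi, Complex.exp (Complex.I * ((x * m : ℝ) : ℂ)) =
      if m = 0 then ((2 * Real.pi : ℝ) : ℂ) else 0 := by
  have hpi := Real.pi_pos
  rw [integral_Icc_eq_integral_Ioc, ← intervalIntegral.integral_of_le (by linarith)]
  split_ifs with h
  · subst h
    simp
    ring
  · have hc : Complex.I * (m : ℂ) ≠ 0 :=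
      mul_ne_zero Complex.I_ne_zero (by exact_mod_cast h)
    have h1 : ∀ x : ℝ, Complex.exp (Complex.I * ((x * m : ℝ) : ℂ)) =
        Complex.exp (Complex.I * (m : ℂ) * (x : ℂ)) := by
      intro x; congr 1; push_cast; ring
    simp_rw [h1]
    rw [integral_exp_mul_complex hc]
    have h2 : Complex.exp (Complex.I * m * (Real.pi : ℂ)) =
        Complex.exp (Complex.I * m * ((-Real.pi : ℝ) : ℂ)) := by
      rw [Complex.exp_eq_exp_iff_exists_int]
      exact ⟨m, by push_cast; ring⟩
    rw [h2, sub_self, zero_div]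

theorem integral_box_exp (w : Fin d → ℤ) :
    ∫ k in box d, Complex.exp (Complex.I * ((inner ℝ k (latticeVec w) : ℝ) : ℂ)) =
      if w = 0 then (((2 * Real.pi) ^ d : ℝ) : ℂ) else 0 := by
  have hmp := EuclideanSpace.volume_preserving_symm_measurableEquiv_toLp (Fin d)
  have h1 := hmp.setIntegral_preimage_emb (MeasurableEquiv.measurableEmbedding _)
    (fun y : Fin d → ℝ => ∏ i, Complex.exp (Complex.I * ((y i * w i : ℝ) : ℂ)))
    (Set.univ.pi fun _ => Icc (-Real.pi) Real.pi)
  rw [← box_eq_preimage] at h1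
  have h2 : ∀ k : EuclideanSpace ℝ (Fin d),
      Complex.exp (Complex.I * ((inner ℝ k (latticeVec w) : ℝ) : ℂ)) =
      ∏ i, Complex.exp (Complex.I * (((MeasurableEquiv.toLp 2 (Fin d → ℝ)).symm k i * w i : ℝ) : ℂ))
      := by
    intro k
    rw [← Complex.exp_sum]
    congr 1
    simp [PiLp.inner_apply, latticeVec, Finset.mul_sum, mul_comm]
  simp_rw [h2]
  rw [h1, volume_pi, Measure.restrict_pi_pi,
    integral_fintype_prod_eq_prod (fun i (y : ℝ) => Complex.exp (Complex.I * ((y * w i : ℝ) : ℂ)))]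
  simp_rw [integral_exp_int]
  split_ifs with h
  · subst h
    simp
  · obtain ⟨i, hi⟩ : ∃ i, w i ≠ 0 := by
      by_contra hcon
      push Not at hcon
      exact h (funext hcon)
    exact Finset.prod_eq_zero (Finset.mem_univ i) (by simp [hi])

theorem integral_box_cos (w : Fin d → ℤ) :
    ∫ k in box d, Real.cos (inner ℝ k (latticeVec w)) =
      if w = 0 then (2 * Real.pi) ^ d else 0 := by
  have h1 := congrArg Complex.re (integral_box_exp w)
  have hint : IntegrableOn (fun k : EuclideanSpace ℝ (Fin d) =>
      Complex.exp (Complex.I * ((inner ℝ k (latticeVec w) : ℝ) : ℂ))) (box d) := by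
    apply ContinuousOn.integrableOn_compact isCompact_box
    fun_prop
  have h2 := integral_re hint
  simp only [RCLike.re_to_complex] at h2
  rw [← h2] at h1
  have h3 : ∀ k : EuclideanSpace ℝ (Fin d),
      (Complex.exp (Complex.I * ((inner ℝ k (latticeVec w) : ℝ) : ℂ))).re =
      Real.cos (inner ℝ k (latticeVec w)) := by
    intro k
    rw [mul_comm, Complex.exp_ofReal_mul_I_re]
  simp_rw [h3] at h1
  rw [h1]
  split_ifs
  · rw [Complex.ofReal_re]
  · simp

theorem latticeVec_add (x y : Fin d → ℤ) : latticeVec (x + y) = latticeVec x + latticeVec y := by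
  ext i; simp [latticeVec]

theorem latticeVec_sub (x y : Fin d → ℤ) : latticeVec (x - y) = latticeVec x - latticeVec y := by
  ext i; simp [latticeVec]

theorem integral_box_cos_mul_cos (x y : Fin d → ℤ) :
    ∫ k in box d, Real.cos (inner ℝ k (latticeVec x)) * Real.cos (inner ℝ k (latticeVec y)) =
      (2 * Real.pi) ^ d * ((if y = x then 1 / 2 else 0) + (if y = -x then 1 / 2 else 0)) := by
  have hint : ∀ w : Fin d → ℤ, IntegrableOn (fun k : EuclideanSpace ℝ (Fin d) =>
      Real.cos (inner ℝ k (latticeVec w)) / 2) (box d) := by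
    intro w
    apply ContinuousOn.integrableOn_compact isCompact_box
    fun_prop
  have h1 : ∀ k : EuclideanSpace ℝ (Fin d),
      Real.cos (inner ℝ k (latticeVec x)) * Real.cos (inner ℝ k (latticeVec y)) =
      Real.cos (inner ℝ k (latticeVec (x - y))) / 2 +
        Real.cos (inner ℝ k (latticeVec (x + y))) / 2 := by
    intro k
    rw [latticeVec_add, latticeVec_sub, inner_add_right, inner_sub_right, Real.cos_add,
      Real.cos_sub]
    ring
  simp_rw [h1]
  rw [integral_add (hint _) (hint _), integral_div, integral_div, integral_box_cos,
    integral_box_cos]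
  have e1 : x - y = 0 ↔ y = x := by rw [sub_eq_zero, eq_comm]
  have e2 : x + y = 0 ↔ y = -x := by rw [add_comm, add_eq_zero_iff_eq_neg]
  simp only [e1, e2]
  split_ifs <;> ring

end Box

section Parseval

variable {d : ℕ} {D : (Fin d → ℤ) → ℝ}

theorem continuous_Dhat (hD : ∀ x, 0 ≤ D x) (hsum : Summable D) : Continuous (Dhat D) := by
  have h : Dhat D = fun k => ∑' x, D x * Real.cos (inner ℝ k (latticeVec x)) :=
    funext (Dhat_eq_tsum hD hsum)
  rw [h]
  refine continuous_tsum (fun x => by fun_prop) hsum fun x k => ?_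
  rw [norm_mul, Real.norm_of_nonneg (hD x)]
  exact mul_le_of_le_one_right (hD x) (Real.abs_cos_le_one _)

theorem abs_Dhat_le_one (hD : ∀ x, 0 ≤ D x) (h1 : fourierZd D 0 = 1)
    (k : EuclideanSpace ℝ (Fin d)) : |Dhat D k| ≤ 1 := by
  have hsum := summable_of_normalised h1
  rw [Dhat_eq_tsum hD hsum, ← tsum_eq_one h1]
  refine tsum_of_norm_bounded (f := fun x => D x * Real.cos (inner ℝ k (latticeVec x)))
    hsum.hasSum fun x => ?_
  rw [norm_mul, Real.norm_of_nonneg (hD x)]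
  exact mul_le_of_le_one_right (hD x) (Real.abs_cos_le_one _)

/-- Termwise integration of `D̂` against a continuous bounded function. -/
theorem hasSum_integral_mul_Dhat (hD : ∀ x, 0 ≤ D x) (hsum : Summable D)
    {φ : EuclideanSpace ℝ (Fin d) → ℝ} (hφ : Continuous φ) (hφ1 : ∀ k, |φ k| ≤ 1) :
    HasSum (fun x => D x * ∫ k in box d, φ k * Real.cos (inner ℝ k (latticeVec x)))
      (∫ k in box d, φ k * Dhat D k) := by
  set F : (Fin d → ℤ) → EuclideanSpace ℝ (Fin d) → ℝ :=
    fun x k => D x * (φ k * Real.cos (inner ℝ k (latticeVec x))) with hF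
  have hint : ∀ x, IntegrableOn (F x) (box d) := by
    intro x
    apply ContinuousOn.integrableOn_compact isCompact_box
    fun_prop
  have hfin : volume (box d) < ⊤ := isCompact_box.measure_lt_top
  have hbd : ∀ x, ∫ k in box d, ‖F x k‖ ≤ D x * volume.real (box d) := by
    intro x
    have h1 : ∀ k ∈ box d, ‖F x k‖ ≤ D x := by
      intro k _
      rw [hF]
      simp only [norm_mul, Real.norm_of_nonneg (hD x)]
      refine mul_le_of_le_one_right (hD x) ?_
      exact mul_le_one₀ (hφ1 k) (norm_nonneg _) (Real.abs_cos_le_one _)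
    have h2 := setIntegral_mono_on (hint x).norm (integrableOn_const (C := D x) hfin.ne)
      measurableSet_box h1
    refine h2.trans (le_of_eq ?_)
    rw [setIntegral_const, smul_eq_mul, mul_comm]
  have h := hasSum_integral_of_summable_integral_norm hint
    (Summable.of_nonneg_of_le (fun x => integral_nonneg fun k => norm_nonneg _) hbd
      (hsum.mul_right _))
  have e1 : ∀ k, ∑' x, F x k = φ k * Dhat D k := by
    intro k
    rw [Dhat_eq_tsum hD hsum, ← tsum_mul_left]
    congr 1
    ext x
    rw [hF]; ring
  simp_rw [e1] at h
  have e2 : (fun x => D x * ∫ k in box d, φ k * Real.cos (inner ℝ k (latticeVec x))) =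
      fun x => ∫ k in box d, F x k := by
    ext x
    rw [hF, integral_const_mul]
  rw [e2]
  exact h

theorem integral_box_Dhat_sq_le (hD : ∀ x, 0 ≤ D x) (h1 : fourierZd D 0 = 1) {B : ℝ}
    (hB : ∀ x, D x ≤ B) : ∫ k in box d, Dhat D k ^ 2 ≤ (2 * Real.pi) ^ d * B := by
  have hsum := summable_of_normalised h1
  have hcoef : ∀ x, ∫ k in box d, Dhat D k * Real.cos (inner ℝ k (latticeVec x)) ≤
      (2 * Real.pi) ^ d * B := by
    intro x
    have h2 := hasSum_integral_mul_Dhat hD hsum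
      (φ := fun k => Real.cos (inner ℝ k (latticeVec x))) (by fun_prop)
      (fun k => Real.abs_cos_le_one _)
    simp_rw [integral_box_cos_mul_cos] at h2
    have h3 : HasSum (fun y : Fin d → ℤ => (2 * Real.pi) ^ d *
        ((if y = x then D x / 2 else 0) + (if y = -x then D (-x) / 2 else 0)))
        ((2 * Real.pi) ^ d * (D x / 2 + D (-x) / 2)) :=
      ((hasSum_ite_eq x (D x / 2)).add (hasSum_ite_eq (-x) (D (-x) / 2))).mul_left _
    have h4 : (fun y : Fin d → ℤ => D y * ((2 * Real.pi) ^ d *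
        ((if y = x then 1 / 2 else 0) + (if y = -x then 1 / 2 else 0)))) =
        fun y => (2 * Real.pi) ^ d *
        ((if y = x then D x / 2 else 0) + (if y = -x then D (-x) / 2 else 0)) := by
      ext y
      have e1 : D y * (if y = x then 1 / 2 else 0) = if y = x then D x / 2 else 0 := by
        split_ifs with h
        · rw [h]; ring
        · ring
      have e2 : D y * (if y = -x then 1 / 2 else 0) = if y = -x then D (-x) / 2 else 0 := by
        split_ifs with h
        · rw [h]; ring
        · ring
      rw [← e1, ← e2]; ring
    rw [h4] at h2
    have h5 := h2.unique h3
    simp_rw [mul_comm (Dhat D _)]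
    rw [h5]
    gcongr
    linarith [hB x, hB (-x)]
  have h6 := hasSum_integral_mul_Dhat hD hsum (continuous_Dhat hD hsum) (abs_Dhat_le_one hD h1)
  simp_rw [← pow_two] at h6
  have h7 := hasSum_le (fun x => mul_le_mul_of_nonneg_left (hcoef x) (hD x)) h6
    (hsum.hasSum.mul_right _)
  rwa [tsum_eq_one h1, one_mul] at h7

end Parseval

end LaceRecursion

namespace LaceRecursion

section Integrals

variable {d : ℕ}

/-- The singular power `‖y‖^{-p}`, cut off outside a ball. -/
noncomputable def cutPow (d : ℕ) (p : ℝ) : EuclideanSpace ℝ (Fin d) → ℝ :=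
  (Metric.ball 0 ((d : ℝ) + 1)).indicator fun y => ‖y‖ ^ (-p)

theorem cutPow_nonneg (p : ℝ) (y : EuclideanSpace ℝ (Fin d)) : 0 ≤ cutPow d p y :=
  Set.indicator_nonneg (fun _ _ => by positivity) y

theorem integrable_cutPow (hd : 0 < d) {p : ℝ} (hp : p < d) : Integrable (cutPow d p) := by
  have : Nonempty (Fin d) := ⟨⟨0, hd⟩⟩
  have : Nontrivial (EuclideanSpace ℝ (Fin d)) := inferInstance
  unfold cutPow
  rw [integrable_indicator_iff measurableSet_ball]
  rw [integrableOn_fun_norm_addHaar volume (f := fun y : ℝ => y ^ (-p))]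
  have h1 := (intervalIntegral.integrableOn_Ioo_rpow_iff (s := (d : ℝ) - 1 - p)
    (t := (d : ℝ) + 1) (by positivity)).2 (by linarith)
  refine h1.congr_fun ?_ measurableSet_Ioo
  intro y hy
  have hy0 : 0 < y := hy.1
  simp only [finrank_euclideanSpace, Fintype.card_fin, smul_eq_mul]
  rw [← Real.rpow_natCast, ← Real.rpow_add hy0, Nat.cast_sub (by omega)]
  congr 1
  push_cast
  ring

theorem integral_cutPow_smul {L : ℝ} (hL : 0 < L) (p : ℝ) :
    ∫ k, cutPow d p (L • k) = (L ^ d)⁻¹ * ∫ k, cutPow d p k := by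
  rw [Measure.integral_comp_smul, finrank_euclideanSpace, Fintype.card_fin, smul_eq_mul,
    abs_of_pos (by positivity)]

theorem integral_gaussian {b : ℝ} (hb : 0 < b) :
    ∫ k : EuclideanSpace ℝ (Fin d), Real.exp (-b * ‖k‖ ^ 2) = (Real.pi / b) ^ ((d : ℝ) / 2) := by
  rw [GaussianFourier.integral_rexp_neg_mul_sq_norm hb]
  simp

theorem integrable_gaussian {b : ℝ} (hb : 0 < b) :
    Integrable fun k : EuclideanSpace ℝ (Fin d) => Real.exp (-b * ‖k‖ ^ 2) := by
  by_contra h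
  have h1 := integral_gaussian (d := d) hb
  rw [integral_undef h] at h1
  have : 0 < (Real.pi / b) ^ ((d : ℝ) / 2) := by positivity
  linarith

theorem norm_lt_of_abs_le {k : EuclideanSpace ℝ (Fin d)} (h : ∀ i, |k i| ≤ 1) :
    ‖k‖ < (d : ℝ) + 1 := by
  have h1 : ‖k‖ ^ 2 ≤ d := by
    rw [EuclideanSpace.norm_sq_eq]
    calc ∑ i, ‖k i‖ ^ 2 ≤ ∑ _i : Fin d, (1 : ℝ) :=
          Finset.sum_le_sum fun i _ => by
            rw [Real.norm_eq_abs]; exact pow_le_one₀ (abs_nonneg _) (h i)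
      _ = d := by simp
  nlinarith [norm_nonneg k, (Nat.cast_nonneg d : (0 : ℝ) ≤ d)]

end Integrals

variable {d : ℕ} {D : (Fin d → ℤ) → ℝ} {R : Recursion d} {C c₁ c₂ η ε L : ℝ}

/-- The constant in the bound on `‖D̂² f_n‖₁`. -/
noncomputable def normConst (d : ℕ) (C c₁ η κ K : ℝ) : ℝ :=
  ((2 * Real.pi) ^ d)⁻¹ * (2 * (2 * Real.pi / c₁) ^ ((d : ℝ) / 2) +
    K * c₁ ^ (-((d : ℝ) / 2 - κ)) * ∫ k, cutPow d (2 * ((d : ℝ) / 2 - κ)) k) +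
    K * η ^ (-((d : ℝ) / 2 - κ)) * |C|

theorem AssumptionD.normOne_le (hD : AssumptionD C c₁ c₂ η ε L D R) (hd : 0 < d) (hL : 1 ≤ L)
    (hc₁ : 0 < c₁) (hη : 0 < η) {κ K x : ℝ} (hκ : 0 < κ) (hκ2 : κ < (d : ℝ) / 2) (hK : 0 ≤ K)
    (hx : 1 ≤ x) {u : EuclideanSpace ℝ (Fin d) → ℝ}
    (hsmall : ∀ k ∈ box d, aFun D k ≤ η → |u k| ≤ 2 * Real.exp (-(aFun D k * x) / 2) +
      K * (aFun D k ^ (-((d : ℝ) / 2 - κ)) * x ^ (-((d : ℝ) / 2))))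
    (hlarge : ∀ k ∈ box d, η < aFun D k →
      |u k| ≤ K * (aFun D k ^ (-((d : ℝ) / 2 - κ)) * x ^ (-((d : ℝ) / 2)))) :
    normOne (fun k => Dhat D k ^ 2 * u k) ≤
      ENNReal.ofReal (normConst d C c₁ η κ K * beta d L * x ^ (-((d : ℝ) / 2))) := by
  have hL0 : 0 < L := by linarith
  have hx0 : 0 < x := by linarith
  set θ := (d : ℝ) / 2 with hθ
  set p := θ - κ with hp
  have hp0 : 0 < p := by linarith
  set X := x ^ (-θ) with hX
  have hX0 : 0 < X := by positivity
  have hsum := summable_of_normalised hD.normalised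
  set b := c₁ * x * L ^ 2 / 2 with hb
  have hb0 : 0 < b := by positivity
  set Φ₁ : EuclideanSpace ℝ (Fin d) → ℝ := fun k => 2 * Real.exp (-b * ‖k‖ ^ 2) with hΦ₁
  set Φ₂ : EuclideanSpace ℝ (Fin d) → ℝ :=
    fun k => K * c₁ ^ (-p) * X * cutPow d (2 * p) (L • k) with hΦ₂
  set Φ₃ : EuclideanSpace ℝ (Fin d) → ℝ := fun k => K * η ^ (-p) * X * Dhat D k ^ 2 with hΦ₃
  have i1 : Integrable Φ₁ := (integrable_gaussian hb0).const_mul 2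
  have hcut : Integrable (cutPow d (2 * p)) := integrable_cutPow hd (by rw [hp, hθ]; linarith)
  have i2 : Integrable Φ₂ := (hcut.comp_smul hL0.ne').const_mul _
  have i3 : IntegrableOn Φ₃ (box d) := by
    apply ContinuousOn.integrableOn_compact isCompact_box
    have := continuous_Dhat hD.nonneg hsum
    fun_prop
  have n1 : ∀ k, 0 ≤ Φ₁ k := fun k => by positivity
  have n2 : ∀ k, 0 ≤ Φ₂ k := fun k =>
    mul_nonneg (by positivity) (cutPow_nonneg _ _)
  have n3 : ∀ k, 0 ≤ Φ₃ k := fun k => by positivity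
  have hpt : ∀ k ∈ box d, |Dhat D k ^ 2 * u k| ≤ Φ₁ k + Φ₂ k + Φ₃ k := by
    intro k hk
    have hD1 : Dhat D k ^ 2 ≤ 1 := by
      have := abs_Dhat_le_one hD.nonneg hD.normalised k
      rw [← sq_abs]
      exact pow_le_one₀ (abs_nonneg _) this
    rw [abs_mul, abs_of_nonneg (sq_nonneg _)]
    rcases le_or_gt (aFun D k) η with ha | ha
    · have hsm := fun i => (hD.abs_lt_of_aFun_le hk ha i).le
      have hlow := hD.a_lower k hsm
      have hball : L • k ∈ Metric.ball (0 : EuclideanSpace ℝ (Fin d)) ((d : ℝ) + 1) := by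
        rw [mem_ball_zero_iff]
        apply norm_lt_of_abs_le
        intro i
        rw [PiLp.smul_apply, smul_eq_mul, abs_mul, abs_of_pos hL0]
        calc L * |k i| ≤ L * L⁻¹ := by gcongr; exact hsm i
          _ = 1 := mul_inv_cancel₀ hL0.ne'
      have e1 : 2 * Real.exp (-(aFun D k * x) / 2) ≤ Φ₁ k := by
        rw [hΦ₁]
        simp only
        gcongr
        rw [hb]
        have : c₁ * L ^ 2 * ‖k‖ ^ 2 * x ≤ aFun D k * x := by gcongr
        linarith
      have e2 : K * (aFun D k ^ (-p) * X) ≤ Φ₂ k := by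
        have e3 : aFun D k ^ (-p) ≤ c₁ ^ (-p) * cutPow d (2 * p) (L • k) := by
          rw [cutPow, Set.indicator_of_mem hball]
          rcases eq_or_ne k 0 with h0 | h0
          · rw [h0, aFun_zero hD.normalised, Real.zero_rpow (by linarith)]
            positivity
          · have hk0 : 0 < ‖k‖ := norm_pos_iff.2 h0
            have h4 : ‖L • k‖ ^ (-(2 * p)) = ((L * ‖k‖) ^ 2) ^ (-p) := by
              rw [norm_smul, Real.norm_of_nonneg hL0.le, ← Real.rpow_natCast,
                ← Real.rpow_mul (by positivity)]
              congr 1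
              push_cast
              ring
            rw [h4, ← Real.mul_rpow hc₁.le (by positivity)]
            apply Real.rpow_le_rpow_of_nonpos (by positivity) _ (by linarith)
            calc _ = c₁ * L ^ 2 * ‖k‖ ^ 2 := by ring
              _ ≤ _ := hlow
        rw [hΦ₂]
        simp only
        calc _ ≤ K * ((c₁ ^ (-p) * cutPow d (2 * p) (L • k)) * X) := by gcongr
          _ = _ := by ring
      have e5 : |u k| ≤ Φ₁ k + Φ₂ k := (hsmall k hk ha).trans (add_le_add e1 e2)
      calc Dhat D k ^ 2 * |u k| ≤ 1 * |u k| := by gcongr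
        _ ≤ Φ₁ k + Φ₂ k + Φ₃ k := by linarith [n3 k]
    · have e1 : aFun D k ^ (-p) ≤ η ^ (-p) :=
        Real.rpow_le_rpow_of_nonpos hη ha.le (by linarith)
      calc Dhat D k ^ 2 * |u k| ≤ Dhat D k ^ 2 * (K * (η ^ (-p) * X)) := by
            gcongr
            refine (hlarge k hk ha).trans ?_
            gcongr
        _ = Φ₃ k := by rw [hΦ₃]; ring
        _ ≤ _ := by linarith [n1 k, n2 k]
  have I1 : ∫ k in box d, Φ₁ k ≤ 2 * (2 * Real.pi / c₁) ^ θ * (beta d L * X) := by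
    refine (setIntegral_le_integral i1 (Eventually.of_forall n1)).trans (le_of_eq ?_)
    rw [hΦ₁, integral_const_mul, integral_gaussian hb0, mul_assoc]
    congr 1
    have e1 : Real.pi / b = (2 * Real.pi / c₁) * (x⁻¹ * (L ^ 2)⁻¹) := by
      rw [hb]; field_simp
    rw [e1, Real.mul_rpow (by positivity) (by positivity),
      Real.mul_rpow (by positivity) (by positivity), Real.inv_rpow hx0.le,
      ← Real.rpow_neg hx0.le, beta, Real.inv_rpow (by positivity), ← Real.rpow_natCast L 2,
      ← Real.rpow_mul hL0.le]
    have e2 : ((2 : ℕ) : ℝ) * ((d : ℝ) / 2) = (d : ℝ) := by push_cast; ring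
    rw [e2, Real.rpow_natCast]
    ring
  have I2 : ∫ k in box d, Φ₂ k ≤
      K * c₁ ^ (-p) * (∫ k, cutPow d (2 * p) k) * (beta d L * X) := by
    refine (setIntegral_le_integral i2 (Eventually.of_forall n2)).trans (le_of_eq ?_)
    rw [hΦ₂, integral_const_mul, integral_cutPow_smul hL0, beta]
    ring
  have I3 : ∫ k in box d, Φ₃ k ≤ K * η ^ (-p) * |C| * ((2 * Real.pi) ^ d * (beta d L * X)) := by
    have h1 := integral_box_Dhat_sq_le hD.nonneg hD.normalised hD.sup_le
    rw [hΦ₃, integral_const_mul]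
    have h2 : C * (L ^ d)⁻¹ ≤ |C| * (L ^ d)⁻¹ := by gcongr; exact le_abs_self C
    calc _ ≤ K * η ^ (-p) * X * ((2 * Real.pi) ^ d * (|C| * (L ^ d)⁻¹)) := by
          gcongr
          refine h1.trans ?_
          gcongr
      _ = _ := by rw [beta]; ring
  have itot : IntegrableOn (fun k => Φ₁ k + Φ₂ k + Φ₃ k) (box d) :=
    (i1.integrableOn.add i2.integrableOn).add i3
  have hlint : ∫⁻ k in box d, ENNReal.ofReal |Dhat D k ^ 2 * u k| ≤
      ENNReal.ofReal (∫ k in box d, (Φ₁ k + Φ₂ k + Φ₃ k)) := by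
    rw [ofReal_integral_eq_lintegral_ofReal itot
      (Eventually.of_forall fun k => by
        have := n1 k; have := n2 k; have := n3 k
        simp only [Pi.zero_apply]; positivity)]
    exact setLIntegral_mono' measurableSet_box fun k hk => ENNReal.ofReal_le_ofReal (hpt k hk)
  have hInt : ∫ k in box d, (Φ₁ k + Φ₂ k + Φ₃ k) ≤
      (2 * (2 * Real.pi / c₁) ^ θ + K * c₁ ^ (-p) * (∫ k, cutPow d (2 * p) k) +
      K * η ^ (-p) * |C| * (2 * Real.pi) ^ d) * (beta d L * X) := by
    have h12 : IntegrableOn (fun k => Φ₁ k + Φ₂ k) (box d) :=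
      i1.integrableOn.add i2.integrableOn
    rw [integral_add h12 i3, integral_add i1.integrableOn i2.integrableOn]
    linarith
  unfold normOne
  calc _ ≤ ENNReal.ofReal (((2 * Real.pi) ^ d)⁻¹) *
        ENNReal.ofReal ((2 * (2 * Real.pi / c₁) ^ θ +
          K * c₁ ^ (-p) * (∫ k, cutPow d (2 * p) k) +
          K * η ^ (-p) * |C| * (2 * Real.pi) ^ d) * (beta d L * X)) := by
        gcongr
        exact hlint.trans (ENNReal.ofReal_le_ofReal hInt)
    _ = _ := by
        rw [← ENNReal.ofReal_mul (by positivity)]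
        congr 1
        have hN : normConst d C c₁ η κ K = ((2 * Real.pi) ^ d)⁻¹ * (2 * (2 * Real.pi / c₁) ^ θ +
            K * c₁ ^ (-p) * ∫ k, cutPow d (2 * p) k) + K * η ^ (-p) * |C| := rfl
        rw [hN]
        have hπ : (2 * Real.pi) ^ d ≠ 0 := by positivity
        have e := inv_mul_cancel₀ hπ
        linear_combination (K * η ^ (-p) * |C| * (beta d L * X)) * e

end LaceRecursion

namespace LaceRecursion

theorem RatioSeq.le_one {a : ℝ} {n : ℕ} {F w : ℕ → ℝ} (H : RatioSeq a n F w) (ha0 : 0 ≤ a)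
    (ha : a ≤ 1 / 4) {j : ℕ} (hj : j ≤ n) : F j ≤ 1 := by
  refine (H.le_exp ha j hj).trans ?_
  rw [Real.exp_le_one_iff]
  have : 0 ≤ a * j := by positivity
  linarith

theorem RatioSeq.one_sub_mem {a : ℝ} {n : ℕ} {F w : ℕ → ℝ} (H : RatioSeq a n F w) (ha0 : 0 ≤ a)
    (ha : a ≤ 1 / 4) {j : ℕ} (hj : j ≤ n) : 1 - F j ∈ Icc 0 (2 * a * j) := by
  have h := (H.mono hj).sub_eq_sum (Nat.zero_le j)
  rw [H.F_zero] at h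
  refine ⟨by linarith [H.le_one ha0 ha hj], ?_⟩
  rw [h]
  calc _ ≤ ∑ _i ∈ Finset.Ico 0 j, 2 * a := by
        apply Finset.sum_le_sum
        intro i hi
        have hi' : i < n := (Finset.mem_Ico.1 hi).2.trans_le hj
        have h1 := H.w_le i hi'
        have h2 := H.le_w i hi'
        have h3 := H.le_one ha0 ha hi'.le
        have h4 := H.pos ha i hi'.le
        nlinarith
    _ = _ := by simp; ring

theorem Exponents.le_quarter {θ δ s γ : ℝ} (E : Exponents θ δ s γ) {a x : ℝ} (hx : 1 ≤ x)
    (ha : a ≤ γ * logRatio x) : a ≤ 1 / 4 := by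
  have h1 := logRatio_le_one hx
  have h2 := E.γ_le
  have h3 := E.γ_pos
  nlinarith [logRatio_pos hx]

/-- For each `N` there is a diffusion constant that is consistent with the coefficients up to
index `N`. -/
theorem exists_drift {θ δ c β z : ℝ} (hδ : 0 ≤ δ) (hθ : 2 < θ - δ) (hc : 0 ≤ c) (hβ : 0 ≤ β)
    {N : ℕ} {h g : ℕ → ℝ} (hz : |z| ≤ 3 / 2) (hsmall : c * β * zetaSum (θ - 1) ≤ 1 / 2)
    (hh : ∀ m, 2 ≤ m → m ≤ N → |h m| ≤ c * β * (m : ℝ) ^ (-(θ - 1)))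
    (hg : ∀ m, 2 ≤ m → m ≤ N → |g m| ≤ c * β * (m : ℝ) ^ (-θ)) :
    ∃ v ∈ Icc (-4 : ℝ) 4, ∀ n < N, |z - ∑ m ∈ Finset.Icc 2 (n + 1), h m -
      v * (1 + ∑ m ∈ Finset.Icc 2 (n + 1), ((m : ℝ) - 1) * g m)| ≤
      5 * c * zetaSum (θ - 1 - δ) * β * ((n : ℝ) + 1) ^ (-δ) := by
  have hg' : ∀ m, 2 ≤ m → m ≤ N → |((m : ℝ) - 1) * g m| ≤ c * β * (m : ℝ) ^ (-(θ - 1)) := by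
    intro m hm hmN
    have hm1 : (2 : ℝ) ≤ m := by exact_mod_cast hm
    have e : (m : ℝ) ^ (-(θ - 1)) = m * (m : ℝ) ^ (-θ) := by
      rw [show -(θ - 1) = 1 + -θ by ring, Real.rpow_add (by linarith), Real.rpow_one]
    rw [abs_mul, abs_of_nonneg (by linarith), e]
    calc _ ≤ (m : ℝ) * (c * β * (m : ℝ) ^ (-θ)) :=
          mul_le_mul (by linarith) (hg m hm hmN) (abs_nonneg _) (by linarith)
      _ = _ := by ring
  have total : ∀ u : ℕ → ℝ, (∀ m, 2 ≤ m → m ≤ N → |u m| ≤ c * β * (m : ℝ) ^ (-(θ - 1))) →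
      |∑ m ∈ Finset.Icc 2 N, u m| ≤ 1 / 2 := by
    intro u hu
    calc _ ≤ ∑ m ∈ Finset.Icc 2 N, c * β * (m : ℝ) ^ (-(θ - 1)) :=
          (Finset.abs_sum_le_sum_abs _ _).trans (Finset.sum_le_sum fun m hm =>
            hu m (Finset.mem_Icc.1 hm).1 (Finset.mem_Icc.1 hm).2)
      _ ≤ c * β * zetaSum (θ - 1) := by
          rw [← Finset.mul_sum]
          gcongr
          exact sum_rpow_le_zetaSum (by linarith) _
      _ ≤ 1 / 2 := hsmall
  have tail : ∀ u : ℕ → ℝ, (∀ m, 2 ≤ m → m ≤ N → |u m| ≤ c * β * (m : ℝ) ^ (-(θ - 1))) →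
      ∀ n < N, |∑ m ∈ Finset.Icc 2 N, u m - ∑ m ∈ Finset.Icc 2 (n + 1), u m| ≤
        c * zetaSum (θ - 1 - δ) * β * ((n : ℝ) + 1) ^ (-δ) := by
    intro u hu n hn
    have hsub : Finset.Icc 2 (n + 1) ⊆ Finset.Icc 2 N := Finset.Icc_subset_Icc le_rfl hn
    rw [← Finset.sum_sdiff hsub, add_sub_cancel_right]
    calc _ ≤ ∑ m ∈ Finset.Icc 2 N \ Finset.Icc 2 (n + 1),
          c * β * ((n : ℝ) + 1) ^ (-δ) * (m : ℝ) ^ (-(θ - 1 - δ)) := by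
          refine (Finset.abs_sum_le_sum_abs _ _).trans (Finset.sum_le_sum fun m hm => ?_)
          rw [Finset.mem_sdiff, Finset.mem_Icc, Finset.mem_Icc] at hm
          have hm1 : (n : ℝ) + 1 ≤ m := by exact_mod_cast (by omega : n + 1 ≤ m)
          have hn0 : (0 : ℝ) < (n : ℝ) + 1 := by positivity
          refine (hu m hm.1.1 hm.1.2).trans ?_
          rw [mul_assoc (c * β)]
          gcongr
          rw [show -(θ - 1) = -δ + -(θ - 1 - δ) by ring,
            Real.rpow_add (by linarith : (0 : ℝ) < m)]
          exact mul_le_mul_of_nonneg_right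
            (Real.rpow_le_rpow_of_nonpos hn0 hm1 (neg_nonpos.2 hδ)) (by positivity)
      _ ≤ c * β * ((n : ℝ) + 1) ^ (-δ) * zetaSum (θ - 1 - δ) := by
          rw [← Finset.mul_sum]
          gcongr
          exact sum_rpow_le_zetaSum (by linarith) _
      _ = _ := by ring
  have tg := total _ hg'
  have th := total _ hh
  set b := ∑ m ∈ Finset.Icc 2 N, h m with hb
  set q := ∑ m ∈ Finset.Icc 2 N, ((m : ℝ) - 1) * g m with hq
  have hq1 : 1 / 2 ≤ 1 + q := by linarith [(abs_le.1 tg).1]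
  have hv : |(z - b) / (1 + q)| ≤ 4 := by
    rw [abs_div, abs_of_pos (by linarith : 0 < 1 + q), div_le_iff₀ (by linarith)]
    have := abs_sub z b
    linarith
  refine ⟨(z - b) / (1 + q), abs_le.1 hv, fun n hn => ?_⟩
  have e : z - b = (z - b) / (1 + q) * (1 + q) := by field_simp
  set v := (z - b) / (1 + q)
  have h1 := tail _ hh n hn
  have h2 := tail _ hg' n hn
  rw [← hb] at h1
  rw [← hq] at h2
  have e2 : z - ∑ m ∈ Finset.Icc 2 (n + 1), h m -
      v * (1 + ∑ m ∈ Finset.Icc 2 (n + 1), ((m : ℝ) - 1) * g m) =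
      (b - ∑ m ∈ Finset.Icc 2 (n + 1), h m) +
      v * (q - ∑ m ∈ Finset.Icc 2 (n + 1), ((m : ℝ) - 1) * g m) := by
    linear_combination e
  rw [e2]
  refine (abs_add_le _ _).trans ?_
  rw [abs_mul]
  have h3 := mul_le_mul hv h2 (abs_nonneg _) (by norm_num)
  linarith

variable {d : ℕ} {D : (Fin d → ℤ) → ℝ} {R : Recursion d} {C c₁ c₂ η ε L : ℝ}

/-- `σ⁻² ∇² g_m(0; z)`. -/
noncomputable def lapRatio (D : (Fin d → ℤ) → ℝ) (R : Recursion d) (z : ℝ) (m : ℕ) : ℝ :=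
  (sigmaSq D)⁻¹ * Laplacian.laplacian (fun k => R.g m k z) 0

/-- The bounds on the coefficients `g_m`, `e_m` with `2 ≤ m ≤ N` at a fixed `z`. -/
structure CoeffBounds (s c L : ℝ) (D : (Fin d → ℤ) → ℝ) (R : Recursion d) (N : ℕ) (z : ℝ) :
    Prop where
  g_le : ∀ m, 2 ≤ m → m ≤ N → ∀ k ∈ box d,
    |R.g m k z| ≤ c * beta d L * (m : ℝ) ^ (-((d : ℝ) / 2))
  e_le : ∀ m, 2 ≤ m → m ≤ N → ∀ k ∈ box d,
    |R.e m k z| ≤ c * beta d L * (m : ℝ) ^ (-((d : ℝ) / 2))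
  e_diff : ∀ m, 2 ≤ m → m ≤ N → ∀ k ∈ box d,
    |R.e m k z - R.e m 0 z| ≤ c * beta d L * aFun D k * (m : ℝ) ^ (-((d : ℝ) / 2 - 1))
  lap_le : ∀ m, 2 ≤ m → m ≤ N →
    |lapRatio D R z m| ≤ c * beta d L * (m : ℝ) ^ (-((d : ℝ) / 2 - 1))
  taylor_zero : ∀ m, 2 ≤ m → m ≤ N → ∀ k ∈ box d,
    |R.g m k z - R.g m 0 z - aFun D k * lapRatio D R z m| ≤
      c * beta d L * aFun D k * (m : ℝ) ^ (-((d : ℝ) / 2 - 1))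
  taylor : ∀ m, 2 ≤ m → m ≤ N → ∀ k ∈ box d,
    |R.g m k z - R.g m 0 z - aFun D k * lapRatio D R z m| ≤
      c * beta d L * aFun D k ^ (1 + s) * (m : ℝ) ^ (-((d : ℝ) / 2 - 1 - s))

theorem beta_pos (hL : 0 < L) : 0 < beta d L := by unfold beta; positivity

theorem coeffBounds {Ce Cg : ℝ → ℝ} {LE LG : ℝ → ℝ → ℝ} (hS : AssumptionS R)
    (hD : AssumptionD C c₁ c₂ η ε L D R) (hd : 0 < d) (hc₁ : 0 < c₁) (hL : 1 ≤ L)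
    (hE : AssumptionE Ce LE L D R) (hG : AssumptionG ε Cg LG L D R) {s K α : ℝ} (hs0 : 0 ≤ s)
    (hsε : s ≤ ε) (hK : 1 < K) (hα : α ∈ Ioo (0 : ℝ) 1) (hLE : LE K α ≤ L) (hLG : LG K α ≤ L)
    {x y : ℝ} (hxy : x < y) (hsub : Icc x y ⊆ Icc (1 - α) (1 + α)) {n : ℕ}
    (hF : ∀ z ∈ Icc x y, ∀ m : ℕ, 1 ≤ m → m ≤ n → FBounds L D R K m z) {z : ℝ}
    (hz : z ∈ Icc x y) : CoeffBounds s (1 + |Ce K| + |Cg K|) L D R (n + 1) z := by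
  have hE' := hE K hK α hα hLE x y hxy hsub n hF z hz
  have hG' := hG K hK α hα hLG x y hxy hsub n hF z hz
  set c := 1 + |Ce K| + |Cg K|
  have hce : Ce K ≤ c := by
    have := le_abs_self (Ce K); have := abs_nonneg (Cg K); simp only [c]; linarith
  have hcg : Cg K ≤ c := by
    have := le_abs_self (Cg K); have := abs_nonneg (Ce K); simp only [c]; linarith
  have hβ : 0 < beta d L := beta_pos (by linarith)
  have ha : ∀ k, 0 ≤ aFun D k := fun k => aFun_nonneg hD.nonneg hD.normalised k
  have hσ := hD.sigmaSq_pos hS hd hL hc₁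
  have x1 : -(d : ℝ) / 2 = -((d : ℝ) / 2) := by ring
  have x2 : -((d : ℝ) - 2) / 2 = -((d : ℝ) / 2 - 1) := by ring
  have hlap : ∀ k m, aFun D k * (sigmaSq D)⁻¹ * Laplacian.laplacian (fun k => R.g m k z) 0 =
      aFun D k * lapRatio D R z m := fun k m => by rw [lapRatio]; ring
  constructor
  · intro m h2 hm k hk
    refine ((hG' m h2 hm).1 k hk).trans ?_
    rw [x1]; gcongr
  · intro m h2 hm k hk
    refine ((hE' k hk m h2 hm).1).trans ?_
    rw [x1]; gcongr
  · intro m h2 hm k hk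
    refine ((hE' k hk m h2 hm).2).trans ?_
    have := ha k
    rw [x2, mul_right_comm (Ce K)]; gcongr
  · intro m h2 hm
    have h := (hG' m h2 hm).2.2.1
    rw [lapRatio, abs_mul, abs_of_pos (inv_pos.2 hσ), inv_mul_le_iff₀ hσ]
    refine h.trans ?_
    rw [x2]
    calc _ ≤ c * sigmaSq D * beta d L * (m : ℝ) ^ (-((d : ℝ) / 2 - 1)) := by gcongr
      _ = _ := by ring
  · intro m h2 hm k hk
    have h := (hG' m h2 hm).2.2.2.2.2 k hk 0 ⟨le_rfl, hs0.trans hsε⟩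
    rw [hlap] at h
    refine h.trans ?_
    rw [show -((d : ℝ) - 2 - 2 * 0) / 2 = -((d : ℝ) / 2 - 1) by ring, add_zero, Real.rpow_one]
    have := ha k
    gcongr
  · intro m h2 hm k hk
    have h := (hG' m h2 hm).2.2.2.2.2 k hk s ⟨hs0, hsε⟩
    rw [hlap] at h
    refine h.trans ?_
    rw [show -((d : ℝ) - 2 - 2 * s) / 2 = -((d : ℝ) / 2 - 1 - s) by ring]
    have := ha k
    gcongr

theorem AssumptionD.f_succ_eq (hD : AssumptionD C c₁ c₂ η ε L D R)
    {k : EuclideanSpace ℝ (Fin d)} (hk : k ∈ box d) {z : ℝ} (hz : 0 < z) (n : ℕ) :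
    R.f (n + 1) k z = z * (1 - aFun D k) * R.f n k z +
      ∑ m ∈ Finset.Icc 2 (n + 1), R.g m k z * R.f (n + 1 - m) k z + R.e (n + 1) k z := by
  rw [R.f_succ n k hk z hz, ← Finset.add_sum_Ioc_eq_sum_Icc (by omega), hD.g_one_eq hk hz]
  rfl

theorem zeroSeq (hD : AssumptionD C c₁ c₂ η ε L D R) (hL : 0 < L) {s c₀ c z : ℝ} {N : ℕ}
    (hc : c₀ ≤ c) (hc0 : 0 ≤ c) (hz : 0 < z) (H : CoeffBounds s c₀ L D R N z)
    (hcrit : ∀ n < N, |z + ∑ m ∈ Finset.Icc 2 (n + 1), R.g m 0 z - 1| ≤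
      c * beta d L * ((n : ℝ) + 1) ^ (-((d : ℝ) / 2 - 1))) :
    ZeroSeq ((d : ℝ) / 2) c (beta d L) z N (fun n => R.f n 0 z) (fun n => R.g n 0 z)
      (fun n => R.e n 0 z) := by
  have hβ : 0 < beta d L := beta_pos hL
  refine ⟨R.f_zero 0 zero_mem_box z hz, fun n _ => ?_, fun m h2 hm => ?_, fun m h1 hm => ?_, hcrit⟩
  · rw [hD.f_succ_eq zero_mem_box hz, aFun_zero hD.normalised]; ring
  · refine (H.g_le m h2 hm 0 zero_mem_box).trans ?_
    gcongr
  · rcases h1.eq_or_lt with h1 | h1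
    · rw [← h1, hD.e_one 0 zero_mem_box z hz]; simp; positivity
    · refine (H.e_le m h1 hm 0 zero_mem_box).trans ?_
      gcongr

theorem pointSeq (hD : AssumptionD C c₁ c₂ η ε L D R) (hL : 0 < L) {δ s c₀ c z v : ℝ} {N : ℕ}
    (hc₀ : 0 ≤ c₀) (hc : 2 * c₀ ≤ c) (hz : 0 < z) (H : CoeffBounds s c₀ L D R N z)
    (hdrift : ∀ n < N, |z - ∑ m ∈ Finset.Icc 2 (n + 1), lapRatio D R z m -
      v * (1 + ∑ m ∈ Finset.Icc 2 (n + 1), ((m : ℝ) - 1) * R.g m 0 z)| ≤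
      c * beta d L * ((n : ℝ) + 1) ^ (-δ)) {k : EuclideanSpace ℝ (Fin d)} (hk : k ∈ box d) :
    PointSeq ((d : ℝ) / 2) δ s c (beta d L) z v (aFun D k) N (fun n => R.g n 0 z)
      (fun n => R.e n 0 z) (fun n => R.f n k z) (fun n => R.g n k z) (fun n => R.e n k z)
      (lapRatio D R z) := by
  have hβ : 0 < beta d L := beta_pos hL
  have ha : 0 ≤ aFun D k := aFun_nonneg hD.nonneg hD.normalised k
  have hcc : c₀ ≤ c := by linarith
  have hc0 : 0 ≤ c := by linarith
  refine ⟨ha, R.f_zero k hk z hz, fun n _ => hD.f_succ_eq hk hz n, fun m h2 hm => ?_,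
    fun m h1 hm => ?_, fun m h2 hm => ?_, fun m h2 hm => ?_, fun m h1 hm => ?_, hdrift⟩
  · refine (H.g_le m h2 hm k hk).trans ?_
    gcongr
  · rcases h1.eq_or_lt with h1 | h1
    · rw [← h1, hD.e_one k hk z hz]; simp; positivity
    · refine (H.e_le m h1 hm k hk).trans ?_
      gcongr
  · have h1 := H.taylor_zero m h2 hm k hk
    have h3 := H.lap_le m h2 hm
    have h4 : |aFun D k * lapRatio D R z m| ≤
        c₀ * beta d L * aFun D k * (m : ℝ) ^ (-((d : ℝ) / 2 - 1)) := by
      rw [abs_mul, abs_of_nonneg ha]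
      calc _ ≤ aFun D k * (c₀ * beta d L * (m : ℝ) ^ (-((d : ℝ) / 2 - 1))) := by gcongr
        _ = _ := by ring
    calc |R.g m k z - R.g m 0 z| = |(R.g m k z - R.g m 0 z - aFun D k * lapRatio D R z m) +
          aFun D k * lapRatio D R z m| := by congr 1; ring
      _ ≤ 2 * c₀ * beta d L * aFun D k * (m : ℝ) ^ (-((d : ℝ) / 2 - 1)) := by
          refine (abs_add_le _ _).trans ((add_le_add h1 h4).trans (le_of_eq ?_)); ring
      _ ≤ _ := by gcongr
  · refine (H.taylor m h2 hm k hk).trans ?_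
    gcongr
  · rcases h1.eq_or_lt with h1 | h1
    · rw [← h1, hD.e_one k hk z hz, hD.e_one 0 zero_mem_box z hz]; simp; positivity
    · refine (H.e_diff m h1 hm k hk).trans ?_
      gcongr

end LaceRecursion

namespace LaceRecursion

variable {d : ℕ} {D : (Fin d → ℤ) → ℝ} {R : Recursion d} {C c₁ c₂ η ε L : ℝ}
  {δ s γ c z v K K₄ : ℝ} {N : ℕ}

/-- The recursion at a fixed `z` up to the index `N`, near criticality, with its diffusion
constant `v`. -/
structure Regular (δ s c L : ℝ) (D : (Fin d → ℤ) → ℝ) (R : Recursion d) (v : ℝ) (N : ℕ) (z : ℝ) :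
    Prop where
  zero : ZeroSeq ((d : ℝ) / 2) c (beta d L) z N (fun n => R.f n 0 z) (fun n => R.g n 0 z)
    (fun n => R.e n 0 z)
  point : ∀ k ∈ box d, PointSeq ((d : ℝ) / 2) δ s c (beta d L) z v (aFun D k) N
    (fun n => R.g n 0 z) (fun n => R.e n 0 z) (fun n => R.f n k z) (fun n => R.g n k z)
    (fun n => R.e n k z) (lapRatio D R z)

namespace Regular

theorem abs_f_sub_le (H : Regular δ s c L D R v N z) (E : Exponents ((d : ℝ) / 2) δ s γ)
    (hc : 1 ≤ c) (hL : 0 < L) (hsmall : c * beta d L * smallConst ((d : ℝ) / 2) δ s ≤ 1)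
    {m : ℕ} (hm : 1 ≤ m) (hmN : m ≤ N) {k : EuclideanSpace ℝ (Fin d)} (hk : k ∈ box d)
    (ha : aFun D k ≤ γ * logRatio m) :
    |R.f m k z - R.f m 0 z| ≤ 5 / 2 * m * aFun D k := by
  obtain ⟨n, rfl⟩ : ∃ n, m = n + 1 := ⟨m - 1, by omega⟩
  have hβ : 0 < beta d L := beta_pos hL
  have hcβ : 0 < c * beta d L := by positivity
  push_cast at ha ⊢
  have hn1 : (1 : ℝ) ≤ (n : ℝ) + 1 := by linarith [(Nat.cast_nonneg n : (0 : ℝ) ≤ n)]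
  have P := H.point k hk
  have HR := (P.abs_rate_sub_le E H.zero hc hβ hsmall n hmN ha).2
  have h1 := HR.one_sub_mem P.a_nonneg (E.le_quarter hn1 ha) le_rfl
  have h2 := H.zero.mem_Icc E.two_lt hc hβ (E.two_rpow_mul_zetaSum_small hcβ hsmall) hmN
  simp only [mem_Icc] at h1 h2
  push_cast at h1
  have hp : 0 < R.f (n + 1) 0 z := by linarith [h2.1]
  have e : R.f (n + 1) k z - R.f (n + 1) 0 z =
      -(R.f (n + 1) 0 z * (1 - R.f (n + 1) k z / R.f (n + 1) 0 z)) := by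
    field_simp; ring
  rw [e, abs_neg, abs_of_nonneg (mul_nonneg hp.le h1.1)]
  calc _ ≤ 5 / 4 * (2 * aFun D k * ((n : ℝ) + 1)) :=
        mul_le_mul h2.2 h1.2 h1.1 (by norm_num)
    _ = _ := by ring

theorem fBounds (H : Regular δ s c L D R v N z) (hS : AssumptionS R)
    (hD : AssumptionD C c₁ c₂ η ε L D R) (hd : 0 < d) (hL : 1 ≤ L) (hc₁ : 0 < c₁) (hη : 0 < η)
    (E : Exponents ((d : ℝ) / 2) δ s γ) (hγη : γ ≤ η)
    (hc : 1 ≤ c) (hsmall : c * beta d L * smallConst ((d : ℝ) / 2) δ s ≤ 1) (hz : 0 < z)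
    (hK₄ : 0 ≤ K₄)
    (htail : ∀ k ∈ box d, ∀ n < N, γ * logRatio ((n : ℝ) + 1) < aFun D k →
      |R.f (n + 1) k z| ≤ K₄ * (aFun D k ^ (-((d : ℝ) / 2 - γ / 8)) *
        ((n : ℝ) + 1) ^ (-((d : ℝ) / 2))))
    (hK : 3 ≤ K) (hK' : normConst d C c₁ η (γ / 8) K₄ ≤ K) {m : ℕ} (hm : 1 ≤ m) (hmN : m ≤ N) :
    FBounds L D R K m z := by
  have hL0 : 0 < L := by linarith
  have hβ : 0 < beta d L := beta_pos hL0
  have hcβ : 0 < c * beta d L := by positivity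
  have ha0 : ∀ k, 0 ≤ aFun D k := fun k => aFun_nonneg hD.nonneg hD.normalised k
  have hσ := hD.sigmaSq_pos hS hd hL hc₁
  have hm1 : (1 : ℝ) ≤ m := by exact_mod_cast hm
  obtain ⟨n, rfl⟩ : ∃ n, m = n + 1 := ⟨m - 1, by omega⟩
  refine ⟨?_, ?_, ?_⟩
  · have h1 : normOne (fun k => Dhat D k ^ 2 * R.f (n + 1) k z) ≤
        ENNReal.ofReal (normConst d C c₁ η (γ / 8) K₄ * beta d L *
          ((n : ℝ) + 1) ^ (-((d : ℝ) / 2))) := by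
      push_cast at hm1
      have hγ := E.γ_pos
      have hγ' := E.γ_le
      have htwo := E.two_lt
      refine hD.normOne_le hd hL hc₁ hη (by linarith) (by linarith) hK₄ hm1 ?_ ?_
      · intro k hk _
        have t0 : 0 ≤ K₄ * (aFun D k ^ (-((d : ℝ) / 2 - γ / 8)) *
            ((n : ℝ) + 1) ^ (-((d : ℝ) / 2))) := by
          have := ha0 k; positivity
        rcases le_or_gt (aFun D k) (γ * logRatio ((n : ℝ) + 1)) with h | h
        · have h2 := ((H.point k hk).abs_le_exp E H.zero hc hβ hsmall hmN h).1
          have := Real.exp_pos (-(aFun D k * ((n : ℝ) + 1)) / 2)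
          linarith
        · have := Real.exp_pos (-(aFun D k * ((n : ℝ) + 1)) / 2)
          linarith [htail k hk n hmN h]
      · intro k hk hak
        apply htail k hk n hmN
        have := logRatio_le_one hm1
        nlinarith
    refine h1.trans (ENNReal.ofReal_le_ofReal ?_)
    push_cast
    rw [neg_div]
    gcongr
  · have h2 := H.zero.mem_Icc E.two_lt hc hβ (E.two_rpow_mul_zetaSum_small hcβ hsmall) hmN
    simp only [mem_Icc] at h2
    rw [abs_of_nonneg (by linarith [h2.1])]
    linarith [h2.2]
  · set i : Fin d := ⟨0, hd⟩
    have t1 := (tendsto_laplacian (hS.smooth (n + 1) hm z hz) (hS.symm_f (n + 1) hm z hz) i).abs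
    have t2 := (hD.tendsto_aFun_single hS i).const_mul (5 / 2 * ((n + 1 : ℕ) : ℝ))
    have t3 := hD.tendsto_aFun_zero hS i
    have hev : ∀ᶠ t in 𝓝[≠] (0 : ℝ), aFun D (t • EuclideanSpace.single i 1) <
        γ * logRatio ((n + 1 : ℕ) : ℝ) :=
      t3.eventually_lt_const (mul_pos E.γ_pos (logRatio_pos hm1))
    have h := le_of_tendsto_of_tendsto t1 t2 (by
      filter_upwards [hev, eventually_abs_le_one] with t h1 h2
      have h3 := H.abs_f_sub_le E hc hL0 hsmall hm hmN (smul_single_mem_box h2 i) h1.le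
      rw [abs_div, abs_of_nonneg (sq_nonneg t), ← mul_div_assoc]
      gcongr)
    have hd' : (0 : ℝ) < 2 * d := by positivity
    rw [abs_div, abs_of_pos hd', ← mul_div_assoc, div_le_div_iff_of_pos_right hd'] at h
    refine h.trans ?_
    have : (0 : ℝ) ≤ ((n + 1 : ℕ) : ℝ) * sigmaSq D := by positivity
    nlinarith

end Regular

end LaceRecursion

namespace LaceRecursion

theorem mul_rpow_neg_succ_le {p x : ℝ} (hp : 0 ≤ p) (hx : 0 < x) :
    p * (x + 1) ^ (-(p + 1)) ≤ x ^ (-p) - (x + 1) ^ (-p) := by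
  have hx1 : 0 < x + 1 := by linarith
  have hq : 0 < (x + 1) / x := by positivity
  have h1 : x ^ (-p) = (x + 1) ^ (-p) * ((x + 1) / x) ^ p := by
    rw [Real.div_rpow hx1.le hx.le, Real.rpow_neg hx.le, Real.rpow_neg hx1.le]
    have : (x + 1) ^ p ≠ 0 := by positivity
    field_simp
  have h2 : 1 + p * (x + 1)⁻¹ ≤ ((x + 1) / x) ^ p := by
    have h3 := Real.one_sub_inv_le_log_of_pos hq
    have h4 : 1 - ((x + 1) / x)⁻¹ = (x + 1)⁻¹ := by field_simp; ring
    rw [h4] at h3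
    rw [Real.rpow_def_of_pos hq]
    have h5 := Real.add_one_le_exp (Real.log ((x + 1) / x) * p)
    nlinarith
  have h4 : (x + 1) ^ (-(p + 1)) = (x + 1) ^ (-p) * (x + 1)⁻¹ := by
    rw [neg_add, Real.rpow_add hx1, Real.rpow_neg_one]
  rw [h1, h4]
  have : 0 < (x + 1) ^ (-p) := by positivity
  nlinarith

/-- `z + ∑_{m=2}^n g_m(z) - 1`. -/
noncomputable def critFun (G : ℕ → ℝ → ℝ) (n : ℕ) (z : ℝ) : ℝ :=
  z + ∑ m ∈ Finset.Icc 2 n, G m z - 1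

/-- A stage of the approximation of the critical point by nested intervals. -/
structure CritInterval (θ b : ℝ) (G : ℕ → ℝ → ℝ) (Q : ℕ → ℝ → Prop) (n : ℕ) (x y : ℝ) : Prop where
  lt : x < y
  subset : Icc x y ⊆ Icc (1 - b) (1 + b)
  left : critFun G n x = -(b * (n : ℝ) ^ (-(θ - 1)))
  right : critFun G n y = b * (n : ℝ) ^ (-(θ - 1))
  abs_critFun_le : ∀ z ∈ Icc x y, ∀ j, 1 ≤ j → j ≤ n → |critFun G j z| ≤ b * (j : ℝ) ^ (-(θ - 1))
  prop : ∀ z ∈ Icc x y, ∀ m, 1 ≤ m → m ≤ n → Q m z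

section Crit

variable {θ b : ℝ} {G : ℕ → ℝ → ℝ} {Q : ℕ → ℝ → Prop}

theorem CritInterval.exists_succ (hθ : 2 < θ) (hb : 0 < b) (hbZ : b * zetaSum (θ - 1) < 1)
    (hG : ∀ n x y, x < y → Icc x y ⊆ Icc (1 - b) (1 + b) →
      (∀ z ∈ Icc x y, ∀ m, 1 ≤ m → m ≤ n → Q m z) → ∀ z ∈ Icc x y, ∀ m, 2 ≤ m → m ≤ n + 1 →
      |G m z| ≤ b * (m : ℝ) ^ (-θ) ∧ DifferentiableAt ℝ (G m) z ∧
      |deriv (G m) z| ≤ b * (m : ℝ) ^ (-(θ - 1)))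
    (hQ : ∀ n x y, x < y → Icc x y ⊆ Icc (1 - b) (1 + b) →
      (∀ z ∈ Icc x y, ∀ m, 1 ≤ m → m ≤ n → Q m z) → ∀ z ∈ Icc x y,
      (∀ j, 1 ≤ j → j ≤ n + 1 → |critFun G j z| ≤ b * (j : ℝ) ^ (-(θ - 1))) →
      ∀ m, 1 ≤ m → m ≤ n + 1 → Q m z)
    {n : ℕ} (hn : 1 ≤ n) {x y : ℝ} (H : CritInterval θ b G Q n x y) :
    ∃ x' y', CritInterval θ b G Q (n + 1) x' y' ∧ Icc x' y' ⊆ Icc x y := by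
  have hn0 : (0 : ℝ) < n := by exact_mod_cast hn
  have hG' := hG n x y H.lt H.subset H.prop
  have hstep : ∀ z, critFun G (n + 1) z = critFun G n z + G (n + 1) z := by
    intro z
    rw [critFun, critFun, Finset.sum_Icc_succ_top (by omega)]
    ring
  have hgap : b * ((n : ℝ) + 1) ^ (-θ) ≤
      b * (n : ℝ) ^ (-(θ - 1)) - b * ((n : ℝ) + 1) ^ (-(θ - 1)) := by
    have h1 := mul_rpow_neg_succ_le (by linarith : 0 ≤ θ - 1) hn0
    rw [show θ - 1 + 1 = θ by ring] at h1
    have h2 : 0 < ((n : ℝ) + 1) ^ (-θ) := by positivity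
    rw [← mul_sub]
    gcongr
    nlinarith
  have hend : ∀ z ∈ Icc x y, |G (n + 1) z| ≤ b * ((n : ℝ) + 1) ^ (-θ) := by
    intro z hz
    have := (hG' z hz (n + 1) (by omega) le_rfl).1
    push_cast at this
    exact this
  set r := b * ((n : ℝ) + 1) ^ (-(θ - 1)) with hr
  have hr0 : 0 < r := by positivity
  have hx : critFun G (n + 1) x ≤ -r := by
    rw [hstep, H.left]
    have := (abs_le.1 (hend x ⟨le_rfl, H.lt.le⟩)).2
    linarith
  have hy : r ≤ critFun G (n + 1) y := by
    rw [hstep, H.right]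
    have := (abs_le.1 (hend y ⟨H.lt.le, le_rfl⟩)).1
    linarith
  have hder : ∀ z ∈ Icc x y, HasDerivAt (critFun G (n + 1))
      (1 + ∑ m ∈ Finset.Icc 2 (n + 1), deriv (G m) z) z := by
    intro z hz
    refine ((hasDerivAt_id z).add (HasDerivAt.fun_sum fun m hm => ?_)).sub_const 1
    rw [Finset.mem_Icc] at hm
    exact (hG' z hz m hm.1 hm.2).2.1.hasDerivAt
  have hcont : ContinuousOn (critFun G (n + 1)) (Icc x y) :=
    fun z hz => (hder z hz).continuousAt.continuousWithinAt
  have hmono : StrictMonoOn (critFun G (n + 1)) (Icc x y) := by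
    refine strictMonoOn_of_deriv_pos (convex_Icc x y) hcont fun z hz => ?_
    have hz' := interior_subset hz
    rw [(hder z hz').deriv]
    have : |∑ m ∈ Finset.Icc 2 (n + 1), deriv (G m) z| ≤ b * zetaSum (θ - 1) := by
      calc _ ≤ ∑ m ∈ Finset.Icc 2 (n + 1), b * (m : ℝ) ^ (-(θ - 1)) := by
            refine (Finset.abs_sum_le_sum_abs _ _).trans (Finset.sum_le_sum fun m hm => ?_)
            rw [Finset.mem_Icc] at hm
            exact (hG' z hz' m hm.1 hm.2).2.2
        _ ≤ _ := by
            rw [← Finset.mul_sum]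
            gcongr
            exact sum_rpow_le_zetaSum (by linarith) _
    linarith [(abs_le.1 this).1]
  have ivt := intermediate_value_Icc H.lt.le hcont
  obtain ⟨x', hx', hx'e⟩ := ivt ⟨hx, by linarith⟩
  obtain ⟨y', hy', hy'e⟩ := ivt ⟨by linarith, hy⟩
  have hlt : x' < y' := by
    rw [← hmono.lt_iff_lt hx' hy', hx'e, hy'e]
    linarith
  have hsub : Icc x' y' ⊆ Icc x y := Icc_subset_Icc hx'.1 hy'.2
  have habs : ∀ z ∈ Icc x' y', ∀ j, 1 ≤ j → j ≤ n + 1 →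
      |critFun G j z| ≤ b * (j : ℝ) ^ (-(θ - 1)) := by
    intro z hz j hj hjn
    rcases Nat.le_succ_iff.1 hjn with h | h
    · exact H.abs_critFun_le z (hsub hz) j hj h
    · subst h
      push_cast
      have h1 := hmono.monotoneOn hx' (hsub hz) hz.1
      have h2 := hmono.monotoneOn (hsub hz) hy' hz.2
      rw [hx'e] at h1
      rw [hy'e] at h2
      exact abs_le.2 ⟨h1, h2⟩
  refine ⟨x', y', ⟨hlt, hsub.trans H.subset, ?_, ?_, habs, ?_⟩, hsub⟩
  · rw [hx'e, hr]; push_cast; rfl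
  · rw [hy'e, hr]; push_cast; rfl
  · exact fun z hz => hQ n x y H.lt H.subset H.prop z (hsub hz) (habs z hz)

theorem exists_critical (hθ : 2 < θ) (hb : 0 < b) (hbZ : b * zetaSum (θ - 1) < 1)
    (hG : ∀ n x y, x < y → Icc x y ⊆ Icc (1 - b) (1 + b) →
      (∀ z ∈ Icc x y, ∀ m, 1 ≤ m → m ≤ n → Q m z) → ∀ z ∈ Icc x y, ∀ m, 2 ≤ m → m ≤ n + 1 →
      |G m z| ≤ b * (m : ℝ) ^ (-θ) ∧ DifferentiableAt ℝ (G m) z ∧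
      |deriv (G m) z| ≤ b * (m : ℝ) ^ (-(θ - 1)))
    (hQ : ∀ n x y, x < y → Icc x y ⊆ Icc (1 - b) (1 + b) →
      (∀ z ∈ Icc x y, ∀ m, 1 ≤ m → m ≤ n → Q m z) → ∀ z ∈ Icc x y,
      (∀ j, 1 ≤ j → j ≤ n + 1 → |critFun G j z| ≤ b * (j : ℝ) ^ (-(θ - 1))) →
      ∀ m, 1 ≤ m → m ≤ n + 1 → Q m z) :
    ∃ z, ∀ n, 1 ≤ n → ∃ x y, z ∈ Icc x y ∧ CritInterval θ b G Q n x y := by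
  have hbase : CritInterval θ b G Q 1 (1 - b) (1 + b) := by
    have h1 : ∀ z ∈ Icc (1 - b) (1 + b), ∀ j, 1 ≤ j → j ≤ 1 →
        |critFun G j z| ≤ b * (j : ℝ) ^ (-(θ - 1)) := by
      intro z hz j hj hj'
      obtain rfl : j = 1 := by omega
      simp only [critFun, Nat.cast_one, Real.one_rpow, mul_one]
      rw [Finset.Icc_eq_empty (by norm_num), Finset.sum_empty, add_zero]
      exact abs_le.2 ⟨by linarith [hz.1], by linarith [hz.2]⟩
    refine ⟨by linarith, subset_rfl, ?_, ?_, h1, fun z hz => ?_⟩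
    · simp [critFun]
    · simp [critFun]
    · exact hQ 0 (1 - b) (1 + b) (by linarith) subset_rfl (fun _ _ m h1 h2 => by omega) z hz
        (h1 z hz)
  have hsucc : ∀ (n : ℕ) (q : {q : ℝ × ℝ // CritInterval θ b G Q (n + 1) q.1 q.2}),
      ∃ q' : {q : ℝ × ℝ // CritInterval θ b G Q (n + 1 + 1) q.1 q.2},
        Icc q'.1.1 q'.1.2 ⊆ Icc q.1.1 q.1.2 := by
    rintro n ⟨⟨x, y⟩, H⟩
    obtain ⟨x', y', H', hs⟩ := H.exists_succ hθ hb hbZ hG hQ (by omega)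
    exact ⟨⟨(x', y'), H'⟩, hs⟩
  choose next hnext using hsucc
  let I : ∀ n : ℕ, {q : ℝ × ℝ // CritInterval θ b G Q (n + 1) q.1 q.2} :=
    fun n => Nat.rec ⟨(1 - b, 1 + b), hbase⟩ next n
  obtain ⟨z, hz⟩ := IsCompact.nonempty_iInter_of_sequence_nonempty_isCompact_isClosed
    (fun n => Icc (I n).1.1 (I n).1.2) (fun n => hnext n (I n))
    (fun n => nonempty_Icc.2 (I n).2.lt.le) isCompact_Icc (fun n => isClosed_Icc)
  rw [mem_iInter] at hz
  refine ⟨z, fun n hn => ?_⟩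
  obtain ⟨j, rfl⟩ : ∃ j, n = j + 1 := ⟨n - 1, by omega⟩
  exact ⟨_, _, hz j, (I j).2⟩

end Crit

variable {d : ℕ} {D : (Fin d → ℤ) → ℝ} {R : Recursion d} {C c₁ c₂ η ε L : ℝ}
  {δ s γ c z v K K₄ : ℝ} {N : ℕ}

/-- The constant in `Regular`, in terms of the constant in `CoeffBounds`. -/
noncomputable def regConst (θ δ c : ℝ) : ℝ := (2 + 5 * zetaSum (θ - 1 - δ)) * c

theorem Exponents.two_mul_le_regConst {θ : ℝ} (E : Exponents θ δ s γ) (hc : 1 ≤ c) :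
    2 * c ≤ regConst θ δ c := by
  have := E.one_le_zetaSum_sub_one_sub
  unfold regConst
  gcongr
  linarith

theorem Exponents.mul_zetaSum_le {θ x : ℝ} (E : Exponents θ δ s γ) (hx : 0 < x)
    (h : x * smallConst θ δ s ≤ 1) : x * zetaSum (θ - 1) ≤ 1 / 2 := by
  have h1 := E.two_rpow_mul_zetaSum_small hx h
  have h2 := E.one_le_zetaSum_sub_one
  have h2θ : (1 : ℝ) ≤ 2 ^ θ := Real.one_le_rpow (by norm_num) (by linarith [E.two_lt])
  have h3 : 0 < x * zetaSum (θ - 1) := by positivity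
  nlinarith

theorem CoeffBounds.exists_regular (H : CoeffBounds s c L D R N z)
    (hD : AssumptionD C c₁ c₂ η ε L D R) (E : Exponents ((d : ℝ) / 2) δ s γ) (hc : 1 ≤ c)
    (hL : 1 ≤ L)
    (hsmall : regConst ((d : ℝ) / 2) δ c * beta d L * smallConst ((d : ℝ) / 2) δ s ≤ 1)
    (hz : |z - 1| ≤ 1 / 2)
    (hcrit : ∀ j, 1 ≤ j → j ≤ N → |critFun (fun m z => R.g m 0 z) j z| ≤
      c * beta d L * (j : ℝ) ^ (-((d : ℝ) / 2 - 1))) :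
    ∃ v ∈ Icc (-4 : ℝ) 4, Regular δ s (regConst ((d : ℝ) / 2) δ c) L D R v N z := by
  have hL0 : 0 < L := by linarith
  have hβ : 0 < beta d L := beta_pos hL0
  have hcc := E.two_mul_le_regConst hc
  have hZ := E.one_le_zetaSum_sub_one_sub
  have hz' := abs_le.1 hz
  have hs1 : c * beta d L * zetaSum ((d : ℝ) / 2 - 1) ≤ 1 / 2 := by
    refine le_trans ?_ (E.mul_zetaSum_le (mul_pos (by linarith) hβ) hsmall)
    have := E.one_le_zetaSum_sub_one
    gcongr
    linarith
  obtain ⟨v, hv, hdrift⟩ := exists_drift E.δ_pos.le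
    (by linarith [E.δ_lt, E.s_lt] : 2 < (d : ℝ) / 2 - δ)
    (by linarith : 0 ≤ c) hβ.le (abs_le.2 ⟨by linarith, by linarith⟩ : |z| ≤ 3 / 2) hs1 H.lap_le
    (fun m h2 hm => H.g_le m h2 hm 0 zero_mem_box)
  refine ⟨v, hv, ?_, fun k hk => ?_⟩
  · refine zeroSeq hD hL0 (by linarith) (by linarith) (by linarith) H fun n hn => ?_
    have h1 := hcrit (n + 1) (by omega) hn
    push_cast at h1
    refine h1.trans ?_
    gcongr
    linarith
  · refine pointSeq hD hL0 (by linarith) hcc (by linarith) H (fun n hn => ?_) hk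
    refine (hdrift n hn).trans ?_
    gcongr
    unfold regConst
    linarith

end LaceRecursion

namespace LaceRecursion

variable {d : ℕ} {D : (Fin d → ℤ) → ℝ} {R : Recursion d} {C c₁ c₂ η ε L : ℝ}
  {δ s γ c z v K K₄ : ℝ} {N : ℕ}

/-- Diffusion constants consistent up to each finite index have a common limit. -/
theorem Regular.exists_common {V : ℕ → ℝ} (hV : ∀ N, V N ∈ Icc (-4 : ℝ) 4)
    (H : ∀ N, Regular δ s c L D R (V N) N z) : ∃ v, ∀ N, Regular δ s c L D R v N z := by
  obtain ⟨v, -, φ, hφ, hlim⟩ := isCompact_Icc.tendsto_subseq hV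
  refine ⟨v, fun N => ⟨(H N).zero, fun k hk => ?_⟩⟩
  have P := (H N).point k hk
  refine ⟨P.a_nonneg, P.f_zero, P.f_succ, P.g_le, P.e_le, P.g_diff, P.g_taylor, P.e_diff,
    fun n hn => ?_⟩
  refine le_of_tendsto ((tendsto_const_nhds.sub (hlim.mul_const _)).abs) ?_
  filter_upwards [eventually_gt_atTop n] with M hM
  exact ((H (φ M)).point k hk).drift n (hM.trans_le (hφ.id_le M))

/-- The tail bound of the recursion, for coefficients bounded with constants `c` and `β`. -/
def TailBound (θ δ s γ η K c β : ℝ) : Prop :=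
  ∀ (z v a : ℝ) (N : ℕ) (f₀ g₀ e₀ f g e h : ℕ → ℝ), ZeroSeq θ c β z N f₀ g₀ e₀ →
    PointSeq θ δ s c β z v a N g₀ e₀ f g e h → a ≤ 2 - η →
    ∀ n < N, γ * logRatio ((n : ℝ) + 1) < a →
      |f (n + 1)| ≤ K * (a ^ (-(θ - γ / 8)) * ((n : ℝ) + 1) ^ (-θ))

theorem exists_critical_point {Ce Cg : ℝ → ℝ} {LE LG : ℝ → ℝ → ℝ} (hS : AssumptionS R)
    (hD : AssumptionD C c₁ c₂ η ε L D R) (hE : AssumptionE Ce LE L D R)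
    (hG : AssumptionG ε Cg LG L D R) (hd : 0 < d) (hc₁ : 0 < c₁) (hη : 0 < η) (hL : 1 ≤ L)
    (E : Exponents ((d : ℝ) / 2) δ s γ) (hsε : s ≤ ε) {η' : ℝ} (hγη : γ ≤ η) (hη' : η' ≤ η)
    (hLE : LE K (1 / 2) ≤ L) (hLG : LG K (1 / 2) ≤ L) (hK₄ : 0 ≤ K₄) (hK : 3 ≤ K)
    (hK' : normConst d C c₁ η (γ / 8) K₄ ≤ K) (hc : c = 1 + |Ce K| + |Cg K|)
    (hsmall : regConst ((d : ℝ) / 2) δ c * beta d L * smallConst ((d : ℝ) / 2) δ s ≤ 1)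
    (htail : TailBound ((d : ℝ) / 2) δ s γ η' K₄ (regConst ((d : ℝ) / 2) δ c) (beta d L)) :
    ∃ z v, |z - 1| ≤ c * beta d L ∧
      (∀ N, Regular δ s (regConst ((d : ℝ) / 2) δ c) L D R v N z) ∧
      ∀ m, 1 ≤ m → FBounds L D R K m z := by
  have hL0 : 0 < L := by linarith
  have hβ : 0 < beta d L := beta_pos hL0
  have hc1 : 1 ≤ c := by rw [hc]; linarith [abs_nonneg (Ce K), abs_nonneg (Cg K)]
  have hcc := E.two_mul_le_regConst hc1
  have hcβ : 0 < c * beta d L := by positivity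
  have hrβ : 0 < regConst ((d : ℝ) / 2) δ c * beta d L := mul_pos (by linarith) hβ
  have hle : c * beta d L ≤ regConst ((d : ℝ) / 2) δ c * beta d L := by gcongr; linarith
  have hb : c * beta d L ≤ 1 / 8 := hle.trans (E.le_one_eighth hrβ hsmall)
  have hbZ : c * beta d L * zetaSum ((d : ℝ) / 2 - 1) < 1 := by
    have h1 := E.mul_zetaSum_le hrβ hsmall
    have h2 : c * beta d L * zetaSum ((d : ℝ) / 2 - 1) ≤
        regConst ((d : ℝ) / 2) δ c * beta d L * zetaSum ((d : ℝ) / 2 - 1) := by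
      have := E.one_le_zetaSum_sub_one
      gcongr
    linarith
  have hα : (1 / 2 : ℝ) ∈ Ioo (0 : ℝ) 1 := by constructor <;> norm_num
  have hbox : Icc (1 - c * beta d L) (1 + c * beta d L) ⊆ Icc (1 - 1 / 2 : ℝ) (1 + 1 / 2) :=
    Icc_subset_Icc (by linarith) (by linarith)
  have hs0 : 0 ≤ s := by linarith [E.δ_pos, E.δ_lt]
  have hcb : ∀ n x y, x < y → Icc x y ⊆ Icc (1 - c * beta d L) (1 + c * beta d L) →
      (∀ w ∈ Icc x y, ∀ m, 1 ≤ m → m ≤ n → FBounds L D R K m w) → ∀ w ∈ Icc x y,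
      CoeffBounds s c L D R (n + 1) w := by
    intro n x y hxy hsub hF w hw
    rw [hc]
    exact coeffBounds hS hD hd hc₁ hL hE hG hs0 hsε (by linarith) hα hLE hLG hxy
      (hsub.trans hbox) hF hw
  have hreg : ∀ n x y, x < y → Icc x y ⊆ Icc (1 - c * beta d L) (1 + c * beta d L) →
      (∀ w ∈ Icc x y, ∀ m, 1 ≤ m → m ≤ n → FBounds L D R K m w) → ∀ w ∈ Icc x y,
      (∀ j, 1 ≤ j → j ≤ n + 1 → |critFun (fun m z => R.g m 0 z) j w| ≤
        c * beta d L * (j : ℝ) ^ (-((d : ℝ) / 2 - 1))) →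
      ∃ v ∈ Icc (-4 : ℝ) 4, Regular δ s (regConst ((d : ℝ) / 2) δ c) L D R v (n + 1) w := by
    intro n x y hxy hsub hF w hw hcrit
    have hw' := hsub hw
    exact (hcb n x y hxy hsub hF w hw).exists_regular hD E hc1 hL hsmall
      (abs_le.2 ⟨by linarith [hw'.1], by linarith [hw'.2]⟩) hcrit
  obtain ⟨z, hz⟩ := exists_critical (G := fun m z => R.g m 0 z) (Q := FBounds L D R K)
    E.two_lt hcβ hbZ
    (by
      intro n x y hxy hsub hF w hw m h2 hm
      have h := hG K (by linarith) (1 / 2) hα hLG x y hxy (hsub.trans hbox) n hF w hw m h2 hm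
      refine ⟨(hcb n x y hxy hsub hF w hw).g_le m h2 hm 0 zero_mem_box, h.2.2.2.1,
        h.2.2.2.2.1.trans ?_⟩
      rw [show -((d : ℝ) - 2) / 2 = -((d : ℝ) / 2 - 1) by ring]
      gcongr
      rw [hc]
      linarith [le_abs_self (Cg K), abs_nonneg (Ce K)])
    (by
      intro n x y hxy hsub hF w hw hcrit m h1 hm
      obtain ⟨v, -, H⟩ := hreg n x y hxy hsub hF w hw hcrit
      have hw' := hsub hw
      refine H.fBounds hS hD hd hL hc₁ hη E hγη (by linarith) hsmall (by linarith [hw'.1]) hK₄ ?_ hK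
        hK' h1 hm
      intro k hk n hn hlt
      exact htail _ _ _ _ _ _ _ _ _ _ _ H.zero (H.point k hk)
        (by linarith [hD.a_lt k hk]) n hn hlt)
  have hV : ∀ N, ∃ v ∈ Icc (-4 : ℝ) 4,
      Regular δ s (regConst ((d : ℝ) / 2) δ c) L D R v N z := by
    intro N
    obtain ⟨x, y, hzI, I⟩ := hz (N + 1) (by omega)
    obtain ⟨v, hv, H⟩ := hreg N x y I.lt I.subset
      (fun w hw m h1 h2 => I.prop w hw m h1 (by omega)) z hzI (I.abs_critFun_le z hzI)
    refine ⟨v, hv, ?_, fun k hk => ?_⟩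
    · have Z := H.zero
      exact ⟨Z.f_zero, fun n hn => Z.f_succ n (by omega), fun m h hm => Z.g_le m h (by omega),
        fun m h hm => Z.e_le m h (by omega), fun n hn => Z.crit n (by omega)⟩
    · have P := H.point k hk
      exact ⟨P.a_nonneg, P.f_zero, fun n hn => P.f_succ n (by omega),
        fun m h hm => P.g_le m h (by omega), fun m h hm => P.e_le m h (by omega),
        fun m h hm => P.g_diff m h (by omega), fun m h hm => P.g_taylor m h (by omega),
        fun m h hm => P.e_diff m h (by omega), fun n hn => P.drift n (by omega)⟩
  choose V hV1 hV2 using hV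
  obtain ⟨v, hv⟩ := Regular.exists_common hV1 hV2
  refine ⟨z, v, ?_, hv, fun m hm => ?_⟩
  · obtain ⟨x, y, hzI, I⟩ := hz 1 le_rfl
    have := I.subset hzI
    exact abs_le.2 ⟨by linarith [this.1], by linarith [this.2]⟩
  · obtain ⟨x, y, hzI, I⟩ := hz m hm
    exact I.prop z hzI m hm le_rfl

end LaceRecursion

namespace LaceRecursion

theorem sum_range_rpow_neg_le {δ : ℝ} (hδ : 0 ≤ δ) (hδ1 : δ < 1) (n : ℕ) :
    ∑ j ∈ Finset.range n, ((j : ℝ) + 1) ^ (-δ) ≤ (1 - δ)⁻¹ * (n : ℝ) ^ (1 - δ) := by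
  induction n with
  | zero => simp; positivity
  | succ n ih =>
    rw [Finset.sum_range_succ]
    push_cast
    have hn : (0 : ℝ) < (n : ℝ) + 1 := by positivity
    have hn0 : (0 : ℝ) ≤ n := by positivity
    have h1 : (n : ℝ) ^ (1 - δ) ≤ ((n : ℝ) + 1) ^ (1 - δ) * (1 - (1 - δ) * ((n : ℝ) + 1)⁻¹) := by
      have e : (n : ℝ) = ((n : ℝ) + 1) * (1 + -((n : ℝ) + 1)⁻¹) := by field_simp; ring
      have h2 : (-1 : ℝ) ≤ -((n : ℝ) + 1)⁻¹ := neg_le_neg (inv_le_one_of_one_le₀ (by linarith))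
      nth_rewrite 1 [e]
      rw [Real.mul_rpow hn.le (by linarith)]
      gcongr
      refine (rpow_one_add_le_one_add_mul_self h2 (by linarith) (by linarith)).trans ?_
      linarith
    have h3 : ((n : ℝ) + 1) ^ (1 - δ) * ((n : ℝ) + 1)⁻¹ = ((n : ℝ) + 1) ^ (-δ) := by
      rw [← Real.rpow_neg_one, ← Real.rpow_add hn]; congr 1; ring
    have h4 : 0 < 1 - δ := by linarith
    have h5 : (1 - δ)⁻¹ * (n : ℝ) ^ (1 - δ) ≤
        (1 - δ)⁻¹ * (((n : ℝ) + 1) ^ (1 - δ) * (1 - (1 - δ) * ((n : ℝ) + 1)⁻¹)) := by gcongr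
    have h6 : (1 - δ)⁻¹ * (((n : ℝ) + 1) ^ (1 - δ) * (1 - (1 - δ) * ((n : ℝ) + 1)⁻¹)) =
        (1 - δ)⁻¹ * ((n : ℝ) + 1) ^ (1 - δ) - ((n : ℝ) + 1) ^ (-δ) := by
      rw [← h3]; field_simp
    linarith

theorem sum_Ico_rpow_neg_le {p : ℝ} (hp : 0 < p) {n M : ℕ} (hn : 1 ≤ n) (hM : n ≤ M) :
    ∑ j ∈ Finset.Ico n M, ((j : ℝ) + 1) ^ (-(p + 1)) ≤ p⁻¹ * (n : ℝ) ^ (-p) := by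
  have h1 : ∑ j ∈ Finset.Ico n M, ((j : ℝ) + 1) ^ (-(p + 1)) ≤
      ∑ j ∈ Finset.Ico n M, p⁻¹ * (-(((j + 1 : ℕ) : ℝ) ^ (-p)) - -((j : ℝ) ^ (-p))) := by
    apply Finset.sum_le_sum
    intro j hj
    have hj0 : (0 : ℝ) < j := by exact_mod_cast hn.trans (Finset.mem_Ico.1 hj).1
    have := mul_rpow_neg_succ_le hp.le hj0
    push_cast
    rw [← div_eq_inv_mul, le_div_iff₀ hp]
    linarith
  refine h1.trans ?_
  rw [← Finset.mul_sum, Finset.sum_Ico_sub (fun j : ℕ => -((j : ℝ) ^ (-p))) hM]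
  gcongr
  have : (0 : ℝ) ≤ (M : ℝ) ^ (-p) := by positivity
  linarith

theorem abs_log_one_sub_add_le {w : ℝ} (h1 : w ≤ 1 / 2) :
    |Real.log (1 - w) + w| ≤ 2 * w ^ 2 := by
  have hp : 0 < 1 - w := by linarith
  have hu := Real.log_le_sub_one_of_pos hp
  have hl := Real.one_sub_inv_le_log_of_pos hp
  have h2 : (1 - w)⁻¹ ≤ 1 + w + 2 * w ^ 2 := by
    rw [inv_le_iff_one_le_mul₀ hp]
    nlinarith [mul_nonneg (sq_nonneg w) (by linarith : 0 ≤ 1 - 2 * w)]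
  exact abs_le.2 ⟨by linarith, by nlinarith⟩

namespace RatioSeq

variable {a : ℝ} {n : ℕ} {F w : ℕ → ℝ}

theorem abs_one_sub_sub_le (H : RatioSeq a n F w) (ha0 : 0 ≤ a) (ha : a ≤ 1 / 4) {u : ℝ}
    {ρ : ℕ → ℝ} (hw : ∀ j < n, |w j - u| ≤ ρ j) :
    |1 - F n - n * u| ≤ 4 * (a * n) ^ 2 + ∑ j ∈ Finset.range n, ρ j := by
  have h := H.sub_eq_sum (Nat.zero_le n)
  rw [H.F_zero, ← Finset.range_eq_Ico] at h
  have e : 1 - F n - n * u = ∑ j ∈ Finset.range n, (-(w j * (1 - F j)) + (w j - u)) := by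
    rw [h, Finset.sum_add_distrib, Finset.sum_sub_distrib, Finset.sum_const, Finset.card_range,
      nsmul_eq_mul, Finset.sum_neg_distrib]
    simp only [mul_sub, mul_one, Finset.sum_sub_distrib]
    ring
  rw [e]
  refine (Finset.abs_sum_le_sum_abs _ _).trans ?_
  calc _ ≤ ∑ j ∈ Finset.range n, (2 * a * (2 * a * n) + ρ j) := by
        apply Finset.sum_le_sum
        intro j hj
        have hj' := Finset.mem_range.1 hj
        refine (abs_add_le _ _).trans (add_le_add ?_ (hw j hj'))
        have h1 := H.one_sub_mem ha0 ha hj'.le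
        have h2 := H.le_w j hj'
        have h3 : (j : ℝ) ≤ n := by exact_mod_cast hj'.le
        have h4 : 1 - F j ≤ 2 * a * n := h1.2.trans (by gcongr)
        rw [abs_neg, abs_of_nonneg (mul_nonneg (by linarith) h1.1)]
        exact mul_le_mul (H.w_le j hj') h4 h1.1 (by linarith)
    _ = _ := by
        rw [Finset.sum_add_distrib, Finset.sum_const, Finset.card_range, nsmul_eq_mul]; ring

theorem abs_log_add_le (H : RatioSeq a n F w) (ha0 : 0 ≤ a) (ha : a ≤ 1 / 4) {u : ℝ}
    {ρ : ℕ → ℝ} (hw : ∀ j < n, |w j - u| ≤ ρ j) :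
    |Real.log (F n) + n * u| ≤ 8 * n * a ^ 2 + ∑ j ∈ Finset.range n, ρ j := by
  have e : ∀ m ≤ n, Real.log (F m) = ∑ j ∈ Finset.range m, Real.log (1 - w j) := by
    intro m
    induction m with
    | zero => simp [H.F_zero]
    | succ m ih =>
      intro hm
      have := H.w_le m hm
      rw [H.F_succ m hm, Real.log_mul (by linarith) (H.pos ha m (by omega)).ne',
        Finset.sum_range_succ, ih (by omega)]
      ring
  have e2 : Real.log (F n) + n * u =
      ∑ j ∈ Finset.range n, ((Real.log (1 - w j) + w j) - (w j - u)) := by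
    rw [e n le_rfl, Finset.sum_sub_distrib, Finset.sum_sub_distrib, Finset.sum_add_distrib,
      Finset.sum_const, Finset.card_range, nsmul_eq_mul]
    ring
  rw [e2]
  refine (Finset.abs_sum_le_sum_abs _ _).trans ?_
  calc _ ≤ ∑ j ∈ Finset.range n, (8 * a ^ 2 + ρ j) := by
        apply Finset.sum_le_sum
        intro j hj
        have hj' := Finset.mem_range.1 hj
        refine (abs_sub _ _).trans (add_le_add ?_ (hw j hj'))
        have h1 := H.w_le j hj'
        have h2 := H.le_w j hj'
        refine (abs_log_one_sub_add_le (by linarith)).trans ?_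
        nlinarith
    _ = _ := by
        rw [Finset.sum_add_distrib, Finset.sum_const, Finset.card_range, nsmul_eq_mul]; ring

end RatioSeq

variable {d : ℕ} {D : (Fin d → ℤ) → ℝ} {R : Recursion d} {C c₁ c₂ η ε L : ℝ}
  {δ s γ c z v : ℝ} {N : ℕ}

namespace Regular

theorem exists_amplitude (H : ∀ N, Regular δ s c L D R v N z) (E : Exponents ((d : ℝ) / 2) δ s γ)
    (hc : 1 ≤ c) (hL : 0 < L) (hsmall : c * beta d L * smallConst ((d : ℝ) / 2) δ s ≤ 1) :
    ∃ A, |A - 1| ≤ 4 * c * beta d L * zetaSum ((d : ℝ) / 2 - 1) ∧ 3 / 4 ≤ A ∧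
      ∃ B, ∀ n : ℕ, 1 ≤ n → |R.f n 0 z - A| ≤ B * (n : ℝ) ^ (-((d : ℝ) / 2 - 2)) := by
  have hβ : 0 < beta d L := beta_pos hL
  have s1 := E.two_rpow_mul_zetaSum_small (by positivity : 0 < c * beta d L) hsmall
  have htwo := E.two_lt
  have hmem : ∀ n, R.f n 0 z ∈ Icc (3 / 4 : ℝ) (5 / 4) := fun n =>
    (H n).zero.mem_Icc htwo hc hβ s1 le_rfl
  obtain ⟨A, hA, φ, hφ, hlim⟩ := isCompact_Icc.tendsto_subseq hmem
  refine ⟨A, ?_, hA.1, 4 * c * beta d L * ((d : ℝ) / 2 - 2)⁻¹, fun n hn => ?_⟩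
  · exact le_of_tendsto (hlim.sub_const 1).abs (Eventually.of_forall fun m =>
      (H (φ m)).zero.abs_sub_one_le htwo hc hβ s1 le_rfl)
  · refine le_of_tendsto (tendsto_const_nhds.sub hlim).abs ?_
    filter_upwards [eventually_ge_atTop n] with M hM
    have hM' : n ≤ φ M := hM.trans (hφ.id_le M)
    refine (abs_sub_le_sum_Ico (fun n => R.f n 0 z) hM').trans ?_
    calc _ ≤ ∑ j ∈ Finset.Ico n (φ M), 4 * c * beta d L *
          ((j : ℝ) + 1) ^ (-(((d : ℝ) / 2 - 2) + 1)) := by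
          apply Finset.sum_le_sum
          intro j hj
          have h1 := (H (φ M)).zero.increment_le htwo hc hβ s1 j (Finset.mem_Ico.1 hj).2
          rwa [show (d : ℝ) / 2 - 1 = (d : ℝ) / 2 - 2 + 1 by ring] at h1
      _ ≤ _ := by
          rw [← Finset.mul_sum, mul_assoc _ ((d : ℝ) / 2 - 2)⁻¹]
          gcongr
          exact sum_Ico_rpow_neg_le (by linarith) hn hM'

/-- The decay rates in the Gaussian region. -/
theorem ratioSeq (H : ∀ N, Regular δ s c L D R v N z) (E : Exponents ((d : ℝ) / 2) δ s γ)
    (hc : 1 ≤ c) (hL : 0 < L) (hsmall : c * beta d L * smallConst ((d : ℝ) / 2) δ s ≤ 1)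
    {n : ℕ} (hn : 1 ≤ n) {k : EuclideanSpace ℝ (Fin d)} (hk : k ∈ box d)
    (ha : aFun D k ≤ γ * logRatio n) :
    RatioSeq (aFun D k) n (fun j => R.f j k z / R.f j 0 z)
      (rate (fun j => R.f j 0 z) (fun j => R.f j k z)) ∧
    ∀ j < n, |rate (fun j => R.f j 0 z) (fun j => R.f j k z) j - v * aFun D k| ≤
      rateConst ((d : ℝ) / 2) δ s * c * beta d L * aFun D k * ((j : ℝ) + 1) ^ (-δ) := by
  have hβ : 0 < beta d L := beta_pos hL
  have key : ∀ j < n, aFun D k ≤ γ * logRatio ((j : ℝ) + 1) := by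
    intro j hj
    refine ha.trans (mul_le_mul_of_nonneg_left (logRatio_anti ?_ ?_) E.γ_pos.le)
    · linarith [(Nat.cast_nonneg j : (0 : ℝ) ≤ j)]
    · exact_mod_cast hj
  refine ⟨?_, fun j hj => ?_⟩
  · have h1 := (((H n).point k hk).abs_rate_sub_le E (H n).zero hc hβ hsmall (n - 1) (by omega)
      (key _ (by omega))).2
    rwa [Nat.sub_add_cancel hn] at h1
  · exact (((H n).point k hk).abs_rate_sub_le E (H n).zero hc hβ hsmall j hj (key _ hj)).1

theorem sum_rate_le {M a : ℝ} (E : Exponents ((d : ℝ) / 2) δ s γ) (hM : 0 ≤ M) (ha : 0 ≤ a)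
    (n : ℕ) : ∑ j ∈ Finset.range n, M * a * ((j : ℝ) + 1) ^ (-δ) ≤
      M * (1 - δ)⁻¹ * (a * (n : ℝ) ^ (1 - δ)) := by
  rw [← Finset.mul_sum]
  calc _ ≤ M * a * ((1 - δ)⁻¹ * (n : ℝ) ^ (1 - δ)) := by
        gcongr
        exact sum_range_rpow_neg_le E.δ_pos.le (by linarith [E.δ_lt, E.s_lt_one]) n
    _ = _ := by ring

/-- The second moment. -/
theorem abs_laplacian_div_sub_le (H : ∀ N, Regular δ s c L D R v N z) (hS : AssumptionS R)
    (hD : AssumptionD C c₁ c₂ η ε L D R) (hd : 0 < d) (E : Exponents ((d : ℝ) / 2) δ s γ)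
    (hc : 1 ≤ c) (hL : 0 < L) (hsmall : c * beta d L * smallConst ((d : ℝ) / 2) δ s ≤ 1)
    (hz : 0 < z) {n : ℕ} (hn : 1 ≤ n) :
    |-(Laplacian.laplacian (fun k => R.f n k z) 0) / R.f n 0 z - v * sigmaSq D * n| ≤
      rateConst ((d : ℝ) / 2) δ s * c * beta d L * (1 - δ)⁻¹ *
        (sigmaSq D * (n : ℝ) ^ (1 - δ)) := by
  have hβ : 0 < beta d L := beta_pos hL
  have hn1 : (1 : ℝ) ≤ n := by exact_mod_cast hn
  have hf := (H n).zero.mem_Icc E.two_lt hc hβ (E.two_rpow_mul_zetaSum_small (by positivity) hsmall) le_rfl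
  simp only [mem_Icc] at hf
  have hp : 0 < R.f n 0 z := by linarith [hf.1]
  set M := rateConst ((d : ℝ) / 2) δ s * c * beta d L with hM
  have hM0 : 0 ≤ M := by have := E.rateConst_pos; positivity
  set i : Fin d := ⟨0, hd⟩
  have t1 := (tendsto_laplacian (hS.smooth n hn z hz) (hS.symm_f n hn z hz) i).neg.div_const
    (R.f n 0 z)
  have ta := hD.tendsto_aFun_single hS i
  have t0 := hD.tendsto_aFun_zero hS i
  have t2 := (t1.sub (ta.const_mul (n * v))).abs
  have t3 := ((t0.mul ta).const_mul (4 * (n : ℝ) ^ 2)).add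
    (ta.const_mul (M * (1 - δ)⁻¹ * (n : ℝ) ^ (1 - δ)))
  have hev : ∀ᶠ t in 𝓝[≠] (0 : ℝ), aFun D (t • EuclideanSpace.single i 1) < γ * logRatio n :=
    t0.eventually_lt_const (mul_pos E.γ_pos (logRatio_pos hn1))
  have h := le_of_tendsto_of_tendsto t2 t3 (by
    filter_upwards [hev, eventually_abs_le_one, self_mem_nhdsWithin] with t h1 h2 h3
    have hk := smul_single_mem_box h2 i
    set k := t • EuclideanSpace.single i (1 : ℝ)
    obtain ⟨HR, hw⟩ := ratioSeq H E hc hL hsmall hn hk h1.le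
    have ha0 : 0 ≤ aFun D k := aFun_nonneg hD.nonneg hD.normalised k
    have h4 := HR.abs_one_sub_sub_le ha0 (E.le_quarter hn1 h1.le) hw
    have h5 := h4.trans (add_le_add le_rfl (sum_rate_le E hM0 ha0 n))
    have ht : 0 < t ^ 2 := by
      have : t ≠ 0 := h3
      positivity
    have e1 : -((R.f n k z - R.f n 0 z) / t ^ 2) / R.f n 0 z - n * v * (aFun D k / t ^ 2) =
        (1 - R.f n k z / R.f n 0 z - n * (v * aFun D k)) / t ^ 2 := by
      field_simp
      ring
    have e2 : 4 * (n : ℝ) ^ 2 * (aFun D k * (aFun D k / t ^ 2)) +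
        M * (1 - δ)⁻¹ * (n : ℝ) ^ (1 - δ) * (aFun D k / t ^ 2) =
        (4 * (aFun D k * n) ^ 2 + M * (1 - δ)⁻¹ * (aFun D k * (n : ℝ) ^ (1 - δ))) / t ^ 2 := by
      field_simp
    rw [e1, e2, abs_div, abs_of_pos ht]
    gcongr)
  have hd' : (0 : ℝ) < 2 * d := by positivity
  have e1 : -(Laplacian.laplacian (fun k => R.f n k z) 0 / (2 * d)) / R.f n 0 z -
      n * v * (sigmaSq D / (2 * d)) =
      (-(Laplacian.laplacian (fun k => R.f n k z) 0) / R.f n 0 z - v * sigmaSq D * n) /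
        (2 * d) := by
    field_simp
  have e2 : 4 * (n : ℝ) ^ 2 * (0 * (sigmaSq D / (2 * d))) +
      M * (1 - δ)⁻¹ * (n : ℝ) ^ (1 - δ) * (sigmaSq D / (2 * d)) =
      M * (1 - δ)⁻¹ * (sigmaSq D * (n : ℝ) ^ (1 - δ)) / (2 * d) := by
    ring
  rw [e1, e2, abs_div, abs_of_pos hd', div_le_div_iff_of_pos_right hd'] at h
  exact h

end Regular

end LaceRecursion

namespace LaceRecursion

theorem abs_exp_sub_one_le_mul_exp (x : ℝ) : |Real.exp x - 1| ≤ |x| * Real.exp |x| := by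
  have h1 := Real.add_one_le_exp x
  have h2 := Real.add_one_le_exp (-x)
  have h3 : Real.exp (-x) * Real.exp x = 1 := by rw [← Real.exp_add]; simp
  have h4 := Real.exp_pos x
  have h5 : 1 ≤ Real.exp |x| := Real.one_le_exp (abs_nonneg x)
  rcases le_total 0 x with hx | hx
  · rw [abs_of_nonneg hx, abs_of_nonneg (by linarith)]
    nlinarith
  · have h6 : Real.exp x ≤ 1 := Real.exp_le_one_iff.2 hx
    rw [abs_of_nonpos (by linarith : Real.exp x - 1 ≤ 0)]
    nlinarith [abs_of_nonpos hx, abs_nonneg x]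

/-- If `F` is close to `e^{-t}` and `f₀` is close to `A`, then `f₀ F` is close to `A e^{-t}`. -/
theorem abs_mul_sub_mul_exp_le {f₀ F A t C₁ C₂ B x y : ℝ} (hF : 0 < F) (hf₀ : |f₀| ≤ 5 / 4)
    (hA : 3 / 4 ≤ A) (hC₁ : 0 ≤ C₁) (hx : 0 ≤ x) (hy : 0 ≤ y) (hxC : x ≤ C₂)
    (hlog : |Real.log F + t| ≤ C₁ * x) (h₀ : |f₀ - A| ≤ B * y) :
    |f₀ * F - A * Real.exp (-t)| ≤ A * Real.exp (-t) *
      ((2 * (C₁ * Real.exp (C₁ * C₂)) + 2 * |B|) * (x + y)) := by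
  set X := Real.log F + t with hX
  have hF' : F = Real.exp X * Real.exp (-t) := by
    rw [← Real.exp_add, hX, add_neg_cancel_right, Real.exp_log hF]
  have e : f₀ * F - A * Real.exp (-t) = Real.exp (-t) * (f₀ * (Real.exp X - 1) + (f₀ - A)) := by
    rw [hF']; ring
  have h1 : |Real.exp X - 1| ≤ C₁ * x * Real.exp (C₁ * C₂) := by
    refine (abs_exp_sub_one_le_mul_exp X).trans ?_
    have : |X| ≤ C₁ * C₂ := hlog.trans (by gcongr)
    gcongr
  have h2 : |f₀ * (Real.exp X - 1) + (f₀ - A)| ≤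
      5 / 4 * (C₁ * x * Real.exp (C₁ * C₂)) + |B| * y := by
    refine (abs_add_le _ _).trans (add_le_add ?_ (h₀.trans ?_))
    · rw [abs_mul]
      exact mul_le_mul hf₀ h1 (abs_nonneg _) (by norm_num)
    · gcongr
      exact le_abs_self B
  rw [e, abs_mul, abs_of_pos (Real.exp_pos _), mul_comm A, mul_assoc]
  gcongr
  refine h2.trans ?_
  set Q := C₁ * Real.exp (C₁ * C₂) with hQ
  have hQ0 : 0 ≤ Q := by positivity
  have h3 : 5 / 4 * (C₁ * x * Real.exp (C₁ * C₂)) = 5 / 4 * Q * x := by rw [hQ]; ring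
  rw [h3]
  have hB := abs_nonneg B
  have h4 : 0 ≤ (2 * Q + 2 * |B|) * (x + y) := by positivity
  have h5 : 0 ≤ Q * x := by positivity
  have h6 : 0 ≤ Q * y := by positivity
  have h7 : 0 ≤ |B| * x := by positivity
  have h8 : 0 ≤ |B| * y := by positivity
  nlinarith

variable {d : ℕ} {D : (Fin d → ℤ) → ℝ} {R : Recursion d} {C c₁ c₂ η ε L : ℝ}
  {δ s γ c z v A B : ℝ} {N : ℕ}

/-- The Taylor approximation of `n v a(q)` in the Gaussian region, and the size of the error. -/
theorem AssumptionD.exists_taylor_const (hD : AssumptionD C c₁ c₂ η ε L D R) (hS : AssumptionS R)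
    (hd : 0 < d) (hL : 1 ≤ L) (hc₁ : 0 < c₁) (hε : 0 < ε) (hsε : s ≤ ε)
    (E : Exponents ((d : ℝ) / 2) δ s γ) (hγη : γ ≤ η) (hv : 0 < v) :
    ∃ C₁ C₂ C₃ : ℝ, 0 ≤ C₁ ∧ 0 ≤ C₃ ∧ ∀ n : ℕ, 1 ≤ n → ∀ q ∈ box d, aFun D q ≤ γ * logRatio n →
      let t := v * sigmaSq D * n * ‖q‖ ^ 2
      |n * (v * aFun D q) - t / (2 * d)| ≤ C₁ * (t * (n : ℝ) ^ (-δ)) ∧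
      t * (n : ℝ) ^ (-δ) ≤ C₂ ∧ aFun D q * (n : ℝ) ^ (1 - δ) ≤ C₃ * (t * (n : ℝ) ^ (-δ)) := by
  have hσ := hD.sigmaSq_pos hS hd hL hc₁
  have hL0 : 0 < L := by linarith
  have hs0 : 0 < s := by linarith [E.δ_pos, E.δ_lt]
  have hpow := E.powConst_pos
  obtain ⟨S, hS0, hT⟩ : ∃ S : ℝ, 0 ≤ S ∧ ∀ q : EuclideanSpace ℝ (Fin d),
      |aFun D q - sigmaSq D / (2 * d) * ‖q‖ ^ 2| ≤ S * ‖q‖ ^ (2 + 2 * s) :=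
    ⟨_, mul_nonneg (by norm_num) (tsum_nonneg fun x => mul_nonneg (by positivity) (hD.nonneg x)),
      fun q => hD.abs_aFun_sub_le hS hε hs0.le E.s_lt_one.le hsε q⟩
  refine ⟨S * ((c₁ * L ^ 2) ^ (-s) * powConst δ s) / sigmaSq D,
    v * sigmaSq D / (c₁ * L ^ 2) * (γ * (1 + 1 / δ)), |c₂| * L ^ 2 / (v * sigmaSq D),
    by positivity, by positivity, ?_⟩
  intro n hn q hq ha t
  have hn1 : (1 : ℝ) ≤ n := by exact_mod_cast hn
  have hn0 : (0 : ℝ) < n := by linarith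
  have hγ := E.γ_pos
  have hδ := E.δ_pos
  have hlr := logRatio_le_one hn1
  have hlr0 := logRatio_pos hn1
  have haγ : aFun D q ≤ γ := by nlinarith
  have ha0 : 0 ≤ aFun D q := aFun_nonneg hD.nonneg hD.normalised q
  have hsm := fun i => (hD.abs_lt_of_aFun_le hq (haγ.trans hγη) i).le
  have hlow := hD.a_lower q hsm
  have hup := hD.a_upper q hsm
  have hcL : 0 < c₁ * L ^ 2 := by positivity
  set x := (n : ℝ) with hx
  set Y := x ^ (-δ) with hY
  have hY0 : 0 < Y := by positivity
  have hY1 : x ^ (1 - δ) = x * Y := by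
    rw [sub_eq_add_neg, Real.rpow_add hn0, Real.rpow_one]
  have hy : ‖q‖ ^ 2 ≤ aFun D q / (c₁ * L ^ 2) := by
    rw [le_div_iff₀ hcL]; linarith
  have ht : t = v * sigmaSq D * x * ‖q‖ ^ 2 := rfl
  refine ⟨?_, ?_, ?_⟩
  · have e1 : x * (v * aFun D q) - t / (2 * d) =
        v * x * (aFun D q - sigmaSq D / (2 * d) * ‖q‖ ^ 2) := by
      rw [ht]; ring
    have h1 : ‖q‖ ^ (2 + 2 * s) = ‖q‖ ^ 2 * (‖q‖ ^ 2) ^ s := by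
      rw [Real.rpow_add_of_nonneg (norm_nonneg q) (by norm_num) (by positivity),
        Real.rpow_mul (norm_nonneg q)]
      norm_num
    have h2 : (‖q‖ ^ 2) ^ s ≤ (c₁ * L ^ 2) ^ (-s) * (powConst δ s * Y) := by
      calc (‖q‖ ^ 2) ^ s ≤ (aFun D q / (c₁ * L ^ 2)) ^ s := by gcongr
        _ = (c₁ * L ^ 2) ^ (-s) * aFun D q ^ s := by
            rw [Real.div_rpow ha0 hcL.le, Real.rpow_neg hcL.le]; ring
        _ ≤ _ := by
            gcongr
            refine rpow_le_of_le_logRatio ha0 hn1 E.δ_lt hs0 ?_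
            have := E.γ_le
            nlinarith
    rw [e1, abs_mul, abs_of_pos (by positivity)]
    calc _ ≤ v * x * (S * (‖q‖ ^ 2 * ((c₁ * L ^ 2) ^ (-s) * (powConst δ s * Y)))) := by
          gcongr
          refine (hT q).trans ?_
          rw [h1]
          gcongr
      _ = _ := by rw [ht]; field_simp
  · have h1 := one_add_log_le hn1 hδ
    have h2 : aFun D q * x ≤ γ * (1 + Real.log x) := by
      have : γ * logRatio x * x = γ * (1 + Real.log x) := by
        rw [logRatio]; field_simp
      rw [← this]
      gcongr
    have h3 : aFun D q * x * Y ≤ γ * (1 + 1 / δ) := by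
      calc _ ≤ γ * ((1 + 1 / δ) * x ^ δ) * Y :=
            mul_le_mul_of_nonneg_right (h2.trans (by gcongr)) hY0.le
        _ = γ * (1 + 1 / δ) * (x ^ δ * Y) := by ring
        _ = _ := by rw [hY, ← Real.rpow_add hn0, add_neg_cancel, Real.rpow_zero, mul_one]
    calc t * Y ≤ v * sigmaSq D * x * (aFun D q / (c₁ * L ^ 2)) * Y := by
          rw [ht]; gcongr
      _ = v * sigmaSq D / (c₁ * L ^ 2) * (aFun D q * x * Y) := by ring
      _ ≤ _ := by gcongr
  · rw [hY1]
    calc _ ≤ |c₂| * L ^ 2 * ‖q‖ ^ 2 * (x * Y) := by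
          gcongr
          refine hup.trans ?_
          gcongr
          exact le_abs_self c₂
      _ = _ := by rw [ht]; field_simp

namespace Regular

/-- The local central limit theorem for `f_n`. -/
theorem exists_gaussian_bound (H : ∀ N, Regular δ s c L D R v N z) (hS : AssumptionS R)
    (hD : AssumptionD C c₁ c₂ η ε L D R) (hd : 0 < d) (hL : 1 ≤ L) (hc₁ : 0 < c₁) (hε : 0 < ε)
    (hsε : s ≤ ε) (E : Exponents ((d : ℝ) / 2) δ s γ) (hγη : γ ≤ η) (hc : 1 ≤ c)
    (hsmall : c * beta d L * smallConst ((d : ℝ) / 2) δ s ≤ 1) (hv : 0 < v) (hA : 3 / 4 ≤ A)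
    (hAB : ∀ n : ℕ, 1 ≤ n → |R.f n 0 z - A| ≤ B * (n : ℝ) ^ (-((d : ℝ) / 2 - 2))) :
    ∃ B' > 0, ∀ n : ℕ, 1 ≤ n → ∀ k q : EuclideanSpace ℝ (Fin d),
      q = (Real.sqrt (v * sigmaSq D * n))⁻¹ • k → q ∈ box d →
      aFun D q ≤ γ * logRatio n →
      |R.f n q z - A * Real.exp (-‖k‖ ^ 2 / (2 * d))| ≤
        A * Real.exp (-‖k‖ ^ 2 / (2 * d)) *
          (B' * (‖k‖ ^ 2 * (n : ℝ) ^ (-δ) + (n : ℝ) ^ (-((d : ℝ) - 4) / 2))) := by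
  have hL0 : 0 < L := by linarith
  have hβ : 0 < beta d L := beta_pos hL0
  have hσ := hD.sigmaSq_pos hS hd hL hc₁
  have hδ1 : δ < 1 := by linarith [E.δ_lt, E.s_lt_one]
  obtain ⟨C₁, C₂, C₃, hC₁, hC₃, hT⟩ :=
    hD.exists_taylor_const hS hd hL hc₁ hε hsε E hγη hv
  set M := rateConst ((d : ℝ) / 2) δ s * c * beta d L with hM
  have hM0 : 0 ≤ M := by have := E.rateConst_pos; positivity
  set P := 8 * (1 + 1 / (1 - δ)) + M * (1 - δ)⁻¹ with hP
  have hδ' : 0 < 1 - δ := by linarith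
  have hP0 : 0 ≤ P := by positivity
  set Q := P * C₃ + C₁ with hQ
  have hQ0 : 0 ≤ Q := by positivity
  refine ⟨2 * (Q * Real.exp (Q * C₂)) + 2 * |B| + 1, by positivity, ?_⟩
  intro n hn k q hqk hq ha
  have hn1 : (1 : ℝ) ≤ n := by exact_mod_cast hn
  have hn0 : (0 : ℝ) < n := by linarith
  obtain ⟨T1, T2, T3⟩ := hT n hn q hq ha
  have hk : v * sigmaSq D * n * ‖q‖ ^ 2 = ‖k‖ ^ 2 := by
    have h0 : 0 < v * sigmaSq D * n := by positivity
    rw [hqk, norm_smul, norm_inv, Real.norm_of_nonneg (Real.sqrt_nonneg _), mul_pow, inv_pow,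
      Real.sq_sqrt h0.le, mul_inv_cancel_left₀ h0.ne']
  rw [hk] at T1 T2 T3
  have ha0 : 0 ≤ aFun D q := aFun_nonneg hD.nonneg hD.normalised q
  have ha4 := E.le_quarter hn1 ha
  obtain ⟨HR, hw⟩ := ratioSeq H E hc hL0 hsmall hn hq ha
  have hF := HR.pos ha4 n le_rfl
  have hf := (H n).zero.mem_Icc E.two_lt hc hβ (E.two_rpow_mul_zetaSum_small (by positivity) hsmall) le_rfl
  simp only [mem_Icc] at hf
  have hp : 0 < R.f n 0 z := by linarith [hf.1]
  have h1 := (HR.abs_log_add_le ha0 ha4 hw).trans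
    (add_le_add le_rfl (sum_rate_le E hM0 ha0 n))
  have h2 : 8 * (n : ℝ) * aFun D q ^ 2 ≤
      8 * (1 + 1 / (1 - δ)) * (aFun D q * (n : ℝ) ^ (1 - δ)) := by
    have h3 : aFun D q ≤ logRatio n := by
      have := E.γ_le
      nlinarith [logRatio_pos hn1]
    have h4 := rpow_le_of_le_logRatio ha0 hn1 hδ1 one_pos h3
    rw [Real.rpow_one, Real.rpow_one] at h4
    rw [sub_eq_add_neg, Real.rpow_add hn0, Real.rpow_one, ← sub_eq_add_neg]
    calc _ = 8 * (n : ℝ) * aFun D q * aFun D q := by ring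
      _ ≤ 8 * (n : ℝ) * aFun D q * ((1 + 1 / (1 - δ)) * (n : ℝ) ^ (-δ)) := by gcongr
      _ = _ := by ring
  have hlog : |Real.log (R.f n q z / R.f n 0 z) + ‖k‖ ^ 2 / (2 * d)| ≤
      Q * (‖k‖ ^ 2 * (n : ℝ) ^ (-δ)) := by
    have e : Real.log (R.f n q z / R.f n 0 z) + ‖k‖ ^ 2 / (2 * d) =
        (Real.log (R.f n q z / R.f n 0 z) + n * (v * aFun D q)) -
        (n * (v * aFun D q) - ‖k‖ ^ 2 / (2 * d)) := by ring
    rw [e]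
    refine (abs_sub _ _).trans ?_
    have h5 : P * (aFun D q * (n : ℝ) ^ (1 - δ)) ≤ P * (C₃ * (‖k‖ ^ 2 * (n : ℝ) ^ (-δ))) := by
      gcongr
    have h6 : P * (aFun D q * (n : ℝ) ^ (1 - δ)) =
        8 * (1 + 1 / (1 - δ)) * (aFun D q * (n : ℝ) ^ (1 - δ)) +
        M * (1 - δ)⁻¹ * (aFun D q * (n : ℝ) ^ (1 - δ)) := by rw [hP]; ring
    have h7 : Q * (‖k‖ ^ 2 * (n : ℝ) ^ (-δ)) = P * (C₃ * (‖k‖ ^ 2 * (n : ℝ) ^ (-δ))) +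
        C₁ * (‖k‖ ^ 2 * (n : ℝ) ^ (-δ)) := by rw [hQ]; ring
    linarith
  have key := abs_mul_sub_mul_exp_le hF (abs_le.2 ⟨by linarith [hf.1], hf.2⟩) hA hQ0
    (by positivity : 0 ≤ ‖k‖ ^ 2 * (n : ℝ) ^ (-δ))
    (by positivity : 0 ≤ (n : ℝ) ^ (-((d : ℝ) / 2 - 2))) T2 hlog (hAB n hn)
  rw [mul_div_cancel₀ _ hp.ne'] at key
  rw [neg_div, show -((d : ℝ) - 4) / 2 = -((d : ℝ) / 2 - 2) by ring]
  have hA0 : 0 < A := by linarith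
  exact key.trans (mul_le_mul_of_nonneg_left
    (mul_le_mul_of_nonneg_right (by linarith) (by positivity)) (by positivity))

end Regular

end LaceRecursion

namespace LaceRecursion

theorem exists_exponents {θ δ ε η : ℝ} (hδ : 0 < δ) (hδ1 : δ < 1) (hδθ : δ < θ - 2) (hε : δ < ε)
    (hη : 0 < η) : ∃ s γ, Exponents θ δ s γ ∧ s ≤ ε ∧ γ ≤ η := by
  obtain ⟨s, hs, hs'⟩ := exists_between (lt_min hδ1 (lt_min hε hδθ))
  have h1 := hs'.trans_le (min_le_left _ _)
  have h2 := (hs'.trans_le (min_le_right _ _)).trans_le (min_le_left _ _)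
  have h3 := (hs'.trans_le (min_le_right _ _)).trans_le (min_le_right _ _)
  refine ⟨s, min (min (1 / 8) ((θ - 2 - s) / 16)) η,
    ⟨by linarith, hδ, hs, h1, h3, ?_, ?_, ?_⟩, h2.le, min_le_right _ _⟩
  · exact lt_min (lt_min (by norm_num) (by linarith)) hη
  · exact (min_le_left _ _).trans (min_le_left _ _)
  · have := (min_le_left (min (1 / 8) ((θ - 2 - s) / 16)) η).trans (min_le_right _ _)
    linarith

theorem beta_le {d : ℕ} (hd : 0 < d) {L β₀ : ℝ} (hL : 1 ≤ L) (hβ₀ : 0 < β₀) (h : β₀⁻¹ ≤ L) :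
    beta d L ≤ β₀ := by
  unfold beta
  rw [inv_le_comm₀ (by positivity) hβ₀]
  exact h.trans (le_self_pow₀ hL hd.ne')

end LaceRecursion

open LaceRecursion in
/-- The constants `L₀`, `γ`, `B` depend only on `d`, `δ` and the constants in the assumptions;
the constant `B'` in (a) may also depend on `L` and on the recursion. -/
theorem theorem1p1 (d : ℕ) (hd : 4 < d) (δ : ℝ) (hδ : 0 < δ) (hδ' : δ < min 1 (((d : ℝ) - 4) / 4))
    (C c₁ c₂ η ε : ℝ) (hc₁ : 0 < c₁) (hc₂ : 0 < c₂) (hη : 0 < η) (hε : δ < ε)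
    (Ce Cg : ℝ → ℝ) (LE LG : ℝ → ℝ → ℝ) :
    ∃ L₀ > 0, ∃ γ > 0, ∃ B > 0, ∀ L : ℝ, L₀ ≤ L →
      ∀ (D : (Fin d → ℤ) → ℝ) (R : Recursion d),
      AssumptionS R → AssumptionD C c₁ c₂ η ε L D R →
      AssumptionE Ce LE L D R → AssumptionG ε Cg LG L D R →
      ∃ zc > 0, ∃ A > 0, ∃ v > 0,
        (|zc - 1| ≤ B * beta d L ∧ |A - 1| ≤ B * beta d L ∧ |v - 1| ≤ B * beta d L) ∧
        -- (a)
        (∃ B' > 0, ∀ n : ℕ, 1 ≤ n → ∀ k q : EuclideanSpace ℝ (Fin d),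
          q = (Real.sqrt (v * sigmaSq D * n))⁻¹ • k → q ∈ box d →
          aFun D q ≤ γ * (n : ℝ)⁻¹ * Real.log n →
          |R.f n q zc - A * Real.exp (-‖k‖ ^ 2 / (2 * d))| ≤
            A * Real.exp (-‖k‖ ^ 2 / (2 * d)) *
              (B' * (‖k‖ ^ 2 * (n : ℝ) ^ (-δ) + (n : ℝ) ^ (-((d : ℝ) - 4) / 2)))) ∧
        -- (b)
        (∀ n : ℕ, 1 ≤ n → R.f n 0 zc ≠ 0 ∧
          |-(Laplacian.laplacian (fun k => R.f n k zc) 0) / R.f n 0 zc - v * sigmaSq D * n| ≤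
            v * sigmaSq D * n * (B * beta d L * (n : ℝ) ^ (-δ))) ∧
        -- (c)
        (∀ n : ℕ, 1 ≤ n → normOne (fun k => Dhat D k ^ 2 * R.f n k zc) ≤
          ENNReal.ofReal (B * beta d L * (n : ℝ) ^ (-(d : ℝ) / 2))) := by
  have hd0 : 0 < d := by omega
  have hδ1 : δ < 1 := hδ'.trans_le (min_le_left _ _)
  have hδ2 : δ < ((d : ℝ) - 4) / 4 := hδ'.trans_le (min_le_right _ _)
  obtain ⟨s, γ, E, hsε, hγη'⟩ := exists_exponents (θ := (d : ℝ) / 2) hδ hδ1 (by linarith) hε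
    (lt_min hη one_pos)
  have hγη : γ ≤ η := hγη'.trans (min_le_left _ _)
  obtain ⟨K₄, hK₄, htail⟩ := exists_tail_bound E (lt_min hη one_pos) (min_le_right η 1)
  obtain ⟨K, hK3, hKn⟩ : ∃ K, 3 ≤ K ∧ normConst d C c₁ η (γ / 8) K₄ ≤ K :=
    ⟨_, le_max_left _ _, le_max_right _ _⟩
  obtain ⟨c₀, hc₀⟩ : ∃ c₀, c₀ = 1 + |Ce K| + |Cg K| := ⟨_, rfl⟩
  have hc₀1 : 1 ≤ c₀ := by rw [hc₀]; linarith [abs_nonneg (Ce K), abs_nonneg (Cg K)]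
  obtain ⟨c, hc⟩ : ∃ c, c = regConst ((d : ℝ) / 2) δ c₀ := ⟨_, rfl⟩
  have hc1 : 1 ≤ c := by rw [hc]; linarith [E.two_mul_le_regConst hc₀1]
  obtain ⟨β₀, hβ₀, htail⟩ := htail c hc1
  have hr := E.rateConst_pos
  have hZ := E.one_le_zetaSum_sub_one
  have hδ3 : 0 < 1 - δ := by linarith
  obtain ⟨Bb, hBb⟩ : ∃ Bb, Bb = 2 * (rateConst ((d : ℝ) / 2) δ s * c * (1 - δ)⁻¹) := ⟨_, rfl⟩
  have hBb0 : 0 ≤ Bb := by rw [hBb]; positivity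
  obtain ⟨B, hB⟩ : ∃ B, B = c₀ + 4 * c * zetaSum ((d : ℝ) / 2 - 1) + 2 * c + Bb + K := ⟨_, rfl⟩
  have hZ0 : 0 ≤ 4 * c * zetaSum ((d : ℝ) / 2 - 1) := by positivity
  refine ⟨max 1 (max β₀⁻¹ (max (LE K (1 / 2)) (LG K (1 / 2)))), by positivity, γ, E.γ_pos, B,
    by linarith, ?_⟩
  intro L hL₀ D R hS hD hE hG
  simp only [max_le_iff] at hL₀
  obtain ⟨hL, hLβ, hLE, hLG⟩ := hL₀
  have hL0 : 0 < L := by linarith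
  have hβ : 0 < beta d L := beta_pos hL0
  obtain ⟨hsmall, htail⟩ := htail (beta d L) hβ (beta_le hd0 hL hβ₀ hLβ)
  obtain ⟨zc, v, hz, H, hF⟩ := exists_critical_point hS hD hE hG hd0 hc₁ hη hL E hsε hγη
    (min_le_left η 1) hLE hLG (by linarith) hK3 hKn hc₀ (hc ▸ hsmall) (hc ▸ htail)
  rw [← hc] at H
  have hcβ : 0 < c * beta d L := by positivity
  have hcβ8 := E.le_one_eighth hcβ hsmall
  have hc₀c : c₀ ≤ c := by rw [hc]; linarith [E.two_mul_le_regConst hc₀1]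
  have hzc : 0 < zc := by
    have h1 : c₀ * beta d L ≤ c * beta d L := by gcongr
    linarith [(abs_le.1 hz).1]
  have hv1 := ((H 1).point 0 zero_mem_box).abs_v_sub_one_le (H 1).zero one_pos
  have hv : 1 / 2 ≤ v := by linarith [(abs_le.1 hv1).1]
  obtain ⟨A, hA1, hA, B₂, hB₂⟩ := Regular.exists_amplitude H E hc1 hL0 hsmall
  have hσ := hD.sigmaSq_pos hS hd0 hL hc₁
  refine ⟨zc, hzc, A, by linarith, v, by linarith, ⟨?_, ?_, ?_⟩, ?_, fun n hn => ⟨?_, ?_⟩,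
    fun n hn => ?_⟩
  · refine hz.trans ?_
    gcongr
    linarith
  · refine hA1.trans ?_
    calc _ = 4 * c * zetaSum ((d : ℝ) / 2 - 1) * beta d L := by ring
      _ ≤ _ := by gcongr; linarith
  · refine hv1.trans ?_
    rw [← mul_assoc]
    gcongr
    linarith
  · obtain ⟨B', hB', h⟩ := Regular.exists_gaussian_bound H hS hD hd0 hL hc₁ (by linarith) hsε E hγη
      hc1 hsmall (by linarith : 0 < v) hA hB₂
    refine ⟨B', hB', fun n hn k q hqk hq ha => h n hn k q hqk hq (ha.trans ?_)⟩
    have hn0 : (0 : ℝ) < n := by exact_mod_cast hn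
    rw [mul_assoc, logRatio, div_eq_inv_mul]
    have := E.γ_pos
    gcongr
    linarith
  · have h := (H n).zero.mem_Icc E.two_lt hc1 hβ (E.two_rpow_mul_zetaSum_small hcβ hsmall) le_rfl
    simp only [mem_Icc] at h
    linarith [h.1]
  · refine (Regular.abs_laplacian_div_sub_le H hS hD hd0 E hc1 hL0 hsmall hzc hn).trans ?_
    have hn0 : (0 : ℝ) < n := by exact_mod_cast hn
    have e : (n : ℝ) ^ (1 - δ) = n * (n : ℝ) ^ (-δ) := by
      rw [sub_eq_add_neg, Real.rpow_add hn0, Real.rpow_one]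
    rw [e]
    calc _ = 1 / 2 * sigmaSq D * n * (Bb * beta d L * (n : ℝ) ^ (-δ)) := by rw [hBb]; ring
      _ ≤ _ := by gcongr; linarith
  · refine (hF n hn).norm_le.trans (ENNReal.ofReal_le_ofReal ?_)
    gcongr
    linarith
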